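/- Let $k$ be an algebraically closed field of characteristic $2$ and let $\mathbb{G}=G_1(\mathbb{P}^3)\subset\mathbb{P}^5$ be the Grassmannian of lines in $\mathbb{P}^3$ over $k$. Let $S\subset\mathbb{G}$ be an irreducible surface that is a smooth hyperplane section of a quadratic line complex, i.e. $S=\mathbb{G}\cap V(h)\cap V(q)$ is a smooth complete intersection with $h$ a linear form and $q$ a quadratic form in the Plücker coordinates (a quartic del Pezzo surface). For $s\in S$ let $\ell_s\subset\mathbb{P}^3$ be the corresponding line (a ray of $S$). Assume that $S$ has no fundamental curves, i.e. only finitely many points of $\mathbb{P}^3$ lie on infinitely many rays of $S$. Let $Z_S=\{(x,s)\in\mathbb{P}^3\times S: x\in\ell_s\}$, with projection $p_S:Z_S\to\mathbb{P}^3$. We say that a line $\ell\subset\mathbb{P}^3$ splits under $p_S$ if $p_S^{-1}(\ell)$ has exactly two irreducible components mapping onto $\ell$ (components contracted to a point are disregarded). Then: (1) $S$ has order $2$ and class $2$: exactly two rays pass through a general point of $\mathbb{P}^3$, and exactly two rays lie in a general plane. (2) $S$ is an irreducible component of the locus of points of $\mathbb{G}$ parametrizing the lines in $\mathbb{P}^3$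 that split under $p_S$. (3) Let $Z_S\to Z_S'\to\mathbb{P}^3$ be the Stein factorization of $p_S$, so that $Z_S'=\mathrm{Proj}\bigoplus_{d\ge0}H^0(Z_S,p_S^*\mathcal{O}_{\mathbb{P}^3}(d))$. There are forms $F_2,F_4$ in $x_0,\dots,x_3$, of degrees $2$ and $4$, such that $Z_S'$ is given over $\mathbb{P}^3$ by the equation $x_4^2+F_2x_4+F_4=0$ in $\mathbb{P}(1,1,1,1,2)$, i.e. $\bigoplus_{d\ge 0}H^0(Z_S,p_S^*\mathcal{O}_{\mathbb{P}^3}(d))\cong k[x_0,\dots,x_4]/(x_4^2+F_2x_4+F_4)$ as graded $k[x_0,\dots,x_3]$-algebras. For every such pair $(F_2,F_4)$, no ray of $S$ is contained in $Q=V(F_2)$. -/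

import Mathlib

open scoped LinearAlgebra.Projectivization

noncomputable section

namespace LineCongruence

variable (k : Type*) [Field k]

/-- A line in `ℙ³`: a two-dimensional subspace of `k⁴`. These are the points of the
Grassmannian `𝔾 = G₁(ℙ³)`. -/
structure Line where
  toSubmodule : Submodule k (Fin 4 → k)
  finrank_eq : Module.finrank k toSubmodule = 2

/-- A point of the point-line flag variety: a point of `ℙ³` together with a line through it. -/
structure Flag where
  pt : ℙ k (Fin 4 → k)
  line : Line k
  mem : pt.submodule ≤ line.toSubmodule

variable {k}

/-- The Plücker coordinates `(p₀₁, p₀₂, p₀₃, p₁₂, p₁₃, p₂₃)` of the pair `u, v`. -/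
def plucker (u v : Fin 4 → k) : Fin 6 → k :=
  ![u 0 * v 1 - u 1 * v 0, u 0 * v 2 - u 2 * v 0, u 0 * v 3 - u 3 * v 0,
    u 1 * v 2 - u 2 * v 1, u 1 * v 3 - u 3 * v 1, u 2 * v 3 - u 3 * v 2]

/-- The equation of the Grassmannian in `ℙ⁵`. -/
def pluckerQuadric (k : Type*) [Field k] : MvPolynomial (Fin 6) k :=
  MvPolynomial.X 0 * MvPolynomial.X 5 - MvPolynomial.X 1 * MvPolynomial.X 4
    + MvPolynomial.X 2 * MvPolynomial.X 3

/-- `p` is a vector of homogeneous Plücker coordinates of the line `L`. -/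
def Line.IsPluckerVector (L : Line k) (p : Fin 6 → k) : Prop :=
  ∃ u v : Fin 4 → k, Submodule.span k {u, v} = L.toSubmodule ∧ p = plucker u v

/-- The form `f` in the Plücker coordinates vanishes at the point `L` of the Grassmannian. -/
def Line.Vanishes (L : Line k) (f : MvPolynomial (Fin 6) k) : Prop :=
  ∀ p, L.IsPluckerVector p → MvPolynomial.eval p f = 0

/-- The set of points of `ℙ³` on the line `L`. -/
def Line.points (L : Line k) : Set (ℙ k (Fin 4 → k)) :=
  {x | x.submodule ≤ L.toSubmodule}

/-- Bihomogeneous polynomials of bidegree `(a, b)` in the coordinates of `ℙ³` and of `ℙ⁵`. -/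
def IsBihomogeneous (f : MvPolynomial (Fin 4 ⊕ Fin 6) k) (a b : ℕ) : Prop :=
  f.IsWeightedHomogeneous (Sum.elim (fun _ => 1) (fun _ => 0) : Fin 4 ⊕ Fin 6 → ℕ) a ∧
  f.IsWeightedHomogeneous (Sum.elim (fun _ => 0) (fun _ => 1) : Fin 4 ⊕ Fin 6 → ℕ) b

/-- The bihomogeneous polynomial `f` vanishes at the flag `z`. -/
def Flag.Vanishes (z : Flag k) (f : MvPolynomial (Fin 4 ⊕ Fin 6) k) : Prop :=
  ∀ p, z.line.IsPluckerVector p → MvPolynomial.eval (Sum.elim z.pt.rep p) f = 0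

/-- The Zariski topology of `ℙ³` (also used for the dual space of planes). -/
instance zariskiPoints : TopologicalSpace (ℙ k (Fin 4 → k)) :=
  TopologicalSpace.generateFrom
    {U | ∃ (n : ℕ) (f : MvPolynomial (Fin 4) k), f.IsHomogeneous n ∧
      U = {x | MvPolynomial.eval x.rep f ≠ 0}}

/-- The Zariski topology of the Grassmannian, induced by the Plücker embedding. -/
instance zariskiLines : TopologicalSpace (Line k) :=
  TopologicalSpace.generateFrom
    {U | ∃ (n : ℕ) (f : MvPolynomial (Fin 6) k), f.IsHomogeneous n ∧
      U = {L | ¬ L.Vanishes f}}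

/-- The Zariski topology of the flag variety, as a subvariety of `ℙ³ × ℙ⁵`. -/
instance zariskiFlags : TopologicalSpace (Flag k) :=
  TopologicalSpace.generateFrom
    {U | ∃ (a b : ℕ) (f : MvPolynomial (Fin 4 ⊕ Fin 6) k), IsBihomogeneous f a b ∧
      U = {z | ¬ z.Vanishes f}}

/-- The irreducible components of a subset `A` of a topological space: the maximal
irreducible subsets of `A`. -/
def componentsOf {X : Type*} [TopologicalSpace X] (A : Set X) : Set (Set X) :=
  {C | Maximal (fun T => IsIrreducible T ∧ T ⊆ A) C}

/-- The gradient of `f` at `p`. -/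
def gradient (f : MvPolynomial (Fin 6) k) (p : Fin 6 → k) : Fin 6 → k :=
  fun i => MvPolynomial.eval p (MvPolynomial.pderiv i f)

/-- The points of `ℙ³` through which infinitely many rays of `S` pass. -/
def fundamentalPoints (S : Set (Line k)) : Set (ℙ k (Fin 4 → k)) :=
  {x | {L | L ∈ S ∧ x ∈ L.points}.Infinite}

/-- `S` is an irreducible surface of lines that is a smooth hyperplane section of a quadratic
line complex (a quartic del Pezzo surface), without fundamental curves. Smoothness is the
Jacobian criterion for the complete intersection of the Plücker quadric, the
hyperplane `h = 0` and the quadric `q = 0` in `ℙ⁵`. -/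
structure IsDelPezzoCongruence (S : Set (Line k)) : Prop where
  irreducible : IsIrreducible S
  section_of_complex : ∃ h q : MvPolynomial (Fin 6) k, h.IsHomogeneous 1 ∧ q.IsHomogeneous 2 ∧
    S = {L | L.Vanishes h ∧ L.Vanishes q} ∧
    ∀ p : Fin 6 → k, p ≠ 0 → MvPolynomial.eval p (pluckerQuadric k) = 0 →
      MvPolynomial.eval p h = 0 → MvPolynomial.eval p q = 0 →
      LinearIndependent k ![gradient (pluckerQuadric k) p, gradient h p, gradient q p]
  no_fundamental_curve : (fundamentalPoints S).Finite

/-- The order of `S` is `m`: exactly `m` rays pass through a general point of `ℙ³`. -/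
def HasOrder (S : Set (Line k)) (m : ℕ) : Prop :=
  ∃ U : Set (ℙ k (Fin 4 → k)), IsOpen U ∧ U.Nonempty ∧
    ∀ x ∈ U, {L | L ∈ S ∧ x ∈ L.points}.encard = m

/-- The class of `S` is `n`: exactly `n` rays lie in a general plane of `ℙ³`, planes being
given by the points `a` of the dual projective space. -/
def HasClass (S : Set (Line k)) (n : ℕ) : Prop :=
  ∃ U : Set (ℙ k (Fin 4 → k)), IsOpen U ∧ U.Nonempty ∧
    ∀ a ∈ U, {L | L ∈ S ∧ ∀ v ∈ L.toSubmodule, a.rep ⬝ᵥ v = 0}.encard = n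

/-- The universal family of rays `Z_S = {(x, s) : x ∈ ℓ_s}`. Its projection
`p_S : Z_S → ℙ³` is `Flag.pt`. -/
def universalFamily (S : Set (Line k)) : Set (Flag k) :=
  {z | z.line ∈ S}

/-- The preimage of the line `ℓ` under `p_S : Z_S → ℙ³`. -/
def preimageOfLine (S : Set (Line k)) (l : Line k) : Set (Flag k) :=
  {z | z ∈ universalFamily S ∧ z.pt ∈ l.points}

/-- `ℓ` splits under `p_S : Z_S → ℙ³`: its preimage has exactly two irreducible components
lying over `ℓ`. (A component of the preimage that does not map onto `ℓ` is a curve contracted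
to a fundamental point; it is not a component of the double cover of `ℓ`.) -/
def Splits (S : Set (Line k)) (l : Line k) : Prop :=
  {C | C ∈ componentsOf (preimageOfLine S l) ∧ Flag.pt '' C = l.points}.encard = 2

/-- The locus of points in the Grassmannian parametrizing splitting lines. -/
def splittingLocus (S : Set (Line k)) : Set (Line k) :=
  {l | Splits S l}

/-- `σ` is a global section of `p_S^* 𝒪(d)` over `Z_S`, written as a function of a vector
`v ≠ 0` in `k⁴` and a ray `L` through the point `[v]`: locally it is a quotient of
bihomogeneous polynomials whose bidegrees differ by `(d, 0)`.
Values of `σ` at other arguments are irrelevant. -/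
def IsRegularSection (S : Set (Line k)) (d : ℕ) (σ : (Fin 4 → k) → Line k → k) : Prop :=
  ∀ L ∈ S, ∀ v ∈ L.toSubmodule, v ≠ 0 →
    ∃ (a b : ℕ) (f g : MvPolynomial (Fin 4 ⊕ Fin 6) k),
      IsBihomogeneous f (a + d) b ∧ IsBihomogeneous g a b ∧
      (∀ p, L.IsPluckerVector p → MvPolynomial.eval (Sum.elim v p) g ≠ 0) ∧
      ∀ L' ∈ S, ∀ v' ∈ L'.toSubmodule, v' ≠ 0 → ∀ p', L'.IsPluckerVector p' →
        MvPolynomial.eval (Sum.elim v' p') g ≠ 0 →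
        σ v' L' * MvPolynomial.eval (Sum.elim v' p') g = MvPolynomial.eval (Sum.elim v' p') f

/-- The finite part `Z_S' → ℙ³` of the Stein factorization `Z_S → Z_S' → ℙ³` of `p_S` is given
by the equation `x₄² + F₂ x₄ + F₄ = 0` in `ℙ(1,1,1,1,2)`. Here `Z_S'` is the `Proj` of the graded
ring of sections `⨁_d H⁰(Z_S, p_S^* 𝒪(d))`; the condition says that this ring is
`k[x₀, …, x₃][x₄] / (x₄² + F₂ x₄ + F₄)`, that is, there is a section `w` of degree two which
satisfies the equation, and every section of degree `d` is `A + B w` for a unique pair of forms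
`A`, `B` in `x₀, …, x₃` of degrees `d` and `d - 2` (with `B = 0` if `d < 2`). -/
def IsSteinEquation (S : Set (Line k)) (F₂ F₄ : MvPolynomial (Fin 4) k) : Prop :=
  F₂.IsHomogeneous 2 ∧ F₄.IsHomogeneous 4 ∧
  ∃ w : (Fin 4 → k) → Line k → k, IsRegularSection S 2 w ∧
    (∀ L ∈ S, ∀ v ∈ L.toSubmodule, v ≠ 0 →
      w v L ^ 2 + MvPolynomial.eval v F₂ * w v L + MvPolynomial.eval v F₄ = 0) ∧
    ∀ (d : ℕ) (σ : (Fin 4 → k) → Line k → k), IsRegularSection S d σ →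
      ∃! AB : MvPolynomial (Fin 4) k × MvPolynomial (Fin 4) k,
        AB.1.IsHomogeneous d ∧
        (AB.2 = 0 ∨ ∃ e, e + 2 = d ∧ AB.2.IsHomogeneous e) ∧
        ∀ L ∈ S, ∀ v ∈ L.toSubmodule, v ≠ 0 →
          σ v L = MvPolynomial.eval v AB.1 + MvPolynomial.eval v AB.2 * w v L

end LineCongruence

end

/-!
The proof is elementary: it works with the form `h = ∑ hᵢ pᵢ` and a matrix `b` of `q`, and with the
alternating form `om h` on `k⁴` attached to `h`.

**Reduction to symplectic geometry.** If the linear complex `h = 0` were special, all points of its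
axis would be fundamental. So `om h` is a symplectic form, and `S` consists of the isotropic lines
on which `q` vanishes (`IsDelPezzoCongruence.exists_isModel`). The rays through `[v]` are the zeros
of `q` on the pencil `v ∧ v^⊥`, which is a projective line. Points with `q = 0` on the whole pencil
(base points) are fundamental, so there are finitely many of them.

**The two forms.** For `u, u' ∈ v^⊥` the minors of `v ∧ u, v ∧ u'` are `om h u u'` times quadratic
forms in `v` (`pf_mul_minor`). Therefore the polar form of `q` on the pencil is `F₂(v) om h u u'`
(`bil_add_bil`) and the determinant of `b` on it is `F₄(v) (om h u u')²` (`bil_det`). In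
characteristic two the quadratic form on the pencil is separable exactly when `F₂(v) ≠ 0`.
Smoothness shows that `F₂` does not vanish identically on any ray: otherwise the derivative of `q` at the
Plücker vector of the ray would be a combination of `h` and of the derivative of the Plücker quadric
(`IsModel.exists_F₂fun_ne_zero`). Hence the order is two, and the class is two because the rays in
the plane `v^⊥` are the rays through `[v]` (`IsModel.hasOrder`, `IsModel.hasClass`).

**The Stein factorization.** The section `w` with `b(v ∧ u, v ∧ u') = w om h u u'` on the ray
`⟨v, u⟩` satisfies `w² + F₂ w + F₄ = 0` (`IsModel.sectionW_quadratic`), and a ray through a point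
which is not a base point can be recovered from its value (`IsModel.isPluckerVector_rayVector`).
Away from the base points any section is therefore locally `(f₀ + f₁ w) / n` with polynomials
`f₀, f₁, n`; the denominators cancel because base points have codimension at least two
(`IsModel.exists_eq_add_mul`, `IsModel.exists_isSteinEquation`). If `(F₂', F₄')` is another pair
then `F₂'` is a nonzero multiple of `F₂`, so it does not vanish on a ray either
(`IsModel.not_forall_eval_eq_zero`).

**Rays split.** Over a ray `l` the double cover is reducible: one component consists of the flags
with line `l`, the other is the closure of the flags given by the second ray through a general point
of `l`, whose Plücker vector is polynomial in the point (`IsModel.subset_splittingLocus`).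

**General splitting lines near `S` are rays.** If a line `l` avoids the base points and splits, then
`w² + F₂ w + F₄` has a polynomial root on `l` (`IsModel.exists_polynomial_root`). When `l` is not a
ray and its polar line avoids the base points, too, the rays given by this root contain a conic
(`IsModel.exists_mem_radical_of_isotropic`, `IsModel.exists_mem_radical_of_hyperbolic`). On the
plane of this conic `q` is a multiple `c Q` of the Plücker quadric, so that `q - c Q` is singular on the
hyperplane `h = 0`, at a point `r` of the plane (`exists_mem_radical_of_conic`); this `r` is
orthogonal to `l` with respect to `Q`. There are finitely many such `c`
(`finite_singularValues`); by smoothness each of them has just one vertex `r_c`, which is not the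
pole of the hyperplane `h = 0` (`IsModel.finrank_radical_le_one`,
`IsModel.nucleus_notMem_radical`). So a splitting line that is not a ray satisfies one of finitely
many closed conditions, none of which holds on all of `S`
(`IsModel.exists_finite_open`). As `S` is closed and irreducible, it is a component of the splitting
locus (`IsModel.mem_componentsOf_splittingLocus`).
-/

open scoped LinearAlgebra.Projectivization

namespace LineCongruence

variable {k : Type*} [Field k]

/-! ### Polynomial functions -/

lemma eval_aeval {σ τ : Type*} (x : σ → k) (P : τ → MvPolynomial σ k) (f : MvPolynomial τ k) :
    MvPolynomial.eval x (MvPolynomial.aeval P f)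
      = MvPolynomial.eval (fun i => MvPolynomial.eval x (P i)) f := by
  induction f using MvPolynomial.induction_on with
  | C a => simp
  | add p q hp hq => rw [map_add, map_add, map_add, hp, hq]
  | mul_X p i hp => rw [map_mul, map_mul, map_mul, hp, MvPolynomial.aeval_X, MvPolynomial.eval_X]

/-- `φ` is the function on the affine space `σ → k` defined by some polynomial. -/
def IsPoly {σ : Type*} (φ : (σ → k) → k) : Prop :=
  ∃ P : MvPolynomial σ k, ∀ x, MvPolynomial.eval x P = φ x

namespace IsPoly

variable {σ τ : Type*} {φ ψ : (σ → k) → k}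

lemma const (c : k) : IsPoly (fun _ : σ → k => c) := ⟨MvPolynomial.C c, by simp⟩

lemma coord (i : σ) : IsPoly (fun x : σ → k => x i) := ⟨MvPolynomial.X i, by simp⟩

lemma add (h₁ : IsPoly φ) (h₂ : IsPoly ψ) : IsPoly (fun x => φ x + ψ x) := by
  obtain ⟨P, hP⟩ := h₁
  obtain ⟨Q, hQ⟩ := h₂
  exact ⟨P + Q, by simp [hP, hQ]⟩

lemma sub (h₁ : IsPoly φ) (h₂ : IsPoly ψ) : IsPoly (fun x => φ x - ψ x) := by
  obtain ⟨P, hP⟩ := h₁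
  obtain ⟨Q, hQ⟩ := h₂
  exact ⟨P - Q, by simp [hP, hQ]⟩

lemma mul (h₁ : IsPoly φ) (h₂ : IsPoly ψ) : IsPoly (fun x => φ x * ψ x) := by
  obtain ⟨P, hP⟩ := h₁
  obtain ⟨Q, hQ⟩ := h₂
  exact ⟨P * Q, by simp [hP, hQ]⟩

lemma pow (h₁ : IsPoly φ) (n : ℕ) : IsPoly (fun x => φ x ^ n) := by
  obtain ⟨P, hP⟩ := h₁
  exact ⟨P ^ n, by simp [hP]⟩

lemma sum {ι : Type*} (s : Finset ι) {f : ι → (σ → k) → k} (h : ∀ i, IsPoly (f i)) :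
    IsPoly (fun x => ∑ i ∈ s, f i x) := by
  choose P hP using h
  exact ⟨∑ i ∈ s, P i, by simp [hP]⟩

lemma eval (f : MvPolynomial τ k) {g : (σ → k) → τ → k} (h : ∀ i, IsPoly (fun x => g x i)) :
    IsPoly (fun x => MvPolynomial.eval (g x) f) := by
  choose P hP using h
  refine ⟨MvPolynomial.aeval P f, fun x => ?_⟩
  rw [eval_aeval]
  simp only [hP]

lemma comp (h₁ : IsPoly φ) {g : (τ → k) → σ → k} (h : ∀ i, IsPoly (fun x => g x i)) :
    IsPoly (fun x => φ (g x)) := by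
  obtain ⟨P, hP⟩ := h₁
  simpa only [hP] using IsPoly.eval P h

/-- A product of two polynomial functions which do not vanish identically does not vanish
identically. -/
lemma exists_ne_zero_and [Infinite k] (h₁ : IsPoly φ) (h₂ : IsPoly ψ) (hφ : ∃ x, φ x ≠ 0)
    (hψ : ∃ x, ψ x ≠ 0) : ∃ x, φ x ≠ 0 ∧ ψ x ≠ 0 := by
  obtain ⟨P, hP⟩ := h₁
  obtain ⟨Q, hQ⟩ := h₂
  by_contra! H
  have : P * Q = 0 := MvPolynomial.funext fun x => by
    by_cases hx : φ x = 0
    · simp [hP, hx]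
    · simp [hQ, H x hx]
  rcases mul_eq_zero.1 this with h | h
  · obtain ⟨x, hx⟩ := hφ
    exact hx (by rw [← hP, h, map_zero])
  · obtain ⟨x, hx⟩ := hψ
    exact hx (by rw [← hQ, h, map_zero])

end IsPoly

lemma coeff_aeval_C_mul_X {σ : Type*} (c : σ → k) (f : MvPolynomial σ k) (d : σ →₀ ℕ) :
    (MvPolynomial.aeval (fun i => MvPolynomial.C (c i) * MvPolynomial.X i) f :
      MvPolynomial σ k).coeff d = f.coeff d * d.prod fun i n => c i ^ n := by
  classical
  induction f using MvPolynomial.induction_on' with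
  | monomial e a =>
    have : (MvPolynomial.aeval (fun i => MvPolynomial.C (c i) * MvPolynomial.X i)
        (MvPolynomial.monomial e a) : MvPolynomial σ k)
        = MvPolynomial.monomial e (a * e.prod fun i n => c i ^ n) := by
      rw [MvPolynomial.aeval_monomial]
      simp only [mul_pow, Finsupp.prod_mul, MvPolynomial.algebraMap_eq]
      rw [MvPolynomial.monomial_eq (s := e), MvPolynomial.C_mul]
      simp only [Finsupp.prod, map_prod, map_pow]
      ring
    rw [this, MvPolynomial.coeff_monomial, MvPolynomial.coeff_monomial]
    split_ifs with h
    · rw [h]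
    · simp
  | add p q hp hq => rw [map_add, MvPolynomial.coeff_add, hp, hq, MvPolynomial.coeff_add, add_mul]

/-- Over an infinite field, the weights of the monomials of a polynomial can be read off the scaling
behaviour of its values. -/
lemma weight_add_eq_of_eval [Infinite k] {σ : Type*} (wt : σ → ℕ) (m n : ℕ)
    {f : MvPolynomial σ k}
    (H : ∀ (c : k) (x : σ → k), c ≠ 0 →
      c ^ m * MvPolynomial.eval (fun i => c ^ wt i * x i) f = c ^ n * MvPolynomial.eval x f)
    {d : σ →₀ ℕ} (hd : f.coeff d ≠ 0) : Finsupp.weight wt d + m = n := by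
  have key : ∀ c : k, c ≠ 0 → c ^ (Finsupp.weight wt d + m) = c ^ n := fun c hc => by
    have h1 : MvPolynomial.C (c ^ m) *
        (MvPolynomial.aeval (fun i => MvPolynomial.C (c ^ wt i) * MvPolynomial.X i) f :
        MvPolynomial σ k) = MvPolynomial.C (c ^ n) * f := by
      refine MvPolynomial.funext fun x => ?_
      rw [map_mul, map_mul, MvPolynomial.eval_C, MvPolynomial.eval_C, ← H c x hc, eval_aeval]
      simp
    have h2 := congrArg (MvPolynomial.coeff d) h1
    rw [MvPolynomial.coeff_C_mul, coeff_aeval_C_mul_X, MvPolynomial.coeff_C_mul,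
      mul_left_comm, mul_comm (c ^ n)] at h2
    have h3 := mul_left_cancel₀ hd h2
    rw [← h3, pow_add, mul_comm, Finsupp.weight_apply, Finsupp.sum, Finsupp.prod,
      ← Finset.prod_pow_eq_pow_sum]
    congr 1
    refine Finset.prod_congr rfl fun i _ => ?_
    rw [← pow_mul, smul_eq_mul, mul_comm]
  have : (Polynomial.X ^ (Finsupp.weight wt d + m + 1) : Polynomial k)
      = Polynomial.X ^ (n + 1) := by
    refine Polynomial.funext fun c => ?_
    by_cases hc : c = 0
    · simp [hc]
    · simpa [pow_succ, hc] using key c hc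
  simpa using congrArg Polynomial.natDegree this

/-- Over an infinite field, weighted homogeneity can be read off the polynomial function. -/
lemma isWeightedHomogeneous_of_eval [Infinite k] {σ : Type*} (wt : σ → ℕ) (n : ℕ)
    (f : MvPolynomial σ k)
    (H : ∀ (c : k) (x : σ → k),
      MvPolynomial.eval (fun i => c ^ wt i * x i) f = c ^ n * MvPolynomial.eval x f) :
    f.IsWeightedHomogeneous wt n := fun d hd => by
  simpa using weight_add_eq_of_eval wt 0 n (fun c x _ => by rw [pow_zero, one_mul, H]) hd

lemma isHomogeneous_of_eval [Infinite k] {σ : Type*} (n : ℕ) (f : MvPolynomial σ k)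
    (H : ∀ (c : k) (x : σ → k), MvPolynomial.eval (c • x) f = c ^ n * MvPolynomial.eval x f) :
    f.IsHomogeneous n := by
  refine isWeightedHomogeneous_of_eval 1 n f fun c x => ?_
  rw [← H]
  congr 2
  ext i
  simp

lemma eval_weighted_smul {σ : Type*} {wt : σ → ℕ} {n : ℕ} {f : MvPolynomial σ k}
    (hf : f.IsWeightedHomogeneous wt n) (c : k) (x : σ → k) :
    MvPolynomial.eval (fun i => c ^ wt i * x i) f = c ^ n * MvPolynomial.eval x f := by
  rw [MvPolynomial.eval_eq, MvPolynomial.eval_eq, Finset.mul_sum]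
  refine Finset.sum_congr rfl fun d hd => ?_
  have := hf (MvPolynomial.mem_support_iff.1 hd)
  rw [← this, Finsupp.weight_apply, Finsupp.sum, ← Finset.prod_pow_eq_pow_sum]
  simp only [mul_pow, Finset.prod_mul_distrib, smul_eq_mul, mul_comm (d _), pow_mul]
  ring

lemma eval_smul_of_isHomogeneous {σ : Type*} {n : ℕ} {f : MvPolynomial σ k}
    (hf : f.IsHomogeneous n) (c : k) (x : σ → k) :
    MvPolynomial.eval (c • x) f = c ^ n * MvPolynomial.eval x f := by
  rw [← eval_weighted_smul (wt := 1) hf]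
  congr 2
  ext i
  simp

lemma IsBihomogeneous.eval_smul {f : MvPolynomial (Fin 4 ⊕ Fin 6) k} {a b : ℕ}
    (hf : IsBihomogeneous f a b) (c d : k) (v : Fin 4 → k) (p : Fin 6 → k) :
    MvPolynomial.eval (Sum.elim (c • v) (d • p)) f
      = c ^ a * d ^ b * MvPolynomial.eval (Sum.elim v p) f := by
  have h1 := eval_weighted_smul hf.1 c (Sum.elim v (d • p))
  have h2 := eval_weighted_smul hf.2 d (Sum.elim v p)
  have e1 : (fun i => c ^ (Sum.elim (fun _ => 1) (fun _ => 0) : Fin 4 ⊕ Fin 6 → ℕ) i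
      * (Sum.elim v (d • p) : Fin 4 ⊕ Fin 6 → k) i) = Sum.elim (c • v) (d • p) := by
    ext i; rcases i with i | i <;> simp
  have e2 : (fun i => d ^ (Sum.elim (fun _ => 0) (fun _ => 1) : Fin 4 ⊕ Fin 6 → ℕ) i
      * (Sum.elim v p : Fin 4 ⊕ Fin 6 → k) i) = Sum.elim v (d • p) := by
    ext i; rcases i with i | i <;> simp
  rw [e1] at h1
  rw [e2] at h2
  rw [h1, h2, mul_assoc]

/-- Bihomogeneous polynomials can be obtained from bihomogeneous polynomial functions. -/
lemma exists_isBihomogeneous [Infinite k] {φ : (Fin 4 → k) → (Fin 6 → k) → k}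
    (h : IsPoly fun x : Fin 4 ⊕ Fin 6 → k => φ (fun i => x (Sum.inl i)) fun i => x (Sum.inr i))
    {a b : ℕ} (h₁ : ∀ c v p, φ (c • v) p = c ^ a * φ v p)
    (h₂ : ∀ c v p, φ v (c • p) = c ^ b * φ v p) :
    ∃ f : MvPolynomial (Fin 4 ⊕ Fin 6) k, IsBihomogeneous f a b ∧
      ∀ v p, MvPolynomial.eval (Sum.elim v p) f = φ v p := by
  obtain ⟨f, hf⟩ := h
  refine ⟨f, ⟨?_, ?_⟩, fun v p => by simp [hf]⟩
  · refine isWeightedHomogeneous_of_eval _ _ _ fun c x => ?_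
    rw [hf, hf, ← h₁]
    refine congrArg₂ φ ?_ ?_ <;> ext i <;> simp
  · refine isWeightedHomogeneous_of_eval _ _ _ fun c x => ?_
    rw [hf, hf, ← h₂]
    refine congrArg₂ φ ?_ ?_ <;> ext i <;> simp

lemma IsBihomogeneous.mul {f g : MvPolynomial (Fin 4 ⊕ Fin 6) k} {a b a' b' : ℕ}
    (hf : IsBihomogeneous f a b) (hg : IsBihomogeneous g a' b') :
    IsBihomogeneous (f * g) (a + a') (b + b') :=
  ⟨hf.1.mul hg.1, hf.2.mul hg.2⟩

lemma isBihomogeneous_one : IsBihomogeneous (1 : MvPolynomial (Fin 4 ⊕ Fin 6) k) 0 0 :=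
  ⟨MvPolynomial.isWeightedHomogeneous_one _ _, MvPolynomial.isWeightedHomogeneous_one _ _⟩

/-! ### Lines, flags and their Plücker vectors -/

section plucker

variable (u u' v v' : Fin 4 → k) (c : k)

lemma plucker_add_left : plucker (u + u') v = plucker u v + plucker u' v := by
  ext i; fin_cases i <;> simp [plucker] <;> ring

lemma plucker_add_right : plucker u (v + v') = plucker u v + plucker u v' := by
  ext i; fin_cases i <;> simp [plucker] <;> ring

lemma plucker_smul_left : plucker (c • u) v = c • plucker u v := by
  ext i; fin_cases i <;> simp [plucker] <;> ring

lemma plucker_smul_right : plucker u (c • v) = c • plucker u v := by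
  ext i; fin_cases i <;> simp [plucker] <;> ring

@[simp] lemma plucker_self : plucker u u = 0 := by
  ext i; fin_cases i <;> simp [plucker] <;> ring

@[simp] lemma plucker_zero_left : plucker 0 v = 0 := by
  ext i; fin_cases i <;> simp [plucker]

@[simp] lemma plucker_zero_right : plucker u 0 = 0 := by
  ext i; fin_cases i <;> simp [plucker]

lemma plucker_swap [CharP k 2] : plucker u v = plucker v u := by
  ext i
  have h2 : (2 : k) = 0 := CharTwo.two_eq_zero
  fin_cases i <;> simp [plucker]
  · linear_combination (u 0 * v 1 - u 1 * v 0) * h2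
  · linear_combination (u 0 * v 2 - u 2 * v 0) * h2
  · linear_combination (u 0 * v 3 - u 3 * v 0) * h2
  · linear_combination (u 1 * v 2 - u 2 * v 1) * h2
  · linear_combination (u 1 * v 3 - u 3 * v 1) * h2
  · linear_combination (u 2 * v 3 - u 3 * v 2) * h2

end plucker

lemma mul_eq_mul_of_plucker_eq_zero {u v : Fin 4 → k} (h : plucker u v = 0) (i j : Fin 4) :
    u i * v j = u j * v i := by
  have h' := fun i => congrFun h i
  simp [Fin.forall_fin_succ, plucker, sub_eq_zero] at h'
  obtain ⟨h0, h1, h2, h3, h4, h5⟩ := h'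
  fin_cases i <;> fin_cases j <;> simp <;> first | rfl | assumption | (symm; assumption)

lemma exists_smul_of_plucker_eq_zero {u v : Fin 4 → k} (hu : u ≠ 0) (h : plucker u v = 0) :
    ∃ c : k, v = c • u := by
  obtain ⟨i, hi⟩ := Function.ne_iff.1 hu
  refine ⟨v i / u i, ?_⟩
  ext j
  have := mul_eq_mul_of_plucker_eq_zero h i j
  simp only [Pi.zero_apply] at hi
  simp only [Pi.smul_apply, smul_eq_mul]
  field_simp
  linear_combination this

lemma linearIndependent_pair_iff_plucker {u v : Fin 4 → k} :
    LinearIndependent k ![u, v] ↔ plucker u v ≠ 0 := by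
  rw [LinearIndependent.pair_iff]
  constructor
  · intro h h0
    by_cases hu : u = 0
    · exact one_ne_zero (h 1 0 (by simp [hu])).1
    · obtain ⟨c, hc⟩ := exists_smul_of_plucker_eq_zero hu h0
      have := (h c (-1) (by simp [hc])).2
      simp at this
  · intro h s t hst
    constructor
    · have : s • plucker u v = 0 := by
        have := congrArg (fun x => plucker x v) hst
        simpa [plucker_add_left, plucker_smul_left] using this
      exact (smul_eq_zero.1 this).resolve_right h
    · have : t • plucker u v = 0 := by
        have := congrArg (fun x => plucker u x) hst
        simpa [plucker_add_right, plucker_smul_right] using this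
      exact (smul_eq_zero.1 this).resolve_right h

lemma ne_zero_left_of_plucker {u v : Fin 4 → k} (h : plucker u v ≠ 0) : u ≠ 0 := by
  rintro rfl; simp at h

lemma ne_zero_right_of_plucker {u v : Fin 4 → k} (h : plucker u v ≠ 0) : v ≠ 0 := by
  rintro rfl; simp at h

/-- The line joining two distinct points, given by vectors which are linearly independent. -/
def lineOf (u v : Fin 4 → k) (h : plucker u v ≠ 0) : Line k where
  toSubmodule := Submodule.span k {u, v}
  finrank_eq := by
    have := finrank_span_eq_card (linearIndependent_pair_iff_plucker.2 h)
    rwa [Matrix.range_cons_cons_empty] at this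

lemma Line.ext' {L L' : Line k} (h : L.toSubmodule = L'.toSubmodule) : L = L' := by
  cases L; cases L'; simp only at h; subst h; rfl

lemma Line.exists_eq_lineOf (L : Line k) : ∃ u v, ∃ h : plucker u v ≠ 0, L = lineOf u v h := by
  let e := Module.finBasisOfFinrankEq k L.toSubmodule L.finrank_eq
  have hs : Submodule.span k {(e 0 : Fin 4 → k), (e 1 : Fin 4 → k)} = L.toSubmodule := by
    have h1 := congrArg (Submodule.map L.toSubmodule.subtype) e.span_eq
    rw [Submodule.map_span, Submodule.map_top, Submodule.range_subtype, ← Set.range_comp] at h1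
    refine Eq.trans (congrArg _ ?_) h1
    ext x
    simp [Fin.exists_fin_two, eq_comm]
  have hli : LinearIndependent k ![(e 0 : Fin 4 → k), (e 1 : Fin 4 → k)] := by
    have := e.linearIndependent.map' L.toSubmodule.subtype (Submodule.ker_subtype _)
    have h2 : (L.toSubmodule.subtype ∘ e) = ![(e 0 : Fin 4 → k), (e 1 : Fin 4 → k)] := by
      funext i
      fin_cases i <;> rfl
    rwa [h2] at this
  exact ⟨e 0, e 1, linearIndependent_pair_iff_plucker.1 hli, Line.ext' hs.symm⟩

lemma mem_lineOf {u v : Fin 4 → k} {h : plucker u v ≠ 0} {x : Fin 4 → k} :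
    x ∈ (lineOf u v h).toSubmodule ↔ ∃ s t : k, s • u + t • v = x :=
  Submodule.mem_span_pair

lemma left_mem_lineOf {u v : Fin 4 → k} {h : plucker u v ≠ 0} : u ∈ (lineOf u v h).toSubmodule :=
  Submodule.subset_span (by simp)

lemma right_mem_lineOf {u v : Fin 4 → k} {h : plucker u v ≠ 0} : v ∈ (lineOf u v h).toSubmodule :=
  Submodule.subset_span (by simp)

/-- Two distinct points of a line span it. -/
lemma Line.eq_lineOf {L : Line k} {u v : Fin 4 → k} (hu : u ∈ L.toSubmodule)
    (hv : v ∈ L.toSubmodule) (h : plucker u v ≠ 0) : L = lineOf u v h := by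
  refine Line.ext' (Submodule.eq_of_le_of_finrank_eq (Submodule.span_le.2 ?_) ?_).symm
  · rintro x (rfl | rfl) <;> assumption
  · rw [L.finrank_eq]
    exact (lineOf u v h).finrank_eq

lemma isPluckerVector_lineOf {u v : Fin 4 → k} {h : plucker u v ≠ 0} {p : Fin 6 → k} :
    (lineOf u v h).IsPluckerVector p ↔ ∃ c : k, c ≠ 0 ∧ p = c • plucker u v := by
  constructor
  · rintro ⟨u', v', hs, rfl⟩
    have hu : u' ∈ (lineOf u v h).toSubmodule := hs ▸ Submodule.subset_span (by simp)
    have hv : v' ∈ (lineOf u v h).toSubmodule := hs ▸ Submodule.subset_span (by simp)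
    have h0 : plucker u' v' ≠ 0 := by
      rw [← linearIndependent_pair_iff_plucker, linearIndependent_iff_card_eq_finrank_span]
      have : Set.range ![u', v'] = {u', v'} := by simp [Matrix.range_cons, Set.pair_comm]
      rw [Set.finrank, this, hs, (lineOf u v h).finrank_eq]
      simp
    obtain ⟨s, t, rfl⟩ := mem_lineOf.1 hu
    obtain ⟨s', t', rfl⟩ := mem_lineOf.1 hv
    have e : plucker (s • u + t • v) (s' • u + t' • v) = (s * t' - t * s') • plucker u v := by
      ext i; fin_cases i <;> simp [plucker] <;> ring
    refine ⟨_, fun hc => h0 ?_, e⟩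
    rw [e, hc, zero_smul]
  · rintro ⟨c, hc, rfl⟩
    have : plucker (c • u) v ≠ 0 := by
      rw [plucker_smul_left]; exact smul_ne_zero hc h
    refine ⟨c • u, v, ?_, (plucker_smul_left u v c).symm⟩
    have := Line.eq_lineOf (L := lineOf u v h)
      (Submodule.smul_mem _ c left_mem_lineOf) right_mem_lineOf this
    exact (congrArg Line.toSubmodule this).symm

lemma isPluckerVector_plucker {u v : Fin 4 → k} (h : plucker u v ≠ 0) :
    (lineOf u v h).IsPluckerVector (plucker u v) :=
  ⟨u, v, rfl, rfl⟩

lemma Line.IsPluckerVector.ne_zero {L : Line k} {p : Fin 6 → k} (h : L.IsPluckerVector p) :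
    p ≠ 0 := by
  obtain ⟨u, v, h0, rfl⟩ := L.exists_eq_lineOf
  obtain ⟨c, hc, rfl⟩ := isPluckerVector_lineOf.1 h
  exact smul_ne_zero hc h0

lemma Line.exists_isPluckerVector (L : Line k) : ∃ p, L.IsPluckerVector p := by
  obtain ⟨u, v, h0, rfl⟩ := L.exists_eq_lineOf
  exact ⟨_, isPluckerVector_plucker h0⟩

lemma Line.IsPluckerVector.smul {L : Line k} {p : Fin 6 → k} (h : L.IsPluckerVector p) {c : k}
    (hc : c ≠ 0) : L.IsPluckerVector (c • p) := by
  obtain ⟨u, v, h0, rfl⟩ := L.exists_eq_lineOf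
  obtain ⟨d, hd, rfl⟩ := isPluckerVector_lineOf.1 h
  exact isPluckerVector_lineOf.2 ⟨c * d, mul_ne_zero hc hd, smul_smul _ _ _⟩

lemma Line.IsPluckerVector.exists_smul {L : Line k} {p p' : Fin 6 → k} (h : L.IsPluckerVector p)
    (h' : L.IsPluckerVector p') : ∃ c : k, c ≠ 0 ∧ p' = c • p := by
  obtain ⟨u, v, h0, rfl⟩ := L.exists_eq_lineOf
  obtain ⟨c, hc, rfl⟩ := isPluckerVector_lineOf.1 h
  obtain ⟨d, hd, rfl⟩ := isPluckerVector_lineOf.1 h'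
  exact ⟨d / c, div_ne_zero hd hc, by rw [smul_smul, div_mul_cancel₀ _ hc]⟩

lemma Line.vanishes_iff {L : Line k} {p : Fin 6 → k} (h : L.IsPluckerVector p) {n : ℕ}
    {f : MvPolynomial (Fin 6) k} (hf : f.IsHomogeneous n) :
    L.Vanishes f ↔ MvPolynomial.eval p f = 0 := by
  refine ⟨fun H => H p h, fun H p' h' => ?_⟩
  obtain ⟨c, -, rfl⟩ := h.exists_smul h'
  rw [eval_smul_of_isHomogeneous hf, H, mul_zero]

/-- A line through `[v]` is the line through `[v]` and another point, and any of its Plücker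
vectors is of the form `v ∧ u`. -/
lemma Line.exists_plucker_eq {L : Line k} {v : Fin 4 → k} (hv : v ∈ L.toSubmodule) (hv0 : v ≠ 0)
    {p : Fin 6 → k} (hp : L.IsPluckerVector p) :
    ∃ u, ∃ h : plucker v u ≠ 0, L = lineOf v u h ∧ plucker v u = p := by
  obtain ⟨a, b, h0, rfl⟩ := L.exists_eq_lineOf
  have : ∃ u ∈ (lineOf a b h0).toSubmodule, plucker v u ≠ 0 := by
    by_contra! H
    obtain ⟨c, hc⟩ := exists_smul_of_plucker_eq_zero hv0 (H a left_mem_lineOf)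
    obtain ⟨d, hd⟩ := exists_smul_of_plucker_eq_zero hv0 (H b right_mem_lineOf)
    apply h0
    rw [hc, hd, plucker_smul_left, plucker_smul_right, plucker_self, smul_zero, smul_zero]
  obtain ⟨u, hu, hvu⟩ := this
  have hL := Line.eq_lineOf hv hu hvu
  rw [hL] at hp hv hu ⊢
  obtain ⟨c, hc, rfl⟩ := isPluckerVector_lineOf.1 hp
  have h1 : plucker v (c • u) ≠ 0 := by
    rw [plucker_smul_right]; exact smul_ne_zero hc hvu
  exact ⟨c • u, h1, Line.eq_lineOf hv (Submodule.smul_mem _ c hu) h1, plucker_smul_right _ _ _⟩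

lemma Line.exists_eq_lineOf_of_mem {L : Line k} {v : Fin 4 → k} (hv : v ∈ L.toSubmodule)
    (hv0 : v ≠ 0) : ∃ u, ∃ h : plucker v u ≠ 0, L = lineOf v u h := by
  obtain ⟨p, hp⟩ := L.exists_isPluckerVector
  obtain ⟨u, h, hL, -⟩ := L.exists_plucker_eq hv hv0 hp
  exact ⟨u, h, hL⟩

/-- The components of `x ∧ p`; they vanish if and only if `[x]` lies on the line `p`. -/
def incidence (x : Fin 4 → k) (p : Fin 6 → k) : Fin 4 → k :=
  ![x 1 * p 5 - x 2 * p 4 + x 3 * p 3, x 0 * p 5 - x 2 * p 2 + x 3 * p 1,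
    x 0 * p 4 - x 1 * p 2 + x 3 * p 0, x 0 * p 3 - x 1 * p 1 + x 2 * p 0]

lemma incidence_smul (x : Fin 4 → k) (c : k) (p : Fin 6 → k) :
    incidence x (c • p) = c • incidence x p := by
  ext i
  fin_cases i <;> simp [incidence] <;> ring

lemma mem_iff_incidence {L : Line k} {p : Fin 6 → k} (hp : L.IsPluckerVector p)
    (x : Fin 4 → k) : x ∈ L.toSubmodule ↔ incidence x p = 0 := by
  obtain ⟨u, v, h0, rfl⟩ := L.exists_eq_lineOf
  obtain ⟨c, hc, rfl⟩ := isPluckerVector_lineOf.1 hp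
  constructor
  · intro h
    obtain ⟨s, t, rfl⟩ := mem_lineOf.1 h
    ext i
    fin_cases i <;> simp [incidence, plucker] <;> ring
  · intro h
    have e := (smul_eq_zero.1 ((incidence_smul x c _).symm.trans h)).resolve_left hc
    obtain ⟨i, hi⟩ := Function.ne_iff.1 h0
    have h' := fun i => congrFun e i
    simp [Fin.forall_fin_succ, incidence, plucker] at h'
    obtain ⟨h1, h2, h3, h4⟩ := h'
    -- Cramer's rule in the coordinates `a, b` for which the minor of `u, v` does not vanish
    have cramer : ∀ a b j : Fin 4, (u a * v b - u b * v a) * x j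
        = (x a * v b - x b * v a) * u j + (u a * x b - u b * x a) * v j := by
      intro a b j
      fin_cases a <;> fin_cases b <;> fin_cases j <;>
        simp only [Fin.reduceFinMk, Fin.zero_eta, Fin.isValue, Fin.mk_one] <;>
        first
        | ring1
        | linear_combination h1
        | linear_combination h2
        | linear_combination h3
        | linear_combination h4
        | linear_combination -h1
        | linear_combination -h2
        | linear_combination -h3
        | linear_combination -h4
    have key : ∀ a b : Fin 4, u a * v b - u b * v a ≠ 0 → x ∈ (lineOf u v h0).toSubmodule := by
      intro a b hab
      refine mem_lineOf.2 ⟨(x a * v b - x b * v a) / (u a * v b - u b * v a),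
        (u a * x b - u b * x a) / (u a * v b - u b * v a), ?_⟩
      ext j
      rw [Pi.add_apply, Pi.smul_apply, Pi.smul_apply, smul_eq_mul, smul_eq_mul, div_mul_eq_mul_div,
        div_mul_eq_mul_div, ← add_div, ← cramer a b j, mul_div_cancel_left₀ _ hab]
    fin_cases i <;> simp [plucker] at hi
    exacts [key 0 1 hi, key 0 2 hi, key 0 3 hi, key 1 2 hi, key 1 3 hi, key 2 3 hi]

lemma Line.eq_of_isPluckerVector {L L' : Line k} {p : Fin 6 → k} (h : L.IsPluckerVector p)
    (h' : L'.IsPluckerVector p) : L = L' := by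
  refine Line.ext' ?_
  ext x
  rw [mem_iff_incidence h, mem_iff_incidence h']

lemma mem_points_iff {L : Line k} {x : ℙ k (Fin 4 → k)} :
    x ∈ L.points ↔ x.rep ∈ L.toSubmodule := by
  rw [Line.points, Set.mem_ofPred_eq, Projectivization.submodule_eq,
    Submodule.span_singleton_le_iff_mem]

lemma mk_mem_points_iff {L : Line k} {v : Fin 4 → k} (hv : v ≠ 0) :
    Projectivization.mk k v hv ∈ L.points ↔ v ∈ L.toSubmodule := by
  rw [Line.points, Set.mem_ofPred_eq, Projectivization.submodule_mk,
    Submodule.span_singleton_le_iff_mem]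

/-- The flag consisting of the point `[v]` and the line `L`. -/
def flagOf (v : Fin 4 → k) (L : Line k) (hv : v ≠ 0) (hL : v ∈ L.toSubmodule) : Flag k :=
  ⟨Projectivization.mk k v hv, L, (mk_mem_points_iff hv).2 hL⟩

lemma Flag.exists_eq_flagOf (z : Flag k) : ∃ v hv hL, z = flagOf v z.line hv hL := by
  obtain ⟨x, L, h⟩ := z
  refine ⟨x.rep, x.rep_nonzero, mem_points_iff.1 h, ?_⟩
  simp [flagOf]

lemma Flag.rep_mem (z : Flag k) : z.pt.rep ∈ z.line.toSubmodule := mem_points_iff.1 z.mem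

lemma flagOf_vanishes_iff {v : Fin 4 → k} {L : Line k} {hv : v ≠ 0} {hL : v ∈ L.toSubmodule}
    {p : Fin 6 → k} (hp : L.IsPluckerVector p) {f : MvPolynomial (Fin 4 ⊕ Fin 6) k} {a b : ℕ}
    (hf : IsBihomogeneous f a b) :
    (flagOf v L hv hL).Vanishes f ↔ MvPolynomial.eval (Sum.elim v p) f = 0 := by
  obtain ⟨c, hc⟩ := Projectivization.exists_smul_eq_mk_rep k v hv
  have hc' : (flagOf v L hv hL).pt.rep = (c : k) • v := hc.symm
  constructor
  · intro H
    have := H p hp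
    rw [hc', ← one_smul k p, hf.eval_smul] at this
    simpa using this
  · intro H p' hp'
    obtain ⟨d, -, rfl⟩ := hp.exists_smul hp'
    rw [hc', hf.eval_smul, H, mul_zero]

/-! ### Closed sets and irreducible sets in the Zariski topologies -/

lemma isOpen_not_vanishes {n : ℕ} {f : MvPolynomial (Fin 6) k} (hf : f.IsHomogeneous n) :
    IsOpen {L : Line k | ¬ L.Vanishes f} :=
  TopologicalSpace.isOpen_generateFrom_of_mem ⟨n, f, hf, rfl⟩

lemma isClosed_vanishes {n : ℕ} {f : MvPolynomial (Fin 6) k} (hf : f.IsHomogeneous n) :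
    IsClosed {L : Line k | L.Vanishes f} :=
  ⟨isOpen_not_vanishes hf⟩

lemma Flag.isOpen_not_vanishes {a b : ℕ} {f : MvPolynomial (Fin 4 ⊕ Fin 6) k}
    (hf : IsBihomogeneous f a b) : IsOpen {z : Flag k | ¬ z.Vanishes f} :=
  TopologicalSpace.isOpen_generateFrom_of_mem ⟨a, b, f, hf, rfl⟩

lemma Flag.isClosed_vanishes {a b : ℕ} {f : MvPolynomial (Fin 4 ⊕ Fin 6) k}
    (hf : IsBihomogeneous f a b) : IsClosed {z : Flag k | z.Vanishes f} :=
  ⟨Flag.isOpen_not_vanishes hf⟩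

lemma Flag.vanishes_mul {z : Flag k} {f g : MvPolynomial (Fin 4 ⊕ Fin 6) k} {a b a' b' : ℕ}
    (hf : IsBihomogeneous f a b) (hg : IsBihomogeneous g a' b') :
    z.Vanishes (f * g) ↔ z.Vanishes f ∨ z.Vanishes g := by
  obtain ⟨v, hv, hL, hz⟩ := z.exists_eq_flagOf
  obtain ⟨p, hp⟩ := z.line.exists_isPluckerVector
  rw [hz, flagOf_vanishes_iff hp (hf.mul hg), flagOf_vanishes_iff hp hf,
    flagOf_vanishes_iff hp hg, map_mul, mul_eq_zero]

lemma Flag.isTopologicalBasis : TopologicalSpace.IsTopologicalBasis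
    {U : Set (Flag k) | ∃ (a b : ℕ) (f : MvPolynomial (Fin 4 ⊕ Fin 6) k), IsBihomogeneous f a b ∧
      U = {z | ¬ z.Vanishes f}} where
  exists_subset_inter := by
    rintro _ ⟨a, b, f, hf, rfl⟩ _ ⟨a', b', g, hg, rfl⟩ x ⟨h1, h2⟩
    refine ⟨_, ⟨_, _, f * g, hf.mul hg, rfl⟩, ?_, fun z hz => ?_⟩
    · simp only [Set.mem_ofPred_eq] at h1 h2 ⊢
      rw [Flag.vanishes_mul hf hg]
      tauto
    · simp only [Set.mem_ofPred_eq, Set.mem_inter_iff] at hz ⊢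
      rw [Flag.vanishes_mul hf hg] at hz
      tauto
  sUnion_eq := by
    refine Set.eq_univ_of_forall fun z => ⟨_, ⟨0, 0, 1, isBihomogeneous_one, rfl⟩, fun h => ?_⟩
    obtain ⟨p, hp⟩ := z.line.exists_isPluckerVector
    simpa using h p hp
  eq_generateFrom := rfl

lemma Flag.isPreirreducible_iff {T : Set (Flag k)} : IsPreirreducible T ↔
    ∀ (a b a' b' : ℕ) (f g : MvPolynomial (Fin 4 ⊕ Fin 6) k), IsBihomogeneous f a b →
      IsBihomogeneous g a' b' → (∃ z ∈ T, ¬ z.Vanishes f) → (∃ z ∈ T, ¬ z.Vanishes g) →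
      ∃ z ∈ T, ¬ z.Vanishes f ∧ ¬ z.Vanishes g := by
  constructor
  · intro h a b a' b' f g hf hg h1 h2
    exact h _ _ (Flag.isOpen_not_vanishes hf) (Flag.isOpen_not_vanishes hg) h1 h2
  · rintro h U V hU hV ⟨x, hxT, hxU⟩ ⟨y, hyT, hyV⟩
    obtain ⟨_, ⟨a, b, f, hf, rfl⟩, hx, hfU⟩ :=
      Flag.isTopologicalBasis.exists_subset_of_mem_open hxU hU
    obtain ⟨_, ⟨a', b', g, hg, rfl⟩, hy, hgV⟩ :=
      Flag.isTopologicalBasis.exists_subset_of_mem_open hyV hV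
    obtain ⟨z, hz, h1, h2⟩ := h a b a' b' f g hf hg ⟨x, hxT, hx⟩ ⟨y, hyT, hy⟩
    exact ⟨z, hz, hfU h1, hgV h2⟩

lemma Flag.mem_closure_iff {T : Set (Flag k)} {z : Flag k} : z ∈ closure T ↔
    ∀ (a b : ℕ) (f : MvPolynomial (Fin 4 ⊕ Fin 6) k), IsBihomogeneous f a b → ¬ z.Vanishes f →
      ∃ z' ∈ T, ¬ z'.Vanishes f := by
  rw [Flag.isTopologicalBasis.mem_closure_iff]
  constructor
  · intro h a b f hf hz
    obtain ⟨z', h1, h2⟩ := h _ ⟨a, b, f, hf, rfl⟩ hz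
    exact ⟨z', h2, h1⟩
  · rintro h _ ⟨a, b, f, hf, rfl⟩ hz
    obtain ⟨z', h1, h2⟩ := h a b f hf hz
    exact ⟨z', h2, h1⟩

/-! ### The symplectic form of a linear complex -/

/-- The alternating form on `k⁴` corresponding to the linear form `∑ hᵢ pᵢ` in the Plücker
coordinates. -/
def om (h : Fin 6 → k) (u v : Fin 4 → k) : k := ∑ i, h i * plucker u v i

/-- The Pfaffian of the alternating form `om h`. -/
def pf (h : Fin 6 → k) : k := h 0 * h 5 - h 1 * h 4 + h 2 * h 3

/-- The bilinear form with matrix `b` on the space of Plücker vectors. -/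
def bil (b : Fin 6 → Fin 6 → k) (p p' : Fin 6 → k) : k := ∑ i, ∑ j, b i j * (p i * p' j)

/-- The polar form of the Plücker quadric. -/
def klein (p p' : Fin 6 → k) : k :=
  p 0 * p' 5 + p 5 * p' 0 - p 1 * p' 4 - p 4 * p' 1 + p 2 * p' 3 + p 3 * p' 2

/-- The quadratic form defining the Plücker quadric. -/
def kleinQ (p : Fin 6 → k) : k := p 0 * p 5 - p 1 * p 4 + p 2 * p 3

section om

variable (h : Fin 6 → k) (u u' v v' : Fin 4 → k) (c : k)

lemma om_add_left : om h (u + u') v = om h u v + om h u' v := by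
  simp [om, plucker_add_left, mul_add, Finset.sum_add_distrib]

lemma om_add_right : om h u (v + v') = om h u v + om h u v' := by
  simp [om, plucker_add_right, mul_add, Finset.sum_add_distrib]

lemma om_smul_left : om h (c • u) v = c * om h u v := by
  simp [om, plucker_smul_left, Finset.mul_sum, mul_left_comm]

lemma om_smul_right : om h u (c • v) = c * om h u v := by
  simp [om, plucker_smul_right, Finset.mul_sum, mul_left_comm]

@[simp] lemma om_self : om h u u = 0 := by simp [om]

lemma om_comm [CharP k 2] : om h u v = om h v u := by simp only [om, plucker_swap u v]

@[simp] lemma om_zero_left : om h 0 v = 0 := by simp [om]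

@[simp] lemma om_zero_right : om h u 0 = 0 := by simp [om]

end om

section bil

variable (b : Fin 6 → Fin 6 → k) (p p' q q' : Fin 6 → k) (c : k)

lemma bil_add_left : bil b (p + p') q = bil b p q + bil b p' q := by
  simp [bil, mul_add, add_mul, Finset.sum_add_distrib]

lemma bil_add_right : bil b p (q + q') = bil b p q + bil b p q' := by
  simp [bil, mul_add, Finset.sum_add_distrib]

lemma bil_smul_left : bil b (c • p) q = c * bil b p q := by
  simp only [bil, Finset.mul_sum, Pi.smul_apply, smul_eq_mul]
  exact Finset.sum_congr rfl fun i _ => Finset.sum_congr rfl fun j _ => by ring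

lemma bil_smul_right : bil b p (c • q) = c * bil b p q := by
  simp only [bil, Finset.mul_sum, Pi.smul_apply, smul_eq_mul]
  exact Finset.sum_congr rfl fun i _ => Finset.sum_congr rfl fun j _ => by ring

lemma klein_add_left : klein (p + p') q = klein p q + klein p' q := by
  simp [klein]; ring

lemma klein_add_right : klein p (q + q') = klein p q + klein p q' := by
  simp [klein]; ring

lemma klein_smul_left : klein (c • p) q = c * klein p q := by
  simp [klein]; ring

lemma klein_smul_right : klein p (c • q) = c * klein p q := by
  simp [klein]; ring

lemma klein_comm : klein p q = klein q p := by
  simp [klein]; ring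

lemma kleinQ_add : kleinQ (p + q) = kleinQ p + kleinQ q + klein p q := by
  simp [klein, kleinQ]; ring

lemma kleinQ_smul : kleinQ (c • p) = c ^ 2 * kleinQ p := by
  simp [kleinQ]; ring

end bil

@[simp] lemma kleinQ_plucker (u v : Fin 4 → k) : kleinQ (plucker u v) = 0 := by
  simp [kleinQ, plucker]; ring

@[simp] lemma klein_plucker_left (u v x : Fin 4 → k) :
    klein (plucker u v) (plucker u x) = 0 := by
  simp [klein, plucker]; ring

/-- Evaluation of the identity `Pf(ω) · vol = ω ∧ ω / 2`. -/
lemma pf_mul_klein (h : Fin 6 → k) (a b c d : Fin 4 → k) :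
    pf h * klein (plucker a b) (plucker c d)
      = om h a b * om h c d - om h a c * om h b d + om h a d * om h b c := by
  simp [pf, klein, om, plucker, Fin.sum_univ_succ]; ring

lemma exists_om_ne_zero {h : Fin 6 → k} (hpf : pf h ≠ 0) {v : Fin 4 → k} (hv : v ≠ 0) :
    ∃ x, om h v x ≠ 0 := by
  by_contra! H
  apply hv
  have e0 := H (Pi.single 0 1)
  have e1 := H (Pi.single 1 1)
  have e2 := H (Pi.single 2 1)
  have e3 := H (Pi.single 3 1)
  simp [om, plucker, Fin.sum_univ_succ] at e0 e1 e2 e3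
  ext i
  apply mul_left_cancel₀ hpf
  rw [pf]
  fin_cases i <;>
    simp only [Fin.zero_eta, Fin.mk_one, Fin.reduceFinMk, Fin.isValue, Pi.zero_apply]
  · linear_combination h 5 * e1 - h 4 * e2 + h 3 * e3
  · linear_combination - h 5 * e0 + h 2 * e2 - h 1 * e3
  · linear_combination h 4 * e0 - h 2 * e1 + h 0 * e3
  · linear_combination - h 3 * e0 + h 1 * e1 - h 0 * e2

/-- `e₁, e₂, f₁, f₂` is a symplectic basis for `om h`. -/
structure IsSymp (h : Fin 6 → k) (e₁ e₂ f₁ f₂ : Fin 4 → k) : Prop where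
  e₁f₁ : om h e₁ f₁ = 1
  e₂f₂ : om h e₂ f₂ = 1
  e₁e₂ : om h e₁ e₂ = 0
  f₁f₂ : om h f₁ f₂ = 0
  e₁f₂ : om h e₁ f₂ = 0
  e₂f₁ : om h e₂ f₁ = 0

section symp

variable [CharP k 2] {h : Fin 6 → k} {e₁ e₂ f₁ f₂ : Fin 4 → k}

lemma IsSymp.pf_mul_klein (H : IsSymp h e₁ e₂ f₁ f₂) :
    pf h * klein (plucker e₁ e₂) (plucker f₁ f₂) = 1 := by
  rw [LineCongruence.pf_mul_klein, H.e₁e₂, H.f₁f₂, H.e₁f₁, H.e₂f₂, H.e₁f₂, H.e₂f₁]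
  linear_combination -(CharTwo.two_eq_zero : (2 : k) = 0)

lemma IsSymp.plucker_ne_zero (H : IsSymp h e₁ e₂ f₁ f₂) : plucker e₁ e₂ ≠ 0 := by
  intro h0
  have := H.pf_mul_klein
  simp [h0, klein] at this

/-- The coordinates with respect to a symplectic basis. -/
lemma IsSymp.expand (H : IsSymp h e₁ e₂ f₁ f₂) (y : Fin 4 → k) :
    y = om h y f₁ • e₁ + om h y f₂ • e₂ + om h y e₁ • f₁ + om h y e₂ • f₂ := by
  have hli : LinearIndependent k ![e₁, e₂, f₁, f₂] := by
    rw [Fintype.linearIndependent_iff]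
    intro g hg
    simp only [Fin.sum_univ_four, Matrix.cons_val] at hg
    have t1 := congrArg (fun x => om h x f₁) hg
    have t2 := congrArg (fun x => om h x f₂) hg
    have t3 := congrArg (fun x => om h x e₁) hg
    have t4 := congrArg (fun x => om h x e₂) hg
    simp only [om_add_left, om_smul_left, om_zero_left, H.e₁f₁, H.e₂f₁, H.e₁f₂, H.e₂f₂, om_self,
      om_comm h f₁ e₁, om_comm h f₁ e₂, om_comm h f₂ e₁, om_comm h f₂ e₂, om_comm h e₂ e₁, H.e₁e₂,
      om_comm h f₂ f₁, H.f₁f₂, mul_zero, mul_one, add_zero, zero_add] at t1 t2 t3 t4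
    intro i
    fin_cases i <;> assumption
  have hs := hli.span_eq_top_of_card_eq_finrank' (by simp)
  have hy : y ∈ Submodule.span k (Set.range ![e₁, e₂, f₁, f₂]) := hs ▸ Submodule.mem_top
  obtain ⟨g, rfl⟩ := (Submodule.mem_span_range_iff_exists_fun k).1 hy
  simp only [Fin.sum_univ_four, Matrix.cons_val, om_add_left, om_smul_left, H.e₁f₁, H.e₂f₁,
    H.e₁f₂, H.e₂f₂, om_self, om_comm h f₁ e₁, om_comm h f₁ e₂, om_comm h f₂ e₁, om_comm h f₂ e₂,
    om_comm h e₂ e₁, H.e₁e₂, om_comm h f₂ f₁, H.f₁f₂, mul_zero, mul_one, add_zero, zero_add]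

lemma IsSymp.swap (H : IsSymp h e₁ e₂ f₁ f₂) : IsSymp h e₂ e₁ f₂ f₁ :=
  ⟨H.e₂f₂, H.e₁f₁, by rw [om_comm, H.e₁e₂], by rw [om_comm, H.f₁f₂], H.e₂f₁, H.e₁f₂⟩

/-- Two independent vectors spanning an isotropic plane extend to a symplectic basis. -/
lemma exists_isSymp_of_isotropic (hpf : pf h ≠ 0) (hi : plucker e₁ e₂ ≠ 0)
    (h0 : om h e₁ e₂ = 0) : ∃ f₁ f₂, IsSymp h e₁ e₂ f₁ f₂ := by
  have key : ∀ a b : Fin 4 → k, plucker a b ≠ 0 → ∃ x, om h a x = 1 ∧ om h b x = 0 := by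
    intro a b hab
    by_contra! H
    have H' : ∀ x, om h b x = 0 → om h a x = 0 := by
      intro x hx
      by_contra hx'
      exact H ((om h a x)⁻¹ • x) (by rw [om_smul_right, inv_mul_cancel₀ hx'])
        (by rw [om_smul_right, hx, mul_zero])
    obtain ⟨x, hx⟩ := exists_om_ne_zero hpf (ne_zero_right_of_plucker hab)
    have h1 : a = (om h a x / om h b x) • b := by
      by_contra hne
      obtain ⟨y, hy⟩ := exists_om_ne_zero hpf (sub_ne_zero.2 hne)
      apply hy
      have := H' (om h b x • y + (-om h b y) • x)
        (by simp only [om_add_right, om_smul_right]; ring)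
      simp only [om_add_right, om_smul_right] at this
      rw [sub_eq_add_neg, ← neg_one_smul k (_ • b)]
      simp only [om_add_left, om_smul_left]
      field_simp
      linear_combination this
    apply hab
    rw [h1, plucker_smul_left, plucker_self, smul_zero]
  obtain ⟨f₁, h1, h2⟩ := key e₁ e₂ hi
  obtain ⟨f₂, h3, h4⟩ := key e₂ e₁ (by rwa [plucker_swap])
  refine ⟨f₁, f₂ + om h f₁ f₂ • e₁, h1, ?_, h0, ?_, ?_, h2⟩
  · rw [om_add_right, om_smul_right, om_comm h e₂ e₁, h0, h3, mul_zero, add_zero]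
  · rw [om_add_right, om_smul_right, om_comm h f₁ e₁, h1, mul_one, CharTwo.add_self_eq_zero]
  · rw [om_add_right, om_smul_right, om_self, h4, mul_zero, add_zero]

/-- A hyperbolic pair extends to a symplectic basis. -/
lemma exists_isSymp_of_hyperbolic (hpf : pf h ≠ 0) (h1 : om h e₁ f₁ = 1) :
    ∃ e₂ f₂, IsSymp h e₁ e₂ f₁ f₂ := by
  have horth : ∀ z, om h e₁ (z + om h z f₁ • e₁ + om h e₁ z • f₁) = 0 ∧
      om h f₁ (z + om h z f₁ • e₁ + om h e₁ z • f₁) = 0 := by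
    intro z
    simp only [om_add_right, om_smul_right, om_self, h1, om_comm h f₁ e₁, om_comm h f₁ z]
    constructor
    · linear_combination om h e₁ z * (CharTwo.two_eq_zero : (2 : k) = 0)
    · linear_combination om h z f₁ * (CharTwo.two_eq_zero : (2 : k) = 0)
  have hz : ∃ z, z + om h z f₁ • e₁ + om h e₁ z • f₁ ≠ 0 := by
    by_contra! H
    classical
    have htop : (⊤ : Submodule k (Fin 4 → k)) ≤
        Submodule.span k (({e₁, f₁} : Finset (Fin 4 → k)) : Set (Fin 4 → k)) := by
      intro z _
      rw [Finset.coe_pair]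
      refine Submodule.mem_span_pair.2 ⟨-om h z f₁, -om h e₁ z, ?_⟩
      rw [← sub_eq_zero, ← neg_eq_zero, ← H z]
      module
    have h2 := (Submodule.finrank_mono htop).trans (finrank_span_finset_le_card _)
    have h3 := Finset.card_le_two (a := e₁) (b := f₁)
    rw [finrank_top, Module.finrank_fin_fun] at h2
    omega
  obtain ⟨z, hz⟩ := hz
  obtain ⟨x, hx⟩ := exists_om_ne_zero hpf hz
  obtain ⟨he, hf⟩ := horth z
  set e₂ := z + om h z f₁ • e₁ + om h e₁ z • f₁
  obtain ⟨he', hf'⟩ := horth x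
  refine ⟨e₂, (om h e₂ x)⁻¹ • (x + om h x f₁ • e₁ + om h e₁ x • f₁), h1, ?_, he, ?_, ?_, ?_⟩
  · rw [om_smul_right, om_add_right, om_add_right, om_smul_right, om_smul_right, om_comm h e₂ e₁,
      om_comm h e₂ f₁, he, hf, mul_zero, mul_zero, add_zero, add_zero, inv_mul_cancel₀ hx]
  · rw [om_smul_right, hf', mul_zero]
  · rw [om_smul_right, he', mul_zero]
  · rw [om_comm, hf]

lemma exists_isSymp (hpf : pf h ≠ 0) (h1 : e₁ ≠ 0) : ∃ e₂ f₁ f₂, IsSymp h e₁ e₂ f₁ f₂ := by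
  obtain ⟨x, hx⟩ := exists_om_ne_zero hpf h1
  obtain ⟨e₂, f₂, H⟩ := exists_isSymp_of_hyperbolic hpf (e₁ := e₁) (f₁ := (om h e₁ x)⁻¹ • x)
    (by rw [om_smul_right, inv_mul_cancel₀ hx])
  exact ⟨e₂, _, f₂, H⟩

/-- The orthogonal complement of `e₁`. -/
lemma IsSymp.eq_of_om_eq_zero (H : IsSymp h e₁ e₂ f₁ f₂) {y : Fin 4 → k} (hy : om h e₁ y = 0) :
    y = om h y f₁ • e₁ + om h y f₂ • e₂ + om h y e₂ • f₂ := by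
  have := H.expand y
  rwa [om_comm h y e₁, hy, zero_smul, add_zero] at this

lemma IsSymp.plucker_eq_of_om_eq_zero (H : IsSymp h e₁ e₂ f₁ f₂) {y : Fin 4 → k}
    (hy : om h e₁ y = 0) :
    plucker e₁ y = om h y f₂ • plucker e₁ e₂ + om h y e₂ • plucker e₁ f₂ := by
  conv_lhs => rw [H.eq_of_om_eq_zero hy]
  simp only [plucker_add_right, plucker_smul_right, plucker_self, smul_zero, zero_add]

end symp

/-! ### The two forms `F₂` and `F₄` -/

/-- The linear forms `om h v eᵢ` in `v`, for the standard basis `eᵢ`. -/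
def covec (h : Fin 6 → k) (v : Fin 4 → k) : Fin 4 → k := fun i => om h v (Pi.single i 1)

/-- The quadratic forms in `v` which give the Plücker coordinates of the line
`{v ∧ u | u ∈ v^⊥}` on the hyperplane section of the Grassmannian, see `pf_mul_minor`. -/
def theta (h : Fin 6 → k) (v : Fin 4 → k) : Fin 6 → Fin 6 → k :=
  let W := covec h v
  ![![0, v 0 * W 3, -(v 0 * W 2), v 1 * W 3, -(v 1 * W 2), v 0 * W 0 + v 1 * W 1],
    ![-(v 0 * W 3), 0, v 0 * W 1, v 2 * W 3, -(v 0 * W 0) - v 2 * W 2, v 2 * W 1],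
    ![v 0 * W 2, -(v 0 * W 1), 0, v 0 * W 0 + v 3 * W 3, -(v 3 * W 2), v 3 * W 1],
    ![-(v 1 * W 3), -(v 2 * W 3), -(v 0 * W 0) - v 3 * W 3, 0, -(v 1 * W 0), -(v 2 * W 0)],
    ![v 1 * W 2, v 0 * W 0 + v 2 * W 2, v 3 * W 2, v 1 * W 0, 0, -(v 3 * W 0)],
    ![-(v 0 * W 0) - v 1 * W 1, -(v 2 * W 1), -(v 3 * W 1), v 2 * W 0, v 3 * W 0, 0]]

/-- The `2 × 2` minors of a pair of lines of the pencil `v ∧ v^⊥` are those of the pencil itself,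
scaled by the value of the symplectic form. -/
lemma pf_mul_minor (h : Fin 6 → k) {v u u' : Fin 4 → k} (hu : om h v u = 0)
    (hu' : om h v u' = 0) (i j : Fin 6) :
    pf h * (plucker v u i * plucker v u' j - plucker v u j * plucker v u' i)
      = om h u u' * theta h v i j := by
  have D : ∀ a, pf h * klein (plucker v u) (plucker u' (Pi.single a 1))
      = covec h v a * om h u u' := fun a => by
    rw [pf_mul_klein, hu, hu', covec]; ring
  have D0 := D 0
  have D1 := D 1
  have D2 := D 2
  have D3 := D 3
  simp [klein, plucker] at D0 D1 D2 D3
  fin_cases i <;> fin_cases j <;>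
    simp only [theta, plucker, Fin.reduceFinMk, Fin.zero_eta, Fin.isValue, Fin.mk_one,
      Matrix.cons_val]
  · ring
  · linear_combination v 0 * D3
  · linear_combination -v 0 * D2
  · linear_combination v 1 * D3
  · linear_combination -v 1 * D2
  · linear_combination v 0 * D0 + v 1 * D1
  · linear_combination -v 0 * D3
  · ring
  · linear_combination v 0 * D1
  · linear_combination v 2 * D3
  · linear_combination -v 0 * D0 - v 2 * D2
  · linear_combination v 2 * D1
  · linear_combination v 0 * D2
  · linear_combination -v 0 * D1
  · ring
  · linear_combination v 0 * D0 + v 3 * D3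
  · linear_combination -v 3 * D2
  · linear_combination v 3 * D1
  · linear_combination -v 1 * D3
  · linear_combination -v 2 * D3
  · linear_combination -v 0 * D0 - v 3 * D3
  · ring
  · linear_combination -v 1 * D0
  · linear_combination -v 2 * D0
  · linear_combination v 1 * D2
  · linear_combination v 0 * D0 + v 2 * D2
  · linear_combination v 3 * D2
  · linear_combination v 1 * D0
  · ring
  · linear_combination -v 3 * D0
  · linear_combination -v 0 * D0 - v 1 * D1
  · linear_combination -v 2 * D1
  · linear_combination -v 3 * D1
  · linear_combination v 2 * D0
  · linear_combination v 3 * D0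
  · ring

/-- The form `F₂`: the polar form of the quadratic form `q` with matrix `b`, restricted to the
pencil `v ∧ v^⊥`, is `F₂(v)` times the symplectic form. -/
def F₂fun (h : Fin 6 → k) (b : Fin 6 → Fin 6 → k) (v : Fin 4 → k) : k :=
  (pf h)⁻¹ * ∑ i, ∑ j, b i j * theta h v i j

/-- The form `F₄`: the determinant of the bilinear form with matrix `b` on the pencil
`v ∧ v^⊥`. The double sum over pairs of indices is halved so as to make sense in
characteristic two. -/
def F₄fun (h : Fin 6 → k) (b : Fin 6 → Fin 6 → k) (v : Fin 4 → k) : k :=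
  (pf h)⁻¹ ^ 2 * ∑ j, ∑ l, if j < l then
    (∑ i, ∑ m, b i j * b m l * theta h v i m) * theta h v j l else 0

lemma minor_eq {h : Fin 6 → k} (hpf : pf h ≠ 0) {v u u' : Fin 4 → k} (hu : om h v u = 0)
    (hu' : om h v u' = 0) (i j : Fin 6) :
    plucker v u i * plucker v u' j - plucker v u j * plucker v u' i
      = (pf h)⁻¹ * (om h u u' * theta h v i j) := by
  rw [← pf_mul_minor h hu hu', inv_mul_cancel_left₀ hpf]

lemma bil_sub_bil {h : Fin 6 → k} (hpf : pf h ≠ 0) (b : Fin 6 → Fin 6 → k) {v u u' : Fin 4 → k}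
    (hu : om h v u = 0) (hu' : om h v u' = 0) :
    bil b (plucker v u) (plucker v u') - bil b (plucker v u') (plucker v u)
      = F₂fun h b v * om h u u' := by
  simp only [bil, F₂fun, Finset.mul_sum, Finset.sum_mul, ← Finset.sum_sub_distrib]
  refine Finset.sum_congr rfl fun i _ => Finset.sum_congr rfl fun j _ => ?_
  have := minor_eq hpf hu hu' i j
  linear_combination b i j * this

lemma cauchy_binet_six (x y z w : Fin 6 → k) :
    (∑ j, x j * z j) * (∑ l, y l * w l) - (∑ j, x j * w j) * (∑ l, y l * z l)
      = ∑ j, ∑ l, if j < l then (x j * y l - x l * y j) * (z j * w l - z l * w j) else 0 := by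
  simp [Fin.sum_univ_succ]
  ring

/-- On the pencil `v ∧ v^⊥`, the Gram determinant of the bilinear form `b` is `F₄(v)` times the
square of the symplectic form. -/
lemma bil_det {h : Fin 6 → k} (hpf : pf h ≠ 0) (b : Fin 6 → Fin 6 → k) {v u u' : Fin 4 → k}
    (hu : om h v u = 0) (hu' : om h v u' = 0) :
    bil b (plucker v u) (plucker v u) * bil b (plucker v u') (plucker v u')
      - bil b (plucker v u) (plucker v u') * bil b (plucker v u') (plucker v u)
      = F₄fun h b v * om h u u' ^ 2 := by
  have hb : ∀ p p' : Fin 6 → k, bil b p p' = ∑ j, (∑ i, b i j * p i) * p' j := by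
    intro p p'
    simp only [bil, Finset.sum_mul]
    rw [Finset.sum_comm]
    exact Finset.sum_congr rfl fun i _ => Finset.sum_congr rfl fun j _ => by ring
  rw [hb, hb, hb, hb, cauchy_binet_six, F₄fun, mul_right_comm, Finset.mul_sum]
  refine Finset.sum_congr rfl fun j _ => ?_
  rw [Finset.mul_sum]
  refine Finset.sum_congr rfl fun l _ => ?_
  split_ifs
  · rw [minor_eq hpf hu hu']
    have : (∑ i, b i j * plucker v u i) * (∑ i, b i l * plucker v u' i)
        - (∑ i, b i l * plucker v u i) * (∑ i, b i j * plucker v u' i)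
        = (pf h)⁻¹ * om h u u' * ∑ i, ∑ m, b i j * b m l * theta h v i m := by
      rw [mul_comm (∑ i, b i l * plucker v u i), Finset.sum_mul_sum, Finset.sum_mul_sum]
      simp only [Finset.mul_sum, ← Finset.sum_sub_distrib]
      refine Finset.sum_congr rfl fun i _ => Finset.sum_congr rfl fun m _ => ?_
      have := minor_eq hpf hu hu' i m
      linear_combination b i j * b m l * this
    rw [this]
    ring
  · rw [mul_zero]

lemma covec_smul (h : Fin 6 → k) (c : k) (v : Fin 4 → k) (i : Fin 4) :
    covec h (c • v) i = c * covec h v i := om_smul_left _ _ _ _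

lemma theta_smul (h : Fin 6 → k) (c : k) (v : Fin 4 → k) (i j : Fin 6) :
    theta h (c • v) i j = c ^ 2 * theta h v i j := by
  fin_cases i <;> fin_cases j <;>
    simp only [theta, covec_smul, Pi.smul_apply, smul_eq_mul, Fin.reduceFinMk, Fin.zero_eta,
      Fin.isValue, Fin.mk_one, Matrix.cons_val] <;> ring

lemma F₂fun_smul (h : Fin 6 → k) (b : Fin 6 → Fin 6 → k) (c : k) (v : Fin 4 → k) :
    F₂fun h b (c • v) = c ^ 2 * F₂fun h b v := by
  simp only [F₂fun, theta_smul, Finset.mul_sum]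
  exact Finset.sum_congr rfl fun i _ => Finset.sum_congr rfl fun j _ => by ring

lemma F₂fun_zero (h : Fin 6 → k) (b : Fin 6 → Fin 6 → k) : F₂fun h b 0 = 0 := by
  rw [← zero_smul k (0 : Fin 4 → k), F₂fun_smul]; ring

lemma F₄fun_smul (h : Fin 6 → k) (b : Fin 6 → Fin 6 → k) (c : k) (v : Fin 4 → k) :
    F₄fun h b (c • v) = c ^ 4 * F₄fun h b v := by
  simp only [F₄fun, theta_smul, Finset.mul_sum]
  refine Finset.sum_congr rfl fun i _ => Finset.sum_congr rfl fun j _ => ?_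
  split_ifs
  · simp only [Finset.sum_mul, Finset.mul_sum]
    exact Finset.sum_congr rfl fun i _ => Finset.sum_congr rfl fun j _ => by ring
  · simp

lemma IsPoly.neg {σ : Type*} {φ : (σ → k) → k} (h : IsPoly φ) : IsPoly (fun x => -φ x) := by
  simpa using (IsPoly.const 0).sub h

lemma IsPoly.plucker {σ : Type*} {f g : (σ → k) → Fin 4 → k} (hf : ∀ i, IsPoly fun x => f x i)
    (hg : ∀ i, IsPoly fun x => g x i) (i : Fin 6) :
    IsPoly fun x => LineCongruence.plucker (f x) (g x) i := by
  fin_cases i <;> exact ((hf _).mul (hg _)).sub ((hf _).mul (hg _))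

lemma IsPoly.om {σ : Type*} (h : Fin 6 → k) {f g : (σ → k) → Fin 4 → k}
    (hf : ∀ i, IsPoly fun x => f x i) (hg : ∀ i, IsPoly fun x => g x i) :
    IsPoly fun x => LineCongruence.om h (f x) (g x) :=
  IsPoly.sum _ fun i => (IsPoly.const _).mul (IsPoly.plucker hf hg i)

lemma IsPoly.bil {σ : Type*} (b : Fin 6 → Fin 6 → k) {f g : (σ → k) → Fin 6 → k}
    (hf : ∀ i, IsPoly fun x => f x i) (hg : ∀ i, IsPoly fun x => g x i) :
    IsPoly fun x => LineCongruence.bil b (f x) (g x) :=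
  IsPoly.sum _ fun i => IsPoly.sum _ fun j => (IsPoly.const _).mul ((hf i).mul (hg j))

lemma isPoly_theta (h : Fin 6 → k) (i j : Fin 6) : IsPoly fun v => theta h v i j := by
  have key : ∀ a c, IsPoly fun v : Fin 4 → k => v a * covec h v c := fun a c =>
    (IsPoly.coord a).mul (IsPoly.om h (fun i => IsPoly.coord i) fun i => IsPoly.const _)
  fin_cases i <;> fin_cases j <;>
    simp only [theta, Fin.reduceFinMk, Fin.zero_eta, Fin.isValue, Fin.mk_one, Matrix.cons_val] <;>
    first
    | exact IsPoly.const 0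
    | exact key _ _
    | exact (key _ _).neg
    | exact (key _ _).add (key _ _)
    | exact (key _ _).neg.sub (key _ _)

lemma isPoly_F₂fun (h : Fin 6 → k) (b : Fin 6 → Fin 6 → k) : IsPoly (F₂fun h b) :=
  (IsPoly.const _).mul (IsPoly.sum _ fun i => IsPoly.sum _ fun j =>
    (IsPoly.const _).mul (isPoly_theta h i j))

lemma isPoly_F₄fun (h : Fin 6 → k) (b : Fin 6 → Fin 6 → k) : IsPoly (F₄fun h b) := by
  refine (IsPoly.const _).mul (IsPoly.sum _ fun j => IsPoly.sum _ fun l => ?_)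
  by_cases hjl : j < l
  · simp only [hjl, if_true]
    exact (IsPoly.sum _ fun i => IsPoly.sum _ fun m =>
      (IsPoly.const _).mul (isPoly_theta h i m)).mul (isPoly_theta h j l)
  · simp only [hjl, if_false]
    exact IsPoly.const 0

/-! ### Equations of the congruence -/

lemma exists_eq_single_add {σ : Type*} {d : σ →₀ ℕ} {n : ℕ} (hd : d.degree = n + 1) :
    ∃ i e, d = Finsupp.single i 1 + e ∧ e.degree = n := by
  have h0 : d ≠ 0 := by rintro rfl; simp at hd
  obtain ⟨i, hi⟩ := Finsupp.ne_iff.1 h0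
  have hle : Finsupp.single i 1 ≤ d := by
    rw [Finsupp.single_le_iff]
    exact Nat.one_le_iff_ne_zero.2 hi
  refine ⟨i, d - Finsupp.single i 1, (add_tsub_cancel_of_le hle).symm, ?_⟩
  have := congrArg Finsupp.degree (add_tsub_cancel_of_le hle)
  rw [map_add, Finsupp.degree_single, hd] at this
  omega

lemma exists_eq_linear {f : MvPolynomial (Fin 6) k} (hf : f.IsHomogeneous 1) :
    ∃ h : Fin 6 → k, f = ∑ i, MvPolynomial.C (h i) * MvPolynomial.X i := by
  classical
  rw [f.as_sum]
  refine Finset.sum_induction _ (fun f : MvPolynomial (Fin 6) k =>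
    ∃ h : Fin 6 → k, f = ∑ i, MvPolynomial.C (h i) * MvPolynomial.X i) ?_ ?_ ?_
  · rintro _ _ ⟨h, rfl⟩ ⟨h', rfl⟩
    exact ⟨h + h', by simp [add_mul, Finset.sum_add_distrib]⟩
  · exact ⟨0, by simp⟩
  · intro d hd
    have hdeg : d.degree = 1 := by
      rw [Finsupp.degree_eq_weight_one]
      exact hf (MvPolynomial.mem_support_iff.1 hd)
    obtain ⟨i, e, rfl, he⟩ := exists_eq_single_add (n := 0) hdeg
    obtain rfl := (Finsupp.degree_eq_zero_iff e).1 he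
    refine ⟨Pi.single i (f.coeff (Finsupp.single i 1 + 0)), ?_⟩
    rw [Finset.sum_eq_single i, Pi.single_eq_same, add_zero, MvPolynomial.C_mul_X_eq_monomial]
    · intro j _ hj
      simp [Pi.single_eq_of_ne hj]
    · simp

lemma exists_eq_quadratic {f : MvPolynomial (Fin 6) k} (hf : f.IsHomogeneous 2) :
    ∃ b : Fin 6 → Fin 6 → k,
      f = ∑ i, ∑ j, MvPolynomial.C (b i j) * (MvPolynomial.X i * MvPolynomial.X j) := by
  classical
  rw [f.as_sum]
  refine Finset.sum_induction _ (fun f : MvPolynomial (Fin 6) k => ∃ b : Fin 6 → Fin 6 → k,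
      f = ∑ i, ∑ j, MvPolynomial.C (b i j) * (MvPolynomial.X i * MvPolynomial.X j)) ?_ ?_ ?_
  · rintro _ _ ⟨h, rfl⟩ ⟨h', rfl⟩
    exact ⟨h + h', by simp [add_mul, Finset.sum_add_distrib]⟩
  · exact ⟨0, by simp⟩
  · intro d hd
    have hdeg : d.degree = 2 := by
      rw [Finsupp.degree_eq_weight_one]
      exact hf (MvPolynomial.mem_support_iff.1 hd)
    obtain ⟨i, e, rfl, he⟩ := exists_eq_single_add (n := 1) hdeg
    obtain ⟨j, e, rfl, he'⟩ := exists_eq_single_add (n := 0) he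
    obtain rfl := (Finsupp.degree_eq_zero_iff e).1 he'
    generalize f.coeff _ = a
    refine ⟨Pi.single i (Pi.single j a), ?_⟩
    rw [Finset.sum_eq_single i, Finset.sum_eq_single j, Pi.single_eq_same, Pi.single_eq_same,
      add_zero]
    · rw [MvPolynomial.monomial_eq]
      simp [Finsupp.prod_add_index', pow_add]
    · intro l _ hl
      simp [Pi.single_eq_of_ne hl]
    · simp
    · intro l _ hl
      simp [Pi.single_eq_of_ne hl]
    · simp

/-- The linear form with coefficients `h` in the Plücker coordinates. -/
def lin (h : Fin 6 → k) (p : Fin 6 → k) : k := ∑ i, h i * p i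

lemma lin_plucker (h : Fin 6 → k) (u v : Fin 4 → k) : lin h (plucker u v) = om h u v := rfl

lemma lin_add (h p q : Fin 6 → k) : lin h (p + q) = lin h p + lin h q := by
  simp [lin, mul_add, Finset.sum_add_distrib]

lemma lin_smul (h : Fin 6 → k) (c : k) (p : Fin 6 → k) : lin h (c • p) = c * lin h p := by
  simp [lin, Finset.mul_sum, mul_left_comm]

/-- The whole pencil of lines through `[v]` in the plane `v^⊥` lies on the congruence given by `h`
and `b`. -/
def IsBasePoint (h : Fin 6 → k) (b : Fin 6 → Fin 6 → k) (v : Fin 4 → k) : Prop :=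
  ∀ u, om h v u = 0 → bil b (plucker v u) (plucker v u) = 0

lemma isBasePoint_zero (h : Fin 6 → k) (b : Fin 6 → Fin 6 → k) : IsBasePoint h b 0 := fun u _ => by
  rw [plucker_zero_left]
  simp [bil]

/-- `S` is the congruence of the isotropic lines of the symplectic form `om h` on which the
quadratic form with matrix `b` vanishes; it is irreducible and smooth, and contains only finitely
many plane pencils. -/
structure IsModel (S : Set (Line k)) (h : Fin 6 → k) (b : Fin 6 → Fin 6 → k) : Prop where
  irreducible : IsIrreducible S
  isClosed : IsClosed S
  pf_ne : pf h ≠ 0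
  mem_iff : ∀ (L : Line k) (p : Fin 6 → k), L.IsPluckerVector p →
    (L ∈ S ↔ lin h p = 0 ∧ bil b p p = 0)
  smooth : ∀ p : Fin 6 → k, p ≠ 0 → kleinQ p = 0 → lin h p = 0 → bil b p p = 0 →
    ∀ c d : k, ¬ ∀ x, bil b p x + bil b x p = c * klein p x + d * lin h x
  finite_base : {x : ℙ k (Fin 4 → k) | IsBasePoint h b x.rep}.Finite

lemma infinite_of_pencil {S : Set (Line k)} [Infinite k] {v w u u' : Fin 4 → k}
    (hli : LinearIndependent k ![v, w, u, u']) (x : k → k)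
    (H : ∀ s, ∀ h0 : plucker v (x s • w + u + s • u') ≠ 0, lineOf v _ h0 ∈ S) :
    {L | L ∈ S ∧ v ∈ L.toSubmodule}.Infinite := by
  rw [Fintype.linearIndependent_iff] at hli
  have hv : v ≠ 0 := by
    rintro rfl
    have := hli ![1, 0, 0, 0] (by simp [Fin.sum_univ_succ]) 0
    simp at this
  have key : ∀ s t c : k, plucker v (x s • w + u + s • u') = c • plucker v (x t • w + u + t • u') →
      c = 1 ∧ s = t := by
    intro s t c hc
    have h1 : plucker v ((x s - c * x t) • w + (1 - c) • u + (s - c * t) • u') = 0 := by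
      rw [← sub_eq_zero] at hc
      rw [← hc]
      simp only [plucker_add_right, plucker_smul_right]
      module
    obtain ⟨d, hd⟩ := exists_smul_of_plucker_eq_zero hv h1
    have h2 := hli ![-d, x s - c * x t, 1 - c, s - c * t] (by
      simp only [Fin.sum_univ_four, Matrix.cons_val]
      rw [← sub_eq_zero] at hd
      rw [← hd]
      module)
    have h3 := h2 2
    have h4 := h2 3
    simp only [Matrix.cons_val, sub_eq_zero] at h3 h4
    rw [← h3, one_mul] at h4
    exact ⟨h3.symm, h4⟩
  have h0 : ∀ s, plucker v (x s • w + u + s • u') ≠ 0 := fun s hs =>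
    zero_ne_one (key s s 0 (by rw [hs, zero_smul])).1
  refine Set.infinite_of_injective_forall_mem (f := fun s : k => lineOf v _ (h0 s)) ?_ ?_
  · intro s t hst
    have h1 : (lineOf v _ (h0 t)).IsPluckerVector (plucker v (x s • w + u + s • u')) := by
      have := isPluckerVector_plucker (h0 s)
      simp only at hst
      rwa [hst] at this
    obtain ⟨c, -, hc⟩ := isPluckerVector_lineOf.1 h1
    exact (key s t c hc).2
  · exact fun s => ⟨H s _, left_mem_lineOf⟩

lemma mem_fundamentalPoints_mk {S : Set (Line k)} {v : Fin 4 → k} (hv : v ≠ 0) :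
    Projectivization.mk k v hv ∈ fundamentalPoints S ↔
      {L | L ∈ S ∧ v ∈ L.toSubmodule}.Infinite := by
  rw [fundamentalPoints, Set.mem_ofPred_eq]
  simp only [mk_mem_points_iff]

lemma IsSymp.linearIndependent [CharP k 2] {h : Fin 6 → k} {e₁ e₂ f₁ f₂ : Fin 4 → k}
    (H : IsSymp h e₁ e₂ f₁ f₂) : LinearIndependent k ![e₁, f₁, e₂, f₂] := by
  rw [Fintype.linearIndependent_iff]
  intro g hg
  simp only [Fin.sum_univ_four, Matrix.cons_val] at hg
  have t1 := congrArg (fun x => om h x f₁) hg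
  have t2 := congrArg (fun x => om h x f₂) hg
  have t3 := congrArg (fun x => om h x e₁) hg
  have t4 := congrArg (fun x => om h x e₂) hg
  simp only [om_add_left, om_smul_left, om_zero_left, H.e₁f₁, H.e₂f₁, H.e₁f₂, H.e₂f₂, om_self,
    om_comm h f₁ e₁, om_comm h f₁ e₂, om_comm h f₂ e₁, om_comm h f₂ e₂, om_comm h e₂ e₁, H.e₁e₂,
    om_comm h f₂ f₁, H.f₁f₂, mul_zero, mul_one, add_zero, zero_add] at t1 t2 t3 t4
  intro i
  fin_cases i <;> assumption

/-- A quadratic polynomial over an algebraically closed field has a root. -/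
lemma exists_root_quadratic [IsAlgClosed k] {a : k} (ha : a ≠ 0) (b c : k) :
    ∃ x, a * x ^ 2 + b * x + c = 0 := by
  obtain ⟨x, hx⟩ := IsAlgClosed.exists_root
    (Polynomial.C a * Polynomial.X ^ 2 + Polynomial.C b * Polynomial.X + Polynomial.C c)
    (by rw [Polynomial.degree_quadratic ha]; decide)
  exact ⟨x, by simpa using hx⟩

/-- Every singular point of a linear complex lies on infinitely many lines of a congruence
cut out by a quadratic complex. -/
lemma infinite_of_mem_radical [IsAlgClosed k] {S : Set (Line k)} {h : Fin 6 → k}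
    {b : Fin 6 → Fin 6 → k} (hS : ∀ (L : Line k) (p : Fin 6 → k), L.IsPluckerVector p →
      (L ∈ S ↔ lin h p = 0 ∧ bil b p p = 0)) {v : Fin 4 → k} (hv : v ≠ 0)
    (hr : ∀ u, om h v u = 0) : {L | L ∈ S ∧ v ∈ L.toSubmodule}.Infinite := by
  have hmem : ∀ u (h0 : plucker v u ≠ 0), lineOf v u h0 ∈ S ↔
      bil b (plucker v u) (plucker v u) = 0 := fun u h0 => by
    rw [hS _ _ (isPluckerVector_plucker h0), lin_plucker, hr]; simp
  have hext : ∀ w, plucker v w ≠ 0 → ∃ u u', LinearIndependent k ![v, w, u, u'] := by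
    intro w hw
    have h2 := linearIndependent_pair_iff_plucker.2 hw
    obtain ⟨u, hu⟩ := exists_linearIndependent_snoc_of_lt_finrank h2 (by simp)
    obtain ⟨u', hu'⟩ := exists_linearIndependent_snoc_of_lt_finrank hu (by simp)
    refine ⟨u, u', ?_⟩
    have e : (Fin.snoc (Fin.snoc ![v, w] u : Fin 3 → Fin 4 → k) u' : Fin 4 → Fin 4 → k)
        = ![v, w, u, u'] := by
      funext i
      fin_cases i <;> rfl
    rwa [e] at hu'
  by_cases hq : ∃ w, bil b (plucker v w) (plucker v w) ≠ 0
  · obtain ⟨w, hw⟩ := hq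
    have hw0 : plucker v w ≠ 0 := by
      intro h0
      rw [h0] at hw
      simp [bil] at hw
    obtain ⟨u, u', hli⟩ := hext w hw0
    have : ∀ s : k, ∃ x : k, bil b (plucker v (x • w + u + s • u'))
        (plucker v (x • w + u + s • u')) = 0 := by
      intro s
      obtain ⟨x, hx⟩ := exists_root_quadratic hw
        (bil b (plucker v w) (plucker v (u + s • u'))
          + bil b (plucker v (u + s • u')) (plucker v w))
        (bil b (plucker v (u + s • u')) (plucker v (u + s • u')))
      refine ⟨x, ?_⟩
      rw [← hx, add_assoc, plucker_add_right v (x • w), plucker_smul_right]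
      simp only [bil_add_left, bil_add_right, bil_smul_left, bil_smul_right]
      ring
    choose x hx using this
    exact infinite_of_pencil hli x fun s h0 => (hmem _ h0).2 (hx s)
  · push Not at hq
    obtain ⟨w, hw⟩ : ∃ w, plucker v w ≠ 0 := by
      obtain ⟨w, hw⟩ := exists_linearIndependent_snoc_of_lt_finrank (R := k) (v := ![v])
        (by exact LinearIndependent.of_subsingleton 0 hv) (by simp)
      refine ⟨w, linearIndependent_pair_iff_plucker.1 ?_⟩
      have e : (Fin.snoc ![v] w : Fin 2 → Fin 4 → k) = ![v, w] := by
        funext i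
        fin_cases i <;> rfl
      rwa [e] at hw
    obtain ⟨u, u', hli⟩ := hext w hw
    exact infinite_of_pencil hli (fun _ => 0) fun s h0 => (hmem _ h0).2 (hq _)

/-- If the alternating form is degenerate, its radical is a line of singular points of the
linear complex. -/
lemma exists_radical {h : Fin 6 → k} (hh : h ≠ 0) (h0 : pf h = 0) :
    ∃ r r', plucker r r' ≠ 0 ∧ (∀ u, om h r u = 0) ∧ ∀ u, om h r' u = 0 := by
  obtain ⟨i, hi⟩ := Function.ne_iff.1 hh
  simp only [Pi.zero_apply] at hi
  rw [pf] at h0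
  have r0 : ∀ u, om h ![0, h 5, -h 4, h 3] u = 0 := fun u => by
    simp [om, plucker, Fin.sum_univ_succ]; linear_combination -u 0 * h0
  have r1 : ∀ u, om h ![-h 5, 0, h 2, -h 1] u = 0 := fun u => by
    simp [om, plucker, Fin.sum_univ_succ]; linear_combination -u 1 * h0
  have r2 : ∀ u, om h ![h 4, -h 2, 0, h 0] u = 0 := fun u => by
    simp [om, plucker, Fin.sum_univ_succ]; linear_combination -u 2 * h0
  have r3 : ∀ u, om h ![-h 3, h 1, -h 0, 0] u = 0 := fun u => by
    simp [om, plucker, Fin.sum_univ_succ]; linear_combination -u 3 * h0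
  have key : ∀ (r r' : Fin 4 → k) (j : Fin 6), plucker r r' j ≠ 0 → plucker r r' ≠ 0 :=
    fun r r' j hj h1 => hj (by rw [h1, Pi.zero_apply])
  fin_cases i
  · exact ⟨_, _, key _ _ 5 (by simpa [plucker] using hi), r2, r3⟩
  · exact ⟨_, _, key _ _ 4 (by simpa [plucker] using hi), r1, r3⟩
  · exact ⟨_, _, key _ _ 3 (by simpa [plucker] using hi), r1, r2⟩
  · exact ⟨_, _, key _ _ 2 (by simpa [plucker] using hi), r0, r3⟩
  · exact ⟨_, _, key _ _ 1 (by simpa [plucker] using hi), r0, r2⟩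
  · exact ⟨_, _, key _ _ 0 (by simpa [plucker] using hi), r0, r1⟩

lemma plucker_add_smul_self (r r' : Fin 4 → k) (s t : k) :
    plucker (r + s • r') (r + t • r') = (t - s) • plucker r r' := by
  ext i; fin_cases i <;> simp [plucker] <;> ring

lemma infinite_points_of_plucker_ne_zero [Infinite k] {r r' : Fin 4 → k} (h : plucker r r' ≠ 0)
    {T : Set (ℙ k (Fin 4 → k))}
    (H : ∀ s : k, ∀ hs : r + s • r' ≠ 0, Projectivization.mk k _ hs ∈ T) : T.Infinite := by
  have h0 : ∀ s : k, r + s • r' ≠ 0 := fun s => by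
    refine ne_zero_left_of_plucker (v := r') ?_
    rwa [plucker_add_left, plucker_smul_left, plucker_self, smul_zero, add_zero]
  refine Set.infinite_of_injective_forall_mem
    (f := fun s : k => Projectivization.mk k _ (h0 s)) ?_ fun s => H s _
  intro s t hst
  obtain ⟨a, ha⟩ := (Projectivization.mk_eq_mk_iff' _ _ _ _ _).1 hst
  have h1 := plucker_add_smul_self r r' s t
  rw [← ha, plucker_smul_left, plucker_self, smul_zero] at h1
  exact (sub_eq_zero.1 ((smul_eq_zero.1 h1.symm).resolve_right h)).symm

lemma mem_fundamentalPoints_of_isBasePoint [Infinite k] [CharP k 2] {S : Set (Line k)}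
    {h : Fin 6 → k} {b : Fin 6 → Fin 6 → k} (hpf : pf h ≠ 0)
    (hS : ∀ (L : Line k) (p : Fin 6 → k), L.IsPluckerVector p →
      (L ∈ S ↔ lin h p = 0 ∧ bil b p p = 0)) {v : Fin 4 → k} (hv : v ≠ 0)
    (hb : IsBasePoint h b v) : {L | L ∈ S ∧ v ∈ L.toSubmodule}.Infinite := by
  obtain ⟨e₂, f₁, f₂, H⟩ := exists_isSymp hpf hv
  refine infinite_of_pencil H.linearIndependent (fun _ => 0) fun s h0 => ?_
  have h1 : om h v ((0 : k) • f₁ + e₂ + s • f₂) = 0 := by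
    simp only [om_add_right, om_smul_right, H.e₁e₂, H.e₁f₂]; ring
  exact (hS _ _ (isPluckerVector_plucker h0)).2 ⟨h1, hb _ h1⟩

/-- A del Pezzo congruence without fundamental curves consists of isotropic lines of a symplectic
form: if the linear complex were special, its axis would be a fundamental curve. -/
theorem IsDelPezzoCongruence.exists_isModel [IsAlgClosed k] [CharP k 2] {S : Set (Line k)}
    (hS : IsDelPezzoCongruence S) : ∃ h b, IsModel S h b := by
  obtain ⟨f, q, hf, hq, hSeq, hsm⟩ := hS.section_of_complex
  have hcl : IsClosed S := by
    rw [hSeq]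
    exact (isClosed_vanishes hf).inter (isClosed_vanishes hq)
  obtain ⟨h, rfl⟩ := exists_eq_linear hf
  obtain ⟨b, rfl⟩ := exists_eq_quadratic hq
  have evf : ∀ p, MvPolynomial.eval p (∑ i, MvPolynomial.C (h i) * MvPolynomial.X i) = lin h p := by
    intro p; simp [lin]
  have evq : ∀ p, MvPolynomial.eval p (∑ i, ∑ j, MvPolynomial.C (b i j) *
      (MvPolynomial.X i * MvPolynomial.X j)) = bil b p p := by
    intro p; simp [bil]
  have evk : ∀ p, MvPolynomial.eval p (pluckerQuadric k) = kleinQ p := by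
    intro p; simp [pluckerQuadric, kleinQ]
  have hmem : ∀ (L : Line k) (p : Fin 6 → k), L.IsPluckerVector p →
      (L ∈ S ↔ lin h p = 0 ∧ bil b p p = 0) := by
    intro L p hp
    rw [hSeq, Set.mem_ofPred_eq, Line.vanishes_iff hp hf, Line.vanishes_iff hp hq, evf, evq]
  have grf : ∀ p, gradient (∑ i, MvPolynomial.C (h i) * MvPolynomial.X i) p = h := by
    intro p; ext i
    simp [gradient, MvPolynomial.pderiv_X, Pi.single_apply]
  have grq : ∀ p i, gradient (∑ i, ∑ j, MvPolynomial.C (b i j) *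
      (MvPolynomial.X i * MvPolynomial.X j)) p i
      = bil b p (Pi.single i 1) + bil b (Pi.single i 1) p := by
    intro p i
    simp [gradient, MvPolynomial.pderiv_X, Pi.single_apply, bil, Finset.sum_add_distrib, mul_add]
  have grk : ∀ p i, gradient (pluckerQuadric k) p i = klein p (Pi.single i 1) := by
    intro p i
    fin_cases i <;>
      simp [gradient, pluckerQuadric, klein, MvPolynomial.pderiv_X]
  have hsm' : ∀ p : Fin 6 → k, p ≠ 0 → kleinQ p = 0 → lin h p = 0 → bil b p p = 0 →
      ∀ c d : k, ¬ ∀ x, bil b p x + bil b x p = c * klein p x + d * lin h x := by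
    intro p hp h1 h2 h3 c d H
    have := hsm p hp (by rw [evk, h1]) (by rw [evf, h2]) (by rw [evq, h3])
    rw [Fintype.linearIndependent_iff] at this
    have := this ![c, d, -1] (by
      ext i
      simp only [Fin.sum_univ_three, Matrix.cons_val, Pi.add_apply, Pi.smul_apply, smul_eq_mul,
        grq, grk, grf, Pi.zero_apply]
      have := H (Pi.single i 1)
      have e : lin h (Pi.single i 1) = h i := by simp [lin, Pi.single_apply]
      rw [e] at this
      linear_combination -this) 2
    simp at this
  have hh : h ≠ 0 := by
    rintro rfl
    obtain ⟨L, hL⟩ := hS.irreducible.nonempty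
    obtain ⟨u, v, h0, rfl⟩ := L.exists_eq_lineOf
    obtain ⟨h1, h2⟩ := (hmem _ _ (isPluckerVector_plucker h0)).1 hL
    have := hsm _ h0 (by rw [evk, kleinQ_plucker]) (by rw [evf, h1]) (by rw [evq, h2])
    rw [grf] at this
    exact this.ne_zero 1 rfl
  have hpf : pf h ≠ 0 := by
    intro h0
    obtain ⟨r, r', hrr, hr, hr'⟩ := exists_radical hh h0
    refine infinite_points_of_plucker_ne_zero hrr (fun s hs => ?_) hS.no_fundamental_curve
    rw [mem_fundamentalPoints_mk]
    exact infinite_of_mem_radical hmem hs fun u => by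
      rw [om_add_left, om_smul_left, hr, hr', mul_zero, add_zero]
  refine ⟨h, b, hS.irreducible, hcl, hpf, hmem, hsm', hS.no_fundamental_curve.subset ?_⟩
  intro x hx
  rw [← x.mk_rep, mem_fundamentalPoints_mk]
  exact mem_fundamentalPoints_of_isBasePoint hpf hmem x.rep_nonzero hx

/-! ### The rays through a point; order and class -/

/-- A linear form on the space of Plücker vectors is determined by its values on the six lines
joining the vectors of a symplectic basis. -/
lemma IsSymp.linearMap_eq_zero [CharP k 2] {h : Fin 6 → k} {e₁ e₂ f₁ f₂ : Fin 4 → k}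
    (H : IsSymp h e₁ e₂ f₁ f₂) (φ : (Fin 6 → k) →ₗ[k] k) (h1 : φ (plucker e₁ e₂) = 0)
    (h2 : φ (plucker e₁ f₁) = 0) (h3 : φ (plucker e₁ f₂) = 0) (h4 : φ (plucker e₂ f₁) = 0)
    (h5 : φ (plucker e₂ f₂) = 0) (h6 : φ (plucker f₁ f₂) = 0) : φ = 0 := by
  have key : ∀ y z, φ (plucker y z) = 0 := by
    intro y z
    rw [H.expand y, H.expand z]
    simp only [plucker_add_left, plucker_add_right, plucker_smul_left, plucker_smul_right, map_add,
      map_smul, plucker_self, plucker_swap e₂ e₁, plucker_swap f₁ e₁, plucker_swap f₁ e₂,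
      plucker_swap f₂ e₁, plucker_swap f₂ e₂, plucker_swap f₂ f₁, h1, h2, h3, h4, h5, h6, smul_zero,
      map_zero, add_zero]
  refine LinearMap.pi_ext' fun i => LinearMap.ext_ring ?_
  have hs : ∃ a b : Fin 4 → k, Pi.single i (1 : k) = plucker a b := by
    fin_cases i
    · exact ⟨Pi.single 0 1, Pi.single 1 1, by ext j; fin_cases j <;> simp [plucker]⟩
    · exact ⟨Pi.single 0 1, Pi.single 2 1, by ext j; fin_cases j <;> simp [plucker]⟩
    · exact ⟨Pi.single 0 1, Pi.single 3 1, by ext j; fin_cases j <;> simp [plucker]⟩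
    · exact ⟨Pi.single 1 1, Pi.single 2 1, by ext j; fin_cases j <;> simp [plucker]⟩
    · exact ⟨Pi.single 1 1, Pi.single 3 1, by ext j; fin_cases j <;> simp [plucker]⟩
    · exact ⟨Pi.single 2 1, Pi.single 3 1, by ext j; fin_cases j <;> simp [plucker]⟩
  obtain ⟨a, b, hab⟩ := hs
  simp only [LinearMap.comp_apply, LinearMap.coe_single, LinearMap.zero_comp,
    LinearMap.zero_apply]
  rw [hab, key]

/-- The linear form `x ↦ β(p, x) - c κ(p, x) - d h(x)`, with `β` and `κ` the polar forms of the
quadratic form with matrix `b` and of the Plücker quadric. -/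
def gradientCombination (h : Fin 6 → k) (b : Fin 6 → Fin 6 → k) (p : Fin 6 → k) (c d : k) :
    (Fin 6 → k) →ₗ[k] k where
  toFun x := bil b p x + bil b x p - c * klein p x - d * lin h x
  map_add' x y := by
    simp only [bil_add_left, bil_add_right, klein_add_right, lin_add]; ring
  map_smul' r x := by
    simp only [bil_smul_left, bil_smul_right, klein_smul_right, lin_smul, RingHom.id_apply,
      smul_eq_mul]
    ring

lemma gradientCombination_apply (h : Fin 6 → k) (b : Fin 6 → Fin 6 → k) (p : Fin 6 → k) (c d : k)
    (x : Fin 6 → k) : gradientCombination h b p c d x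
      = bil b p x + bil b x p - c * klein p x - d * lin h x := rfl

/-- On the pencil `v ∧ v^⊥`, the polar form of the quadratic complex is `F₂(v)` times the symplectic
form. -/
lemma bil_add_bil [CharP k 2] {h : Fin 6 → k} (hpf : pf h ≠ 0) (b : Fin 6 → Fin 6 → k)
    {v u u' : Fin 4 → k} (hu : om h v u = 0) (hu' : om h v u' = 0) :
    bil b (plucker v u) (plucker v u') + bil b (plucker v u') (plucker v u)
      = F₂fun h b v * om h u u' := by
  rw [← bil_sub_bil hpf b hu hu', CharTwo.sub_eq_add]

lemma bil_self_smul_add_smul [CharP k 2] {h : Fin 6 → k} (hpf : pf h ≠ 0)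
    (b : Fin 6 → Fin 6 → k) {v u u' : Fin 4 → k} (hu : om h v u = 0) (hu' : om h v u' = 0)
    (s t : k) :
    bil b (plucker v (s • u + t • u')) (plucker v (s • u + t • u'))
      = bil b (plucker v u) (plucker v u) * s ^ 2 + F₂fun h b v * om h u u' * (s * t)
        + bil b (plucker v u') (plucker v u') * t ^ 2 := by
  rw [← bil_add_bil hpf b hu hu']
  simp only [plucker_add_right, plucker_smul_right, bil_add_left, bil_add_right, bil_smul_left,
    bil_smul_right]
  ring

lemma isOpen_ne_zero [Infinite k] {φ : (Fin 4 → k) → k} (hφ : IsPoly φ) {n : ℕ}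
    (hs : ∀ c v, φ (c • v) = c ^ n * φ v) : IsOpen {x : ℙ k (Fin 4 → k) | φ x.rep ≠ 0} := by
  obtain ⟨P, hP⟩ := hφ
  refine TopologicalSpace.isOpen_generateFrom_of_mem ⟨n, P, ?_, ?_⟩
  · exact isHomogeneous_of_eval n P fun c x => by rw [hP, hP, hs]
  · simp only [hP]

lemma nonempty_ne_zero {φ : (Fin 4 → k) → k} {n : ℕ} (hs : ∀ c v, φ (c • v) = c ^ n * φ v)
    {v : Fin 4 → k} (hv : v ≠ 0) (h : φ v ≠ 0) :
    {x : ℙ k (Fin 4 → k) | φ x.rep ≠ 0}.Nonempty := by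
  obtain ⟨c, hc⟩ := Projectivization.exists_smul_eq_mk_rep k v hv
  refine ⟨Projectivization.mk k v hv, ?_⟩
  rw [Set.mem_ofPred_eq, ← hc]
  change φ ((c : k) • v) ≠ 0
  rw [hs]
  exact mul_ne_zero (pow_ne_zero _ c.ne_zero) h

/-- The pole of the plane with equation `a`, with respect to the symplectic form. -/
def pole (h : Fin 6 → k) (a : Fin 4 → k) : Fin 4 → k :=
  ![(pf h)⁻¹ * (h 5 * a 1 - h 4 * a 2 + h 3 * a 3), (pf h)⁻¹ * (-h 5 * a 0 + h 2 * a 2 - h 1 * a 3),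
    (pf h)⁻¹ * (h 4 * a 0 - h 2 * a 1 + h 0 * a 3), (pf h)⁻¹ * (-h 3 * a 0 + h 1 * a 1 - h 0 * a 2)]

lemma om_pole {h : Fin 6 → k} (hpf : pf h ≠ 0) (a u : Fin 4 → k) : om h (pole h a) u = a ⬝ᵥ u := by
  have : om h (pole h a) u = (pf h)⁻¹ * (pf h * (a ⬝ᵥ u)) := by
    simp [om, plucker, pole, Fin.sum_univ_succ, dotProduct]
    rw [pf]
    ring
  rw [this, inv_mul_cancel_left₀ hpf]

section model

variable {S : Set (Line k)} {h : Fin 6 → k} {b : Fin 6 → Fin 6 → k}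

lemma IsModel.lineOf_mem_iff (M : IsModel S h b) {u v : Fin 4 → k} (h0 : plucker u v ≠ 0) :
    lineOf u v h0 ∈ S ↔ om h u v = 0 ∧ bil b (plucker u v) (plucker u v) = 0 :=
  M.mem_iff _ _ (isPluckerVector_plucker h0)

lemma IsModel.om_eq_zero (M : IsModel S h b) {L : Line k} (hL : L ∈ S) {x y : Fin 4 → k}
    (hx : x ∈ L.toSubmodule) (hy : y ∈ L.toSubmodule) : om h x y = 0 := by
  by_cases h0 : plucker x y = 0
  · simp [om, h0]
  · rw [Line.eq_lineOf hx hy h0] at hL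
    exact ((M.lineOf_mem_iff h0).1 hL).1

variable [CharP k 2]

/-- No ray is contained in the quadric `F₂ = 0`: otherwise the tangent hyperplane of the quadratic
complex at the ray would contain the tangent space of the linear complex. -/
theorem IsModel.exists_F₂fun_ne_zero (M : IsModel S h b) {L : Line k} (hL : L ∈ S) :
    ∃ v ∈ L.toSubmodule, F₂fun h b v ≠ 0 := by
  by_contra! H
  obtain ⟨e₁, e₂, h0, rfl⟩ := L.exists_eq_lineOf
  obtain ⟨hom, hq⟩ := (M.lineOf_mem_iff h0).1 hL
  obtain ⟨f₁, f₂, B⟩ := exists_isSymp_of_isotropic M.pf_ne h0 hom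
  have two : (2 : k) = 0 := CharTwo.two_eq_zero
  have hk : klein (plucker e₁ e₂) (plucker f₁ f₂) ≠ 0 := right_ne_zero_of_mul_eq_one B.pf_mul_klein
  refine M.smooth _ h0 (kleinQ_plucker _ _) hom hq
    ((bil b (plucker e₁ e₂) (plucker f₁ f₂) + bil b (plucker f₁ f₂) (plucker e₁ e₂))
      / klein (plucker e₁ e₂) (plucker f₁ f₂))
    (bil b (plucker e₁ e₂) (plucker e₁ f₁) + bil b (plucker e₁ f₁) (plucker e₁ e₂)) fun x => ?_
  set c := (bil b (plucker e₁ e₂) (plucker f₁ f₂) + bil b (plucker f₁ f₂) (plucker e₁ e₂))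
      / klein (plucker e₁ e₂) (plucker f₁ f₂) with hc
  set d := bil b (plucker e₁ e₂) (plucker e₁ f₁) + bil b (plucker e₁ f₁) (plucker e₁ e₂) with hd
  have hF : ∀ s t : k, F₂fun h b (s • e₁ + t • e₂) = 0 := fun s t => H _ (mem_lineOf.2 ⟨s, t, rfl⟩)
  have t1 : bil b (plucker e₁ e₂) (plucker e₁ f₂) + bil b (plucker e₁ f₂) (plucker e₁ e₂) = 0 := by
    rw [bil_add_bil M.pf_ne b B.e₁e₂ B.e₁f₂, ← one_smul k e₁, ← add_zero ((1 : k) • e₁),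
      ← zero_smul k e₂, hF, zero_mul]
  have t2 : bil b (plucker e₁ e₂) (plucker e₂ f₁) + bil b (plucker e₂ f₁) (plucker e₁ e₂) = 0 := by
    rw [plucker_swap e₁ e₂, bil_add_bil M.pf_ne b (by rw [om_comm, B.e₁e₂]) B.e₂f₁,
      ← one_smul k e₂, ← zero_add ((1 : k) • e₂), ← zero_smul k e₁, hF, zero_mul]
  have t3 : bil b (plucker e₁ e₂) (plucker e₂ f₂) + bil b (plucker e₂ f₂) (plucker e₁ e₂) = d := by
    have h1 : om h (e₁ + e₂) e₂ = 0 := by rw [om_add_left, B.e₁e₂, om_self, add_zero]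
    have h2 : om h (e₁ + e₂) (f₁ + f₂) = 0 := by
      rw [om_add_left, om_add_right, om_add_right, B.e₁f₁, B.e₁f₂, B.e₂f₁, B.e₂f₂]
      linear_combination two
    have h3 := bil_add_bil M.pf_ne b h1 h2
    have h4 := hF 1 1
    rw [one_smul, one_smul] at h4
    rw [h4, zero_mul] at h3
    simp only [plucker_add_left, plucker_add_right, plucker_self, bil_add_left, bil_add_right,
      add_zero] at h3
    linear_combination h3 - t1 - t2 - d * two
  have h1 : klein (plucker e₁ e₂) (plucker e₂ f₁) = 0 := by
    rw [plucker_swap e₁, klein_plucker_left]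
  have h2 : klein (plucker e₁ e₂) (plucker e₂ f₂) = 0 := by
    rw [plucker_swap e₁, klein_plucker_left]
  have := B.linearMap_eq_zero (gradientCombination h b (plucker e₁ e₂) c d) ?_ ?_ ?_ ?_ ?_ ?_
  · have h3 := LinearMap.congr_fun this x
    rw [gradientCombination_apply, LinearMap.zero_apply] at h3
    linear_combination h3
  all_goals
    rw [gradientCombination_apply, lin_plucker]
    simp only [klein_plucker_left, B.e₁e₂, B.e₁f₁, B.e₂f₂, B.f₁f₂, B.e₁f₂, B.e₂f₁, t1, t2, t3, hq,
      h1, h2]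
  · ring
  · rw [hd]; ring
  · ring
  · ring
  · ring
  · rw [hc, div_mul_cancel₀ _ hk]; ring

/-- The quadratic form vanishes on the pencil of a base point, hence so does its polar form, that is
`F₂`. -/
lemma not_isBasePoint (hpf : pf h ≠ 0) {v : Fin 4 → k} (hF : F₂fun h b v ≠ 0) :
    ¬ IsBasePoint h b v := by
  intro H
  have hv : v ≠ 0 := by
    rintro rfl
    exact hF (F₂fun_zero h b)
  obtain ⟨e₂, f₁, f₂, B⟩ := exists_isSymp hpf hv
  have h1 := bil_self_smul_add_smul hpf b B.e₁e₂ B.e₁f₂ 1 1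
  rw [H _ B.e₁e₂, H _ B.e₁f₂, H _ (by
    rw [om_add_right, om_smul_right, om_smul_right, B.e₁e₂, B.e₁f₂]; ring), B.e₂f₂] at h1
  apply hF
  linear_combination -h1

/-- Through a point which is not a base point there is an isotropic line which is not a ray. -/
lemma exists_isSymp_of_not_isBasePoint (hpf : pf h ≠ 0) {v : Fin 4 → k}
    (hv : ¬ IsBasePoint h b v) : ∃ e₂ f₁ f₂, IsSymp h v e₂ f₁ f₂ ∧
      bil b (plucker v e₂) (plucker v e₂) ≠ 0 := by
  simp only [IsBasePoint, not_forall] at hv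
  obtain ⟨u, hu, hq⟩ := hv
  have h0 : plucker v u ≠ 0 := by
    intro h0
    rw [h0] at hq
    simp [bil] at hq
  obtain ⟨f₁, f₂, B⟩ := exists_isSymp_of_isotropic hpf h0 hu
  exact ⟨u, f₁, f₂, B, hq⟩

lemma IsSymp.plucker_smul_add_ne_zero {v e₂ f₁ f₂ : Fin 4 → k} (B : IsSymp h v e₂ f₁ f₂) {s t : k}
    (ht : t ≠ 0) : plucker v (s • e₂ + t • f₂) ≠ 0 := by
  intro h0
  apply ht
  have h1 := LineCongruence.pf_mul_klein h v (s • e₂ + t • f₂) e₂ f₁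
  rw [h0] at h1
  simp only [om_add_left, om_add_right, om_smul_left, om_smul_right, B.e₁e₂, B.e₁f₂, B.e₁f₁,
    om_comm h f₂ e₂, B.e₂f₂, om_self, B.e₂f₁] at h1
  simp [klein] at h1
  exact h1.symm

/-- The rays through a point which is not a base point, as roots of a quadratic polynomial. -/
lemma IsModel.mem_iff_exists_root (M : IsModel S h b) {v e₂ f₁ f₂ : Fin 4 → k}
    (B : IsSymp h v e₂ f₁ f₂) (ha : bil b (plucker v e₂) (plucker v e₂) ≠ 0) (hv : v ≠ 0)
    {L : Line k} : (L ∈ S ∧ v ∈ L.toSubmodule) ↔ ∃ x, ∃ h0 : plucker v (x • e₂ + (1 : k) • f₂) ≠ 0,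
      bil b (plucker v e₂) (plucker v e₂) * x ^ 2 + F₂fun h b v * x
        + bil b (plucker v f₂) (plucker v f₂) = 0 ∧ L = lineOf v _ h0 := by
  constructor
  · rintro ⟨hL, hvL⟩
    obtain ⟨u, h0, rfl⟩ := L.exists_eq_lineOf_of_mem hvL hv
    obtain ⟨hom, hq⟩ := (M.lineOf_mem_iff h0).1 hL
    have hu := B.eq_of_om_eq_zero hom
    have hpl := B.plucker_eq_of_om_eq_zero hom
    set s := om h u f₂
    set t := om h u e₂
    have hq' : bil b (plucker v e₂) (plucker v e₂) * s ^ 2 + F₂fun h b v * (s * t)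
        + bil b (plucker v f₂) (plucker v f₂) * t ^ 2 = 0 := by
      have := bil_self_smul_add_smul M.pf_ne b B.e₁e₂ B.e₁f₂ s t
      rw [plucker_add_right, plucker_smul_right, plucker_smul_right, ← hpl, hq, B.e₂f₂] at this
      linear_combination -this
    have ht : t ≠ 0 := by
      intro ht
      rw [ht] at hq' hpl
      have hs : s ≠ 0 := by
        rintro hs
        apply h0
        rw [hpl, hs, zero_smul, zero_smul, add_zero]
      apply ha
      apply mul_right_cancel₀ (pow_ne_zero 2 hs)
      linear_combination hq'
    have h1 : plucker v ((s / t) • e₂ + (1 : k) • f₂) ≠ 0 :=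
      B.plucker_smul_add_ne_zero one_ne_zero
    refine ⟨s / t, h1, ?_, ?_⟩
    · field_simp
      linear_combination hq'
    · refine Line.eq_of_isPluckerVector (isPluckerVector_plucker h0)
        (isPluckerVector_lineOf.2 ⟨t, ht, ?_⟩)
      rw [hpl, plucker_add_right, plucker_smul_right, plucker_smul_right, smul_add, smul_smul,
        smul_smul, mul_div_cancel₀ _ ht, mul_one]
  · rintro ⟨x, h0, hx, rfl⟩
    refine ⟨(M.lineOf_mem_iff h0).2 ⟨?_, ?_⟩, left_mem_lineOf⟩
    · rw [om_add_right, om_smul_right, om_smul_right, B.e₁e₂, B.e₁f₂]; ring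
    · rw [bil_self_smul_add_smul M.pf_ne b B.e₁e₂ B.e₁f₂, B.e₂f₂]
      linear_combination hx

lemma IsSymp.lineOf_injective {v e₂ f₁ f₂ : Fin 4 → k} (B : IsSymp h v e₂ f₁ f₂) {x y : k}
    {h0 : plucker v (x • e₂ + (1 : k) • f₂) ≠ 0} {h1 : plucker v (y • e₂ + (1 : k) • f₂) ≠ 0}
    (hxy : lineOf v _ h0 = lineOf v _ h1) : x = y := by
  have h2 : x • e₂ + (1 : k) • f₂ ∈ (lineOf v _ h1).toSubmodule := hxy ▸ right_mem_lineOf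
  obtain ⟨s, t, hst⟩ := mem_lineOf.1 h2
  have e1 := congrArg (om h f₂) hst
  have e2 := congrArg (om h e₂) hst
  simp only [om_add_right, om_smul_right, om_comm h e₂ v, om_comm h f₂ v, om_comm h f₂ e₂, B.e₁e₂,
    B.e₁f₂, B.e₂f₂, om_self] at e1 e2
  have ht : t = 1 := by linear_combination e2
  rw [ht] at e1
  linear_combination -e1

variable [IsAlgClosed k]

/-- There are exactly two rays through a point outside the quadric `F₂ = 0`. -/
theorem IsModel.encard_rays (M : IsModel S h b) {v : Fin 4 → k} (hF : F₂fun h b v ≠ 0) :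
    {L | L ∈ S ∧ v ∈ L.toSubmodule}.encard = 2 := by
  have hv : v ≠ 0 := by
    rintro rfl
    exact hF (F₂fun_zero h b)
  obtain ⟨e₂, f₁, f₂, B, ha⟩ :=
    exists_isSymp_of_not_isBasePoint M.pf_ne (not_isBasePoint M.pf_ne hF)
  set a := bil b (plucker v e₂) (plucker v e₂)
  set c := bil b (plucker v f₂) (plucker v f₂)
  obtain ⟨x, hx⟩ := exists_root_quadratic ha (F₂fun h b v) c
  have h0 : ∀ x : k, plucker v (x • e₂ + (1 : k) • f₂) ≠ 0 :=
    fun x => B.plucker_smul_add_ne_zero one_ne_zero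
  have two : (2 : k) = 0 := CharTwo.two_eq_zero
  -- the two roots differ by `F₂ / a`
  have : {L | L ∈ S ∧ v ∈ L.toSubmodule}
      = {lineOf v _ (h0 x), lineOf v _ (h0 (x + F₂fun h b v / a))} := by
    ext L
    rw [Set.mem_ofPred_eq, M.mem_iff_exists_root B ha hv, Set.mem_insert_iff,
      Set.mem_singleton_iff]
    constructor
    · rintro ⟨y, hy0, hy, rfl⟩
      have : (y - x) * (y - (x + F₂fun h b v / a)) = 0 := by
        apply mul_left_cancel₀ ha
        field_simp
        linear_combination hy + hx - (F₂fun h b v * y + y * x * a + c) * two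
      rcases mul_eq_zero.1 this with h1 | h1
      · obtain rfl := sub_eq_zero.1 h1
        exact Or.inl rfl
      · obtain rfl := sub_eq_zero.1 h1
        exact Or.inr rfl
    · rintro (rfl | rfl)
      · exact ⟨x, h0 x, hx, rfl⟩
      · refine ⟨_, h0 _, ?_, rfl⟩
        have : a * (x + F₂fun h b v / a) ^ 2 + F₂fun h b v * (x + F₂fun h b v / a) + c
            = (a * x ^ 2 + F₂fun h b v * x + c) + 2 * (x * F₂fun h b v + F₂fun h b v ^ 2 / a) := by
          field_simp
          ring
        rw [this, hx, two]
        ring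
  rw [this, Set.encard_pair]
  intro h1
  have := B.lineOf_injective h1
  rw [left_eq_add, div_eq_zero_iff] at this
  tauto

theorem IsModel.hasOrder (M : IsModel S h b) : HasOrder S 2 := by
  obtain ⟨L, hL⟩ := M.irreducible.nonempty
  obtain ⟨v, -, hv⟩ := M.exists_F₂fun_ne_zero hL
  have hv0 : v ≠ 0 := by
    rintro rfl
    exact hv (F₂fun_zero h b)
  refine ⟨_, isOpen_ne_zero (isPoly_F₂fun h b) (F₂fun_smul h b),
    nonempty_ne_zero (F₂fun_smul h b) hv0 hv, fun x hx => ?_⟩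
  simp only [mem_points_iff]
  exact M.encard_rays hx

theorem IsModel.hasClass (M : IsModel S h b) : HasClass S 2 := by
  obtain ⟨L, hL⟩ := M.irreducible.nonempty
  obtain ⟨v, -, hv⟩ := M.exists_F₂fun_ne_zero hL
  have hs : ∀ c a, F₂fun h b (pole h (c • a)) = c ^ 2 * F₂fun h b (pole h a) := by
    intro c a
    rw [← F₂fun_smul]
    congr 1
    ext i
    fin_cases i <;> simp [pole] <;> ring
  have hp : IsPoly fun a => F₂fun h b (pole h a) := by
    refine (isPoly_F₂fun h b).comp fun i => ?_
    fin_cases i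
    · exact (IsPoly.const _).mul ((((IsPoly.const _).mul (IsPoly.coord 1)).sub
        ((IsPoly.const _).mul (IsPoly.coord 2))).add ((IsPoly.const _).mul (IsPoly.coord 3)))
    · exact (IsPoly.const _).mul ((((IsPoly.const _).mul (IsPoly.coord 0)).add
        ((IsPoly.const _).mul (IsPoly.coord 2))).sub ((IsPoly.const _).mul (IsPoly.coord 3)))
    · exact (IsPoly.const _).mul ((((IsPoly.const _).mul (IsPoly.coord 0)).sub
        ((IsPoly.const _).mul (IsPoly.coord 1))).add ((IsPoly.const _).mul (IsPoly.coord 3)))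
    · exact (IsPoly.const _).mul ((((IsPoly.const _).mul (IsPoly.coord 0)).add
        ((IsPoly.const _).mul (IsPoly.coord 1))).sub ((IsPoly.const _).mul (IsPoly.coord 2)))
  -- the plane `v^⊥` has pole `v`
  have hpole : pole h (covec h v) = v := by
    by_contra hne
    obtain ⟨x, hx⟩ := exists_om_ne_zero M.pf_ne (sub_ne_zero.2 hne)
    apply hx
    have e : covec h v ⬝ᵥ x = om h v x := by
      simp [covec, om, plucker, Fin.sum_univ_succ, dotProduct]
      ring
    rw [sub_eq_add_neg, ← neg_one_smul k v, om_add_left, om_smul_left, om_pole M.pf_ne, e]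
    ring
  have h0 : covec h v ≠ 0 := by
    intro h0
    apply hv
    rw [← hpole, h0, ← zero_smul k (0 : Fin 4 → k), hs]
    ring
  refine ⟨_, isOpen_ne_zero hp hs, nonempty_ne_zero (φ := fun a => F₂fun h b (pole h a)) hs h0
    (by simpa only [hpole] using hv), fun a ha => ?_⟩
  refine Eq.trans ?_ (M.encard_rays ha)
  congr 1
  ext L
  simp only [Set.mem_ofPred_eq]
  refine and_congr_right fun hL => ?_
  simp only [← om_pole M.pf_ne]
  constructor
  · intro H
    obtain ⟨u, v, h0, rfl⟩ := L.exists_eq_lineOf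
    obtain ⟨f₁, f₂, B⟩ :=
      exists_isSymp_of_isotropic M.pf_ne h0 ((M.lineOf_mem_iff h0).1 hL).1
    have := B.expand (pole h a.rep)
    rw [H u left_mem_lineOf, H v right_mem_lineOf, zero_smul, zero_smul, add_zero, add_zero] at this
    exact mem_lineOf.2 ⟨_, _, this.symm⟩
  · exact fun H u hu => M.om_eq_zero hL H hu

end model

/-! ### The section of degree two -/

/-- The section `w` of degree two on the universal family. If `L = ⟨v, u⟩` then
`b(v ∧ u, v ∧ u') = w ω(u, u')` for all `u'` in `v^⊥`, with `b` the (not necessarily symmetric)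
bilinear form defining the quadratic complex. -/
noncomputable def sectionW (h : Fin 6 → k) (b : Fin 6 → Fin 6 → k) (v : Fin 4 → k) (L : Line k) :
    k :=
  open Classical in
  if H : ∃ c, ∀ u ∈ L.toSubmodule, ∀ u', om h v u' = 0 →
      bil b (plucker v u) (plucker v u') = c * om h u u' then H.choose else 0

/-- A vector in `v^⊥` depending linearly on `v`; it equals `u` when `ω(v, x) = 1`
and `ω(v, u) = 0`. -/
def orthVec (h : Fin 6 → k) (x u v : Fin 4 → k) : Fin 4 → k := om h v x • u + om h v u • x

lemma om_orthVec [CharP k 2] (h : Fin 6 → k) (x u v : Fin 4 → k) :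
    om h v (orthVec h x u v) = 0 := by
  simp only [orthVec, om_add_right, om_smul_right]
  linear_combination om h v x * om h v u * (CharTwo.two_eq_zero : (2 : k) = 0)

lemma orthVec_smul (h : Fin 6 → k) (x u : Fin 4 → k) (c : k) (v : Fin 4 → k) :
    orthVec h x u (c • v) = c • orthVec h x u v := by
  simp only [orthVec, om_smul_left]
  module

lemma orthVec_eq {h : Fin 6 → k} {x u v : Fin 4 → k} (hx : om h v x = 1) (hu : om h v u = 0) :
    orthVec h x u v = u := by
  rw [orthVec, hx, hu, one_smul, zero_smul, add_zero]

lemma IsPoly.orthVec {σ : Type*} (h : Fin 6 → k) (x u : Fin 4 → k) {f : (σ → k) → Fin 4 → k}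
    (hf : ∀ i, IsPoly fun y => f y i) (i : Fin 4) :
    IsPoly fun y => LineCongruence.orthVec h x u (f y) i :=
  ((IsPoly.om h hf (g := fun _ => x) fun i => IsPoly.const (x i)).mul (IsPoly.const (u i))).add
    ((IsPoly.om h hf (g := fun _ => u) fun i => IsPoly.const (u i)).mul (IsPoly.const (x i)))

lemma IsPoly.klein {σ : Type*} {f g : (σ → k) → Fin 6 → k} (hf : ∀ i, IsPoly fun x => f x i)
    (hg : ∀ i, IsPoly fun x => g x i) :
    IsPoly fun x => LineCongruence.klein (f x) (g x) :=
  ((((((hf 0).mul (hg 5)).add ((hf 5).mul (hg 0))).sub ((hf 1).mul (hg 4))).sub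
    ((hf 4).mul (hg 1))).add ((hf 2).mul (hg 3))).add ((hf 3).mul (hg 2))

section model

variable {S : Set (Line k)} {h : Fin 6 → k} {b : Fin 6 → Fin 6 → k} [CharP k 2]

lemma IsModel.sectionW_spec (M : IsModel S h b) {L : Line k} (hL : L ∈ S) {v : Fin 4 → k}
    (hv : v ∈ L.toSubmodule) (hv0 : v ≠ 0) {u u' : Fin 4 → k} (hu : u ∈ L.toSubmodule)
    (hu' : om h v u' = 0) :
    bil b (plucker v u) (plucker v u') = sectionW h b v L * om h u u' := by
  have H : ∃ c, ∀ u ∈ L.toSubmodule, ∀ u', om h v u' = 0 →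
      bil b (plucker v u) (plucker v u') = c * om h u u' := by
    obtain ⟨e₂, h0, rfl⟩ := L.exists_eq_lineOf_of_mem hv hv0
    obtain ⟨hom, hq⟩ := (M.lineOf_mem_iff h0).1 hL
    obtain ⟨f₁, f₂, B⟩ := exists_isSymp_of_isotropic M.pf_ne h0 hom
    refine ⟨bil b (plucker v e₂) (plucker v f₂), fun u hu u' hu' => ?_⟩
    obtain ⟨s, t, rfl⟩ := mem_lineOf.1 hu
    rw [B.plucker_eq_of_om_eq_zero hu']
    simp only [plucker_add_right, plucker_smul_right, plucker_self, smul_zero, zero_add,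
      bil_add_right, bil_smul_left, bil_smul_right, hq, om_add_left, om_smul_left, hu',
      om_comm h u' e₂]
    ring
  rw [sectionW, dif_pos H]
  exact H.choose_spec u hu u' hu'

/-- The equation of the Stein factorization. -/
lemma IsModel.sectionW_quadratic (M : IsModel S h b) {L : Line k} (hL : L ∈ S) {v : Fin 4 → k}
    (hv : v ∈ L.toSubmodule) (hv0 : v ≠ 0) :
    sectionW h b v L ^ 2 + F₂fun h b v * sectionW h b v L + F₄fun h b v = 0 := by
  obtain ⟨e₂, h0, rfl⟩ := L.exists_eq_lineOf_of_mem hv hv0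
  obtain ⟨hom, hq⟩ := (M.lineOf_mem_iff h0).1 hL
  obtain ⟨f₁, f₂, B⟩ := exists_isSymp_of_isotropic M.pf_ne h0 hom
  have h1 := M.sectionW_spec hL hv hv0 right_mem_lineOf B.e₁f₂
  have h2 := bil_add_bil M.pf_ne b hom B.e₁f₂
  have h3 := bil_det M.pf_ne b hom B.e₁f₂
  rw [B.e₂f₂] at h1 h2 h3
  rw [hq] at h3
  set w := sectionW h b v (lineOf v e₂ h0)
  have two : (2 : k) = 0 := CharTwo.two_eq_zero
  linear_combination -h3 - w * h2 + (w - bil b (plucker v f₂) (plucker v e₂)) * h1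
    + w ^ 2 * two

/-- In a frame `u₁, u₂` of `v^⊥` modulo `v`, coordinates are given by the symplectic form. -/
lemma om_smul_plucker (hpf : pf h ≠ 0) {v u₁ u₂ u : Fin 4 → k} (h₁ : om h v u₁ = 0)
    (h₂ : om h v u₂ = 0) (hu : om h v u = 0) (h0 : plucker v u₁ ≠ 0) :
    om h u₁ u₂ • plucker v u = om h u u₂ • plucker v u₁ + om h u u₁ • plucker v u₂ := by
  obtain ⟨f₁, f₂, B⟩ := exists_isSymp_of_isotropic hpf h0 h₁
  have e1 := B.plucker_eq_of_om_eq_zero hu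
  have e2 := B.plucker_eq_of_om_eq_zero h₂
  have e3 : om h u u₂ = om h u₂ f₂ * om h u u₁ + om h u₂ u₁ * om h u f₂ := by
    conv_lhs => rw [B.eq_of_om_eq_zero h₂]
    simp only [om_add_right, om_smul_right, om_comm h u v, hu, mul_zero, zero_add]
  rw [e1, e2, e3, om_comm h u₁ u₂]
  have two : (2 : k) = 0 := CharTwo.two_eq_zero
  ext i
  simp only [Pi.add_apply, Pi.smul_apply, smul_eq_mul]
  linear_combination -om h u₂ f₂ * om h u u₁ * plucker v u₁ i * two

/-- The Plücker vector of a ray through `[v]`, recovered from the value of `w`. The vectors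
`u₁, u₂` form a frame of `v^⊥` modulo `v` and the line joining `v` and `u₁` is not a ray. -/
def rayVector (h : Fin 6 → k) (b : Fin 6 → Fin 6 → k) (v u₁ u₂ : Fin 4 → k) (w : k) : Fin 6 → k :=
  (om h u₁ u₂ * w + bil b (plucker v u₂) (plucker v u₁)) • plucker v u₁
    + bil b (plucker v u₁) (plucker v u₁) • plucker v u₂

/-- A ray through `[v]` is determined by the value of `w` on it. -/
lemma IsModel.isPluckerVector_rayVector (M : IsModel S h b) {v u₁ u₂ : Fin 4 → k}
    (h₁ : om h v u₁ = 0) (h₂ : om h v u₂ = 0) (h₁₂ : om h u₁ u₂ ≠ 0)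
    (ha : bil b (plucker v u₁) (plucker v u₁) ≠ 0) {L : Line k} (hL : L ∈ S)
    (hv : v ∈ L.toSubmodule) :
    L.IsPluckerVector (rayVector h b v u₁ u₂ (sectionW h b v L)) := by
  have h0 : plucker v u₁ ≠ 0 := by
    intro h0
    rw [h0] at ha
    simp [bil] at ha
  have hv0 := ne_zero_left_of_plucker h0
  obtain ⟨u, hu0, rfl⟩ := L.exists_eq_lineOf_of_mem hv hv0
  obtain ⟨hom, hq⟩ := (M.lineOf_mem_iff hu0).1 hL
  have e0 := om_smul_plucker M.pf_ne h₁ h₂ hom h0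
  have e1 := M.sectionW_spec hL hv hv0 right_mem_lineOf h₁
  set w := sectionW h b v (lineOf v u hu0)
  have e2 : om h u u₂ * bil b (plucker v u₁) (plucker v u₁)
      + om h u u₁ * bil b (plucker v u₂) (plucker v u₁) = om h u₁ u₂ * (w * om h u u₁) := by
    rw [← e1, ← bil_smul_left, ← bil_smul_left, ← bil_smul_left, ← bil_add_left, e0]
  have ht : om h u u₁ ≠ 0 := by
    intro ht
    rw [ht, mul_zero, mul_zero, zero_mul, add_zero] at e2
    have hs := (mul_eq_zero.1 e2).resolve_right ha
    rw [hs, ht, zero_smul, zero_smul, add_zero] at e0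
    exact hu0 ((smul_eq_zero.1 e0).resolve_left h₁₂)
  refine isPluckerVector_lineOf.2 ⟨om h u₁ u₂ * bil b (plucker v u₁) (plucker v u₁) / om h u u₁,
    div_ne_zero (mul_ne_zero h₁₂ ha) ht, ?_⟩
  rw [div_eq_mul_inv, mul_comm, mul_comm (om h u₁ u₂), mul_smul, mul_smul, e0, eq_comm,
    inv_smul_eq_iff₀ ht, rayVector]
  have two : (2 : k) = 0 := CharTwo.two_eq_zero
  ext i
  simp only [Pi.add_apply, Pi.smul_apply, smul_eq_mul]
  linear_combination plucker v u₁ i * (e2 - om h u u₁ * bil b (plucker v u₂) (plucker v u₁) * two)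

/-- Every root of the quadratic equation of the Stein factorization comes from a ray. -/
lemma IsModel.exists_ray_of_root (M : IsModel S h b) {v : Fin 4 → k}
    (hv : ¬ IsBasePoint h b v) {w : k} (hw : w ^ 2 + F₂fun h b v * w + F₄fun h b v = 0) :
    ∃ L ∈ S, v ∈ L.toSubmodule ∧ sectionW h b v L = w := by
  obtain ⟨u₁, f₁, u₂, B, ha⟩ := exists_isSymp_of_not_isBasePoint M.pf_ne hv
  have h2 := bil_add_bil M.pf_ne b B.e₁e₂ B.e₁f₂
  have h3 := bil_det M.pf_ne b B.e₁e₂ B.e₁f₂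
  rw [B.e₂f₂, mul_one] at h2
  rw [B.e₂f₂, one_pow, mul_one] at h3
  have h0 := B.plucker_smul_add_ne_zero (s := w + bil b (plucker v u₂) (plucker v u₁)) ha
  have two : (2 : k) = 0 := CharTwo.two_eq_zero
  have hmem : lineOf v _ h0 ∈ S := by
    refine (M.lineOf_mem_iff h0).2 ⟨?_, ?_⟩
    · rw [om_add_right, om_smul_right, om_smul_right, B.e₁e₂, B.e₁f₂]; ring
    · rw [bil_self_smul_add_smul M.pf_ne b B.e₁e₂ B.e₁f₂, B.e₂f₂, mul_one, ← h2]
      rw [← h2] at hw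
      set a := bil b (plucker v u₁) (plucker v u₁)
      set c := bil b (plucker v u₂) (plucker v u₂)
      set m := bil b (plucker v u₁) (plucker v u₂)
      set n := bil b (plucker v u₂) (plucker v u₁)
      linear_combination a * (hw + h3) + (a * w * n + a * m * n + a * n ^ 2) * two
  refine ⟨_, hmem, left_mem_lineOf, ?_⟩
  have h4 := M.sectionW_spec hmem left_mem_lineOf (ne_zero_left_of_plucker h0) right_mem_lineOf
    B.e₁e₂
  simp only [plucker_add_right, plucker_smul_right, bil_add_left, bil_smul_left, om_add_left,
    om_smul_left, om_self, om_comm h u₂ u₁, B.e₂f₂] at h4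
  apply mul_right_cancel₀ ha
  linear_combination -h4 + bil b (plucker v u₂) (plucker v u₁)
    * bil b (plucker v u₁) (plucker v u₁) * two

/-- Two rays through a point outside `F₂ = 0` whose `w`-values add up to `F₂`. -/
lemma IsModel.exists_two_rays [IsAlgClosed k] (M : IsModel S h b) {v : Fin 4 → k}
    (hF : F₂fun h b v ≠ 0) : ∃ L ∈ S, ∃ L' ∈ S, v ∈ L.toSubmodule ∧ v ∈ L'.toSubmodule ∧
      sectionW h b v L' = sectionW h b v L + F₂fun h b v := by
  obtain ⟨w, hw⟩ := exists_root_quadratic one_ne_zero (F₂fun h b v) (F₄fun h b v)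
  obtain ⟨L, hL, hvL, rfl⟩ := M.exists_ray_of_root (not_isBasePoint M.pf_ne hF)
    (w := w) (by linear_combination hw)
  obtain ⟨L', hL', hvL', hw'⟩ := M.exists_ray_of_root (not_isBasePoint M.pf_ne hF)
    (w := sectionW h b v L + F₂fun h b v) (by
      have two : (2 : k) = 0 := CharTwo.two_eq_zero
      linear_combination hw + (F₂fun h b v * sectionW h b v L + F₂fun h b v ^ 2) * two)
  exact ⟨L, hL, L', hL', hvL, hvL', hw'⟩

lemma IsModel.isRegularSection_sectionW [Infinite k] (M : IsModel S h b) :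
    IsRegularSection S 2 (sectionW h b) := by
  intro L₀ hL₀ v₀ hv₀ hv0
  obtain ⟨u₀, h0, rfl⟩ := L₀.exists_eq_lineOf_of_mem hv₀ hv0
  obtain ⟨hom, hq⟩ := (M.lineOf_mem_iff h0).1 hL₀
  obtain ⟨f₁, f₂, B⟩ := exists_isSymp_of_isotropic M.pf_ne h0 hom
  have hX : ∀ i, IsPoly fun x : Fin 4 ⊕ Fin 6 → k => x (Sum.inl i) := fun i => IsPoly.coord _
  have hY : ∀ i, IsPoly fun x : Fin 4 ⊕ Fin 6 → k => x (Sum.inr i) := fun i => IsPoly.coord _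
  -- `w = b(p, v ∧ u') / ω(u, u')` for `p = v ∧ u` and `u' ∈ v^⊥`; the denominator is a form in
  -- `v` and `p` after multiplication by `ω(v, f₁)`
  obtain ⟨f, hf, hfe⟩ := exists_isBihomogeneous (a := 1 + 2) (b := 1)
    (φ := fun v p => om h v f₁ * bil b p (plucker v (orthVec h f₁ f₂ v)))
    ((IsPoly.om h hX fun i => IsPoly.const (f₁ i)).mul
      (IsPoly.bil b hY (IsPoly.plucker hX (IsPoly.orthVec h f₁ f₂ hX))))
    (fun c v p => by
      simp only [orthVec_smul, om_smul_left, plucker_smul_left, plucker_smul_right,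
        bil_smul_right]
      ring)
    (fun c v p => by rw [bil_smul_left]; ring)
  obtain ⟨g, hg, hge⟩ := exists_isBihomogeneous (a := 1) (b := 1)
    (φ := fun v p => pf h * klein p (plucker f₁ (orthVec h f₁ f₂ v)))
    ((IsPoly.const _).mul (IsPoly.klein hY
      (IsPoly.plucker (fun i => IsPoly.const (f₁ i)) (IsPoly.orthVec h f₁ f₂ hX))))
    (fun c v p => by simp only [orthVec_smul, plucker_smul_right, klein_smul_right]; ring)
    (fun c v p => by rw [klein_smul_left]; ring)
  refine ⟨1, 1, f, g, hf, hg, fun p hp => ?_, fun L hL v hv hvne p hp _ => ?_⟩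
  · obtain ⟨c, hc, rfl⟩ := isPluckerVector_lineOf.1 hp
    rw [hge, orthVec_eq B.e₁f₁ B.e₁f₂, klein_smul_left, mul_left_comm, B.pf_mul_klein, mul_one]
    exact hc
  · rw [hge, hfe]
    obtain ⟨u, hu0, rfl, rfl⟩ := L.exists_plucker_eq hv hvne hp
    have h1 := M.sectionW_spec hL hv hvne right_mem_lineOf (om_orthVec h f₁ f₂ v)
    rw [h1, pf_mul_klein, om_orthVec, ((M.lineOf_mem_iff hu0).1 hL).1]
    linear_combination -sectionW h b v (lineOf v u hu0) * om h v f₁ * om h u (orthVec h f₁ f₂ v) *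
      (CharTwo.two_eq_zero : (2 : k) = 0)

end model

/-! ### Denominators of rational functions on affine four-space -/

lemma IsPoly.prod {σ ι : Type*} (s : Finset ι) {f : ι → (σ → k) → k} (h : ∀ i, IsPoly (f i)) :
    IsPoly (fun x => ∏ i ∈ s, f i x) := by
  choose P hP using h
  exact ⟨∏ i ∈ s, P i, by simp [hP]⟩

lemma IsPoly.exists_forall_ne_zero [Infinite k] {σ ι : Type*} (s : Finset ι)
    {f : ι → (σ → k) → k} (h : ∀ i, IsPoly (f i)) (h0 : ∀ i ∈ s, ∃ x, f i x ≠ 0) :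
    ∃ x, ∀ i ∈ s, f i x ≠ 0 := by
  classical
  suffices ∃ x, ∏ i ∈ s, f i x ≠ 0 by
    obtain ⟨x, hx⟩ := this
    exact ⟨x, fun i hi => Finset.prod_ne_zero_iff.1 hx i hi⟩
  induction s using Finset.induction_on with
  | empty => exact ⟨0, by simp⟩
  | insert a s ha ih =>
    obtain ⟨x, hx, hx'⟩ := (h a).exists_ne_zero_and (IsPoly.prod s h)
      (h0 a (Finset.mem_insert_self a s)) (ih fun i hi => h0 i (Finset.mem_insert_of_mem hi))
    exact ⟨x, by rw [Finset.prod_insert ha]; exact mul_ne_zero hx hx'⟩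

lemma IsPoly.eq_zero_of_eval [Infinite k] {σ : Type*} {φ : (σ → k) → k} (hφ : IsPoly φ)
    (h0 : ∃ x, φ x ≠ 0) {P : MvPolynomial σ k} (H : ∀ x, φ x ≠ 0 → MvPolynomial.eval x P = 0) :
    P = 0 := by
  by_contra hP
  have : ∃ x, MvPolynomial.eval x P ≠ 0 := by
    by_contra! h
    exact hP (MvPolynomial.funext fun x => by rw [h, map_zero])
  obtain ⟨x, hx, hx'⟩ := hφ.exists_ne_zero_and ⟨P, fun _ => rfl⟩ h0 this
  exact hx' (H x hx)

lemma polynomial_eval_aeval {τ : Type*} (s : k) (P : τ → Polynomial k) (f : MvPolynomial τ k) :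
    (MvPolynomial.aeval P f).eval s = MvPolynomial.eval (fun i => (P i).eval s) f := by
  induction f using MvPolynomial.induction_on with
  | C a => simp
  | add p q hp hq => rw [map_add, map_add, Polynomial.eval_add, hp, hq]
  | mul_X p i hp => rw [map_mul, map_mul, Polynomial.eval_mul, hp, MvPolynomial.aeval_X,
      MvPolynomial.eval_X]

lemma IsPoly.incidence {σ : Type*} {f : (σ → k) → Fin 4 → k} {g : (σ → k) → Fin 6 → k}
    (hf : ∀ i, IsPoly fun x => f x i) (hg : ∀ i, IsPoly fun x => g x i) (i : Fin 4) :
    IsPoly fun x => LineCongruence.incidence (f x) (g x) i := by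
  fin_cases i
  · exact (((hf 1).mul (hg 5)).sub ((hf 2).mul (hg 4))).add ((hf 3).mul (hg 3))
  · exact (((hf 0).mul (hg 5)).sub ((hf 2).mul (hg 2))).add ((hf 3).mul (hg 1))
  · exact (((hf 0).mul (hg 4)).sub ((hf 1).mul (hg 2))).add ((hf 3).mul (hg 0))
  · exact (((hf 0).mul (hg 3)).sub ((hf 1).mul (hg 1))).add ((hf 2).mul (hg 0))

lemma exists_incidence_ne_zero {t : Fin 4 → k} (ht : t ≠ 0) :
    ∃ i, ∃ x y, incidence t (plucker x y) i ≠ 0 := by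
  obtain ⟨j, hj⟩ := Function.ne_iff.1 ht
  fin_cases j
  · exact ⟨1, Pi.single 2 1, Pi.single 3 1, by simpa [incidence, plucker] using hj⟩
  · exact ⟨0, Pi.single 2 1, Pi.single 3 1, by simpa [incidence, plucker] using hj⟩
  · exact ⟨0, Pi.single 1 1, Pi.single 3 1, by simpa [incidence, plucker] using hj⟩
  · exact ⟨0, Pi.single 1 1, Pi.single 2 1, by simpa [incidence, plucker] using hj⟩

lemma plucker_ne_zero_of_incidence {t x y : Fin 4 → k} (h : incidence t (plucker x y) ≠ 0)
    (s : k) : plucker t (x + s • y) ≠ 0 := by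
  intro h0
  have hxy : plucker x y ≠ 0 := by
    intro h0
    rw [h0, ← zero_smul k (0 : Fin 6 → k), incidence_smul, zero_smul] at h
    exact h rfl
  have ht : t ≠ 0 := by
    rintro rfl
    exact h (by ext i; fin_cases i <;> simp [incidence])
  obtain ⟨c, hc⟩ := exists_smul_of_plucker_eq_zero ht h0
  have hv : x + s • y ≠ 0 := by
    intro hv
    have : plucker (x + s • y) y = 0 := by rw [hv, plucker_zero_left]
    rw [plucker_add_left, plucker_smul_left, plucker_self, smul_zero, add_zero] at this
    exact hxy this
  have hc0 : c ≠ 0 := by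
    rintro rfl
    rw [zero_smul] at hc
    exact hv hc
  apply h
  rw [← mem_iff_incidence (isPluckerVector_plucker hxy), ← inv_smul_smul₀ hc0 t, ← hc]
  exact Submodule.smul_mem _ _ (mem_lineOf.2 ⟨1, s, by rw [one_smul]⟩)

/-- A nonunit has a zero outside finitely many given lines through the origin, since it has a zero
on a general affine line. -/
lemma exists_eval_eq_zero_off_lines [IsAlgClosed k] {D : MvPolynomial (Fin 4) k}
    (hD : ¬ IsUnit D) (T : Finset (Fin 4 → k)) (hT : ∀ t ∈ T, t ≠ 0) :
    ∃ v, MvPolynomial.eval v D = 0 ∧ ∀ t ∈ T, plucker t v ≠ 0 := by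
  classical
  have hX : ∀ i, IsPoly fun x : Fin 4 ⊕ Fin 4 → k => x (Sum.inl i) := fun i => IsPoly.coord _
  have hY : ∀ i, IsPoly fun x : Fin 4 ⊕ Fin 4 → k => x (Sum.inr i) := fun i => IsPoly.coord _
  have h1 : ∀ t : Fin 4 → k, ∃ i, t ≠ 0 → ∃ x y, incidence t (plucker x y) i ≠ 0 := fun t => by
    by_cases ht : t = 0
    · exact ⟨0, fun h => absurd ht h⟩
    · obtain ⟨i, hi⟩ := exists_incidence_ne_zero ht
      exact ⟨i, fun _ => hi⟩
  choose j hj using h1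
  obtain ⟨z, hz⟩ := IsPoly.exists_forall_ne_zero T
    (f := fun (t : Fin 4 → k) (z : Fin 4 ⊕ Fin 4 → k) =>
      incidence t (plucker (fun i => z (Sum.inl i)) fun i => z (Sum.inr i)) (j t))
    (fun t => IsPoly.incidence (f := fun _ => t) (fun i => IsPoly.const (t i))
      (IsPoly.plucker hX hY) _)
    (fun t ht => by
      obtain ⟨x, y, hxy⟩ := hj t (hT t ht)
      exact ⟨Sum.elim x y, by simpa using hxy⟩)
  by_cases hc : ∃ x y, MvPolynomial.eval (x + y) D - MvPolynomial.eval x D ≠ 0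
  · obtain ⟨x, y, hxy⟩ := hc
    obtain ⟨z, hz, hz'⟩ := (IsPoly.prod T
      (f := fun (t : Fin 4 → k) (z : Fin 4 ⊕ Fin 4 → k) =>
        incidence t (plucker (fun i => z (Sum.inl i)) fun i => z (Sum.inr i)) (j t))
      (fun t => IsPoly.incidence (f := fun _ => t) (fun i => IsPoly.const (t i))
      (IsPoly.plucker hX hY) _)
      ).exists_ne_zero_and
      ((IsPoly.eval D (g := fun z : Fin 4 ⊕ Fin 4 → k =>
        (fun i => z (Sum.inl i)) + fun i => z (Sum.inr i)) fun i => (hX i).add (hY i)).sub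
        (IsPoly.eval D (g := fun z : Fin 4 ⊕ Fin 4 → k => fun i => z (Sum.inl i)) hX))
      ⟨z, Finset.prod_ne_zero_iff.2 hz⟩ ⟨Sum.elim x y, by simpa using hxy⟩
    rw [Finset.prod_ne_zero_iff] at hz
    set x := fun i => z (Sum.inl i)
    set y := fun i => z (Sum.inr i)
    set P : Polynomial k := MvPolynomial.aeval
      (fun i => Polynomial.C (x i) + Polynomial.X * Polynomial.C (y i)) D
    have hP : ∀ s, P.eval s = MvPolynomial.eval (x + s • y) D := by
      intro s
      rw [polynomial_eval_aeval]
      congr 2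
      ext i
      simp only [Polynomial.eval_add, Polynomial.eval_mul, Polynomial.eval_C, Polynomial.eval_X,
        Pi.add_apply, Pi.smul_apply, smul_eq_mul]
    have hdeg : P.degree ≠ 0 := by
      intro h0
      have := Polynomial.eq_C_of_degree_eq_zero h0
      apply hz'
      have e0 := hP 0
      have e1 := hP 1
      rw [this, Polynomial.eval_C] at e0 e1
      rw [zero_smul, add_zero] at e0
      rw [one_smul] at e1
      rw [← e0, ← e1, sub_self]
    obtain ⟨s, hs⟩ := IsAlgClosed.exists_root P hdeg
    refine ⟨x + s • y, (hP s).symm.trans hs, fun t ht => plucker_ne_zero_of_incidence ?_ s⟩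
    exact fun h => hz t ht (by rw [h]; rfl)
  · push Not at hc
    have hDc : D = MvPolynomial.C (MvPolynomial.eval 0 D) := MvPolynomial.funext fun x => by
      have := hc 0 x
      rw [zero_add] at this
      rw [MvPolynomial.eval_C, sub_eq_zero.1 this]
    have hD0 : MvPolynomial.eval 0 D = 0 := by
      by_contra h0
      exact hD (hDc ▸ (IsUnit.mk0 _ h0).map MvPolynomial.C)
    refine ⟨fun i => z (Sum.inl i), by rw [hDc, hD0]; simp, fun t ht => ?_⟩
    have := plucker_ne_zero_of_incidence (t := t) (x := fun i => z (Sum.inl i))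
      (y := fun i => z (Sum.inr i)) (fun h => hz t ht (by rw [h]; rfl)) 0
    rwa [zero_smul, add_zero] at this

/-- A rational function that is locally regular outside finitely many lines through the origin is
a polynomial. -/
lemma dvd_of_forall_exists [IsAlgClosed k] {n f : MvPolynomial (Fin 4) k} (hn : n ≠ 0)
    (T : Finset (Fin 4 → k)) (hT : ∀ t ∈ T, t ≠ 0)
    (H : ∀ v, (∀ t ∈ T, plucker t v ≠ 0) →
      ∃ m g, MvPolynomial.eval v m ≠ 0 ∧ n * g = m * f) : n ∣ f := by
  obtain ⟨n', f', c, hrel, rfl, rfl⟩ := UniqueFactorizationMonoid.exists_reduced_factors n hn f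
  have hc : c ≠ 0 := left_ne_zero_of_mul hn
  suffices IsUnit n' from mul_dvd_mul_left c this.dvd
  by_contra hu
  obtain ⟨v, hv, hvT⟩ := exists_eval_eq_zero_off_lines hu T hT
  obtain ⟨m, g, hm, hmg⟩ := H v hvT
  have h1 : n' * g = m * f' := mul_left_cancel₀ hc (by linear_combination hmg)
  obtain ⟨e, rfl⟩ := hrel.dvd_of_dvd_mul_right (Dvd.intro _ h1)
  exact hm (by rw [map_mul, hv, zero_mul])

/-! ### The ring of sections -/

/-- A function of `v` and `w` which becomes `g₀(v) + g₁(v) w` with polynomials `g₀, g₁` when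
`w` is a root of the equation of the Stein factorization at `v`. -/
def IsRedPoly (h : Fin 6 → k) (b : Fin 6 → Fin 6 → k) (Φ : (Fin 4 → k) → k → k) : Prop :=
  ∃ g₀ g₁, IsPoly g₀ ∧ IsPoly g₁ ∧
    ∀ v w, w ^ 2 + F₂fun h b v * w + F₄fun h b v = 0 → Φ v w = g₀ v + g₁ v * w

namespace IsRedPoly

variable {h : Fin 6 → k} {b : Fin 6 → Fin 6 → k} {Φ Ψ : (Fin 4 → k) → k → k}

lemma of_isPoly {g : (Fin 4 → k) → k} (hg : IsPoly g) : IsRedPoly h b fun v _ => g v :=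
  ⟨g, _, hg, IsPoly.const 0, fun v w _ => by ring⟩

lemma root : IsRedPoly h b fun _ w => w :=
  ⟨_, _, IsPoly.const 0, IsPoly.const 1, fun v w _ => by ring⟩

lemma add (h₁ : IsRedPoly h b Φ) (h₂ : IsRedPoly h b Ψ) :
    IsRedPoly h b fun v w => Φ v w + Ψ v w := by
  obtain ⟨g₀, g₁, p₀, p₁, e⟩ := h₁
  obtain ⟨g₀', g₁', p₀', p₁', e'⟩ := h₂
  exact ⟨_, _, p₀.add p₀', p₁.add p₁', fun v w hw => by
    simp only [e v w hw, e' v w hw]; ring⟩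

lemma mul (h₁ : IsRedPoly h b Φ) (h₂ : IsRedPoly h b Ψ) :
    IsRedPoly h b fun v w => Φ v w * Ψ v w := by
  obtain ⟨g₀, g₁, p₀, p₁, e⟩ := h₁
  obtain ⟨g₀', g₁', p₀', p₁', e'⟩ := h₂
  refine ⟨_, _, (p₀.mul p₀').sub ((p₁.mul p₁').mul (isPoly_F₄fun h b)),
    ((p₀.mul p₁').add (p₁.mul p₀')).sub ((p₁.mul p₁').mul (isPoly_F₂fun h b)),
    fun v w hw => ?_⟩
  simp only [e v w hw, e' v w hw]
  linear_combination g₁ v * g₁' v * hw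

lemma eval {τ : Type*} (f : MvPolynomial τ k) {x : (Fin 4 → k) → k → τ → k}
    (hx : ∀ i, IsRedPoly h b fun v w => x v w i) :
    IsRedPoly h b fun v w => MvPolynomial.eval (x v w) f := by
  induction f using MvPolynomial.induction_on with
  | C a => simpa using of_isPoly (IsPoly.const a)
  | add p q hp hq => simpa using hp.add hq
  | mul_X p i hp => simpa using hp.mul (hx i)

end IsRedPoly

lemma IsBasePoint.smul {h : Fin 6 → k} {b : Fin 6 → Fin 6 → k} {v : Fin 4 → k}
    (hv : IsBasePoint h b v) (c : k) : IsBasePoint h b (c • v) := fun u hu => by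
  by_cases hc : c = 0
  · rw [hc, zero_smul]
    exact isBasePoint_zero h b u (om_zero_left h u)
  · rw [om_smul_left] at hu
    rw [plucker_smul_left, bil_smul_left, bil_smul_right, hv u ((mul_eq_zero.1 hu).resolve_left hc),
      mul_zero, mul_zero]

/-- Finitely many vectors such that every base point is proportional to one of them. -/
lemma IsModel.exists_finset_base {S : Set (Line k)} {h : Fin 6 → k} {b : Fin 6 → Fin 6 → k}
    (M : IsModel S h b) : ∃ T : Finset (Fin 4 → k),
    (∀ t ∈ T, t ≠ 0) ∧ ∀ v, (∀ t ∈ T, plucker t v ≠ 0) → ¬ IsBasePoint h b v := by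
  classical
  refine ⟨insert (Pi.single 0 1) (M.finite_base.toFinset.image Projectivization.rep), ?_,
    fun v hv hb => ?_⟩
  · intro t ht
    rcases Finset.mem_insert.1 ht with rfl | ht
    · intro h
      simpa using congrFun h 0
    · obtain ⟨x, -, rfl⟩ := Finset.mem_image.1 ht
      exact x.rep_nonzero
  · have hv0 : v ≠ 0 := ne_zero_right_of_plucker (hv _ (Finset.mem_insert_self _ _))
    obtain ⟨c, hc⟩ := Projectivization.exists_smul_eq_mk_rep k v hv0
    refine hv (Projectivization.mk k v hv0).rep (Finset.mem_insert_of_mem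
      (Finset.mem_image_of_mem _ ?_)) ?_
    · rw [Set.Finite.mem_toFinset, Set.mem_ofPred_eq, ← hc]
      exact hb.smul _
    · rw [← hc, Units.smul_def, plucker_smul_left, plucker_self, smul_zero]

section model

variable {S : Set (Line k)} {h : Fin 6 → k} {b : Fin 6 → Fin 6 → k} [CharP k 2]

/-- Near a point which is not a base point, Plücker coordinates of the rays are given by
polynomials in `v` and `w`. -/
lemma IsModel.exists_chart (M : IsModel S h b) {v₀ : Fin 4 → k} (hb : ¬ IsBasePoint h b v₀) :
    ∃ (κ : (Fin 4 → k) → k) (ρ : (Fin 4 → k) → k → Fin 6 → k), IsPoly κ ∧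
      (∀ i, IsRedPoly h b fun v w => (Sum.elim v (ρ v w) : Fin 4 ⊕ Fin 6 → k) i) ∧ κ v₀ ≠ 0 ∧
      ∀ L ∈ S, ∀ v ∈ L.toSubmodule, κ v ≠ 0 → L.IsPluckerVector (ρ v (sectionW h b v L)) := by
  obtain ⟨e₂, f₁, f₂, B, ha⟩ := exists_isSymp_of_not_isBasePoint M.pf_ne hb
  have hV : ∀ i, IsPoly fun v : Fin 4 → k => v i := IsPoly.coord
  let u₁ := fun v => orthVec h f₁ e₂ v
  let u₂ := fun v => orthVec h f₁ f₂ v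
  have hu₁ : ∀ i, IsPoly fun v => u₁ v i := IsPoly.orthVec h f₁ e₂ hV
  have hu₂ : ∀ i, IsPoly fun v => u₂ v i := IsPoly.orthVec h f₁ f₂ hV
  have e₁ : u₁ v₀ = e₂ := orthVec_eq B.e₁f₁ B.e₁e₂
  have e₂' : u₂ v₀ = f₂ := orthVec_eq B.e₁f₁ B.e₁f₂
  refine ⟨fun v => bil b (plucker v (u₁ v)) (plucker v (u₁ v)) * om h (u₁ v) (u₂ v),
    fun v w => rayVector h b v (u₁ v) (u₂ v) w,
    (IsPoly.bil b (IsPoly.plucker hV hu₁) (IsPoly.plucker hV hu₁)).mul (IsPoly.om h hu₁ hu₂),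
    ?_, ?_, fun L hL v hv hκ => ?_⟩
  · rintro (i | i)
    · exact IsRedPoly.of_isPoly (hV i)
    · exact ((((IsRedPoly.of_isPoly (IsPoly.om h hu₁ hu₂)).mul IsRedPoly.root).add
        (IsRedPoly.of_isPoly (IsPoly.bil b (IsPoly.plucker hV hu₂) (IsPoly.plucker hV hu₁)))).mul
        (IsRedPoly.of_isPoly (IsPoly.plucker hV hu₁ i))).add
        ((IsRedPoly.of_isPoly (IsPoly.bil b (IsPoly.plucker hV hu₁) (IsPoly.plucker hV hu₁))).mul
        (IsRedPoly.of_isPoly (IsPoly.plucker hV hu₂ i)))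
  · simp only [e₁, e₂', B.e₂f₂, mul_one]
    exact ha
  · obtain ⟨hav, hδ⟩ := mul_ne_zero_iff.1 hκ
    exact M.isPluckerVector_rayVector (om_orthVec h f₁ e₂ v) (om_orthVec h f₁ f₂ v) hδ hav hL hv

/-- Regularity at one ray, expressed through `v` and the section of degree two. -/
lemma IsModel.exists_isRedPoly (M : IsModel S h b) {d : ℕ} {σ : (Fin 4 → k) → Line k → k}
    (hσ : IsRegularSection S d σ) {L₀ : Line k} (hL₀ : L₀ ∈ S) {v₀ : Fin 4 → k}
    (hv₀ : v₀ ∈ L₀.toSubmodule) (hb : ¬ IsBasePoint h b v₀) :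
    ∃ Φ Ψ, IsRedPoly h b Φ ∧ IsRedPoly h b Ψ ∧ Ψ v₀ (sectionW h b v₀ L₀) ≠ 0 ∧
      ∀ L ∈ S, ∀ v ∈ L.toSubmodule, v ≠ 0 →
        σ v L * Ψ v (sectionW h b v L) = Φ v (sectionW h b v L) := by
  obtain ⟨κ, ρ, hκ, hx, hκ0, H⟩ := M.exists_chart hb
  have hv0 : v₀ ≠ 0 := by
    rintro rfl
    exact hb (isBasePoint_zero h b)
  obtain ⟨m, n, f, g, -, -, hg0, hfg⟩ := hσ L₀ hL₀ v₀ hv₀ hv0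
  have hF := IsRedPoly.eval f hx
  have hG := IsRedPoly.eval g hx
  have hκ' : IsRedPoly h b fun v _ => κ v := IsRedPoly.of_isPoly hκ
  -- the extra factors make the identity hold also where the chart is not defined
  refine ⟨_, _, hκ'.mul (hF.mul hG), hκ'.mul (hG.mul hG), ?_, fun L hL v hv hvne => ?_⟩
  · have := hg0 _ (H L₀ hL₀ v₀ hv₀ hκ0)
    exact mul_ne_zero hκ0 (mul_ne_zero this this)
  · by_cases hκv : κ v = 0
    · simp only [hκv]; ring
    have key := hfg L hL v hv hvne _ (H L hL v hv hκv)
    by_cases hgv : MvPolynomial.eval (Sum.elim v (ρ v (sectionW h b v L))) g = 0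
    · simp only [hgv]; ring
    · have := key hgv
      linear_combination (κ v * MvPolynomial.eval (Sum.elim v (ρ v (sectionW h b v L))) g) * this

/-- Near a point which is not a base point, a section is `(f₀ + f₁ w) / n` with polynomials
`n, f₀, f₁` in the coordinates of the point. -/
lemma IsModel.exists_local_form [IsAlgClosed k] (M : IsModel S h b) {d : ℕ}
    {σ : (Fin 4 → k) → Line k → k}
    (hσ : IsRegularSection S d σ) {v₀ : Fin 4 → k} (hb : ¬ IsBasePoint h b v₀) :
    ∃ n f₀ f₁ : MvPolynomial (Fin 4) k, MvPolynomial.eval v₀ n ≠ 0 ∧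
      ∀ L ∈ S, ∀ v ∈ L.toSubmodule, v ≠ 0 → σ v L * MvPolynomial.eval v n
        = MvPolynomial.eval v f₀ + MvPolynomial.eval v f₁ * sectionW h b v L := by
  have two : (2 : k) = 0 := CharTwo.two_eq_zero
  obtain ⟨w₁, hw₁⟩ := exists_root_quadratic one_ne_zero (F₂fun h b v₀) (F₄fun h b v₀)
  replace hw₁ : w₁ ^ 2 + F₂fun h b v₀ * w₁ + F₄fun h b v₀ = 0 := by linear_combination hw₁
  have hw₂ : (w₁ + F₂fun h b v₀) ^ 2 + F₂fun h b v₀ * (w₁ + F₂fun h b v₀) + F₄fun h b v₀ = 0 := by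
    linear_combination hw₁ + (F₂fun h b v₀ * w₁ + F₂fun h b v₀ ^ 2) * two
  -- a denominator which vanishes at neither of the two points of the fibre
  obtain ⟨Φ, Ψ, hΦ, hΨ, hΨ₁, hΨ₂, H⟩ : ∃ Φ Ψ, IsRedPoly h b Φ ∧ IsRedPoly h b Ψ ∧ Ψ v₀ w₁ ≠ 0 ∧
      Ψ v₀ (w₁ + F₂fun h b v₀) ≠ 0 ∧ ∀ L ∈ S, ∀ v ∈ L.toSubmodule, v ≠ 0 →
        σ v L * Ψ v (sectionW h b v L) = Φ v (sectionW h b v L) := by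
    obtain ⟨L₁, hL₁, hvL₁, e₁⟩ := M.exists_ray_of_root hb hw₁
    obtain ⟨L₂, hL₂, hvL₂, e₂⟩ := M.exists_ray_of_root hb hw₂
    obtain ⟨Φ₁, Ψ₁, hΦ₁, hΨ₁, h₁, H₁⟩ := M.exists_isRedPoly hσ hL₁ hvL₁ hb
    obtain ⟨Φ₂, Ψ₂, hΦ₂, hΨ₂, h₂, H₂⟩ := M.exists_isRedPoly hσ hL₂ hvL₂ hb
    rw [e₁] at h₁
    rw [e₂] at h₂
    by_cases h₁₂ : Ψ₁ v₀ (w₁ + F₂fun h b v₀) = 0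
    · by_cases h₂₁ : Ψ₂ v₀ w₁ = 0
      · refine ⟨_, _, hΦ₁.add hΦ₂, hΨ₁.add hΨ₂, by rwa [h₂₁, add_zero], by rwa [h₁₂, zero_add],
          fun L hL v hv hv0 => ?_⟩
        rw [mul_add, H₁ L hL v hv hv0, H₂ L hL v hv hv0]
      · exact ⟨Φ₂, Ψ₂, hΦ₂, hΨ₂, h₂₁, h₂, H₂⟩
    · exact ⟨Φ₁, Ψ₁, hΦ₁, hΨ₁, h₁, h₁₂, H₁⟩
  -- multiply numerator and denominator by the conjugate of the denominator
  obtain ⟨g₀, g₁, hg₀, hg₁, eΨ⟩ := hΨ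
  have hconj : IsRedPoly h b fun v w => g₀ v + g₁ v * (w + F₂fun h b v) :=
    (IsRedPoly.of_isPoly hg₀).add ((IsRedPoly.of_isPoly hg₁).mul
      (IsRedPoly.root.add (IsRedPoly.of_isPoly (isPoly_F₂fun h b))))
  obtain ⟨_, _, ⟨f₀, hf₀⟩, ⟨f₁, hf₁⟩, ef⟩ := hΦ.mul hconj
  obtain ⟨n, hn⟩ := (((hg₀.pow 2).add ((hg₀.mul hg₁).mul (isPoly_F₂fun h b))).add
    ((hg₁.pow 2).mul (isPoly_F₄fun h b)))
  have hnorm : ∀ v w, w ^ 2 + F₂fun h b v * w + F₄fun h b v = 0 →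
      MvPolynomial.eval v n = Ψ v w * (g₀ v + g₁ v * (w + F₂fun h b v)) := fun v w hw => by
    rw [hn, eΨ v w hw]
    linear_combination -g₁ v ^ 2 * hw + (g₁ v ^ 2 * F₄fun h b v - g₀ v * g₁ v * w) * two
  refine ⟨n, f₀, f₁, ?_, fun L hL v hv hv0 => ?_⟩
  · rw [hnorm v₀ w₁ hw₁, ← eΨ v₀ _ hw₂]
    exact mul_ne_zero hΨ₁ hΨ₂
  · have hw := M.sectionW_quadratic hL hv hv0
    rw [hnorm v _ hw, ← mul_assoc, H L hL v hv hv0, hf₀, hf₁, ← ef v _ hw]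

/-- `1` and `w` are linearly independent over the polynomials. -/
lemma IsModel.eq_zero_of_add_mul_sectionW [IsAlgClosed k] (M : IsModel S h b)
    {A B : MvPolynomial (Fin 4) k}
    (H : ∀ L ∈ S, ∀ v ∈ L.toSubmodule, v ≠ 0 →
      MvPolynomial.eval v A + MvPolynomial.eval v B * sectionW h b v L = 0) : A = 0 ∧ B = 0 := by
  obtain ⟨L, hL⟩ := M.irreducible.nonempty
  obtain ⟨v, -, hv⟩ := M.exists_F₂fun_ne_zero hL
  have h0 : ∀ v, F₂fun h b v ≠ 0 → MvPolynomial.eval v A = 0 ∧ MvPolynomial.eval v B = 0 := by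
    intro v hv
    obtain ⟨L₁, hL₁, L₂, hL₂, h₁, h₂, e⟩ := M.exists_two_rays hv
    have hv0 : v ≠ 0 := by
      rintro rfl
      exact not_isBasePoint M.pf_ne hv (isBasePoint_zero h b)
    have E₁ := H L₁ hL₁ v h₁ hv0
    have E₂ := H L₂ hL₂ v h₂ hv0
    have hB : MvPolynomial.eval v B = 0 := by
      apply (mul_eq_zero.1 (?_ : MvPolynomial.eval v B * F₂fun h b v = 0)).resolve_right hv
      rw [e] at E₂
      linear_combination E₂ - E₁
    rw [hB] at E₁
    exact ⟨by linear_combination E₁, hB⟩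
  exact ⟨(isPoly_F₂fun h b).eq_zero_of_eval ⟨v, hv⟩ fun x hx => (h0 x hx).1,
    (isPoly_F₂fun h b).eq_zero_of_eval ⟨v, hv⟩ fun x hx => (h0 x hx).2⟩

/-- A regular section is `A + B w` with polynomials `A, B`, at least away from base points. -/
lemma IsModel.exists_eq_add_mul_of_not_isBasePoint [IsAlgClosed k] (M : IsModel S h b) {d : ℕ}
    {σ : (Fin 4 → k) → Line k → k} (hσ : IsRegularSection S d σ) :
    ∃ A B : MvPolynomial (Fin 4) k, ∀ L ∈ S, ∀ v ∈ L.toSubmodule, ¬ IsBasePoint h b v →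
      σ v L = MvPolynomial.eval v A + MvPolynomial.eval v B * sectionW h b v L := by
  obtain ⟨T, hT, hTb⟩ := M.exists_finset_base
  obtain ⟨L₀, hL₀⟩ := M.irreducible.nonempty
  obtain ⟨v₀, -, hv₀⟩ := M.exists_F₂fun_ne_zero hL₀
  obtain ⟨n, f₀, f₁, hn, H⟩ := M.exists_local_form hσ (not_isBasePoint M.pf_ne hv₀)
  have hn0 : n ≠ 0 := by
    rintro rfl
    exact hn (map_zero _)
  have key : ∀ v, ¬ IsBasePoint h b v → ∃ m g₀ g₁, MvPolynomial.eval v m ≠ 0 ∧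
      n * g₀ = m * f₀ ∧ n * g₁ = m * f₁ ∧ ∀ L ∈ S, ∀ v ∈ L.toSubmodule, v ≠ 0 →
        σ v L * MvPolynomial.eval v m
          = MvPolynomial.eval v g₀ + MvPolynomial.eval v g₁ * sectionW h b v L := by
    intro v hv
    obtain ⟨m, g₀, g₁, hm, H'⟩ := M.exists_local_form hσ hv
    obtain ⟨h1, h2⟩ := M.eq_zero_of_add_mul_sectionW (A := n * g₀ - m * f₀)
      (B := n * g₁ - m * f₁) fun L hL v hv hv0 => by
        have E := H L hL v hv hv0
        have E' := H' L hL v hv hv0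
        simp only [map_sub, map_mul]
        linear_combination MvPolynomial.eval v m * E - MvPolynomial.eval v n * E'
    exact ⟨m, g₀, g₁, hm, sub_eq_zero.1 h1, sub_eq_zero.1 h2, H'⟩
  obtain ⟨A, rfl⟩ := dvd_of_forall_exists (f := f₀) hn0 T hT fun v hv => by
    obtain ⟨m, g₀, g₁, hm, e₀, -⟩ := key v (hTb v hv)
    exact ⟨m, g₀, hm, e₀⟩
  obtain ⟨B, rfl⟩ := dvd_of_forall_exists (f := f₁) hn0 T hT fun v hv => by
    obtain ⟨m, g₀, g₁, hm, -, e₁, -⟩ := key v (hTb v hv)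
    exact ⟨m, g₁, hm, e₁⟩
  refine ⟨A, B, fun L hL v hv hb => ?_⟩
  obtain ⟨m, g₀, g₁, hm, e₀, e₁, H'⟩ := key v hb
  obtain rfl : g₀ = m * A := mul_left_cancel₀ hn0 (by linear_combination e₀)
  obtain rfl : g₁ = m * B := mul_left_cancel₀ hn0 (by linear_combination e₁)
  have hv0 : v ≠ 0 := by
    rintro rfl
    exact hb (isBasePoint_zero h b)
  have E := H' L hL v hv hv0
  simp only [map_mul] at E
  exact mul_right_cancel₀ hm (by linear_combination E)

end model

/-! ### The equation of the Stein factorization -/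

lemma IsRegularSection.map_smul {S : Set (Line k)} {d : ℕ} {σ : (Fin 4 → k) → Line k → k}
    (hσ : IsRegularSection S d σ) {L : Line k} (hL : L ∈ S) {v : Fin 4 → k}
    (hv : v ∈ L.toSubmodule) (hv0 : v ≠ 0) {c : k} (hc : c ≠ 0) :
    σ (c • v) L = c ^ d * σ v L := by
  obtain ⟨a, b, f, g, hf, hg, hg0, H⟩ := hσ L hL v hv hv0
  obtain ⟨p, hp⟩ := L.exists_isPluckerVector
  have h0 := hg0 p hp
  have e₁ := H L hL v hv hv0 p hp h0
  have eg := hg.eval_smul c 1 v p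
  have ef := hf.eval_smul c 1 v p
  rw [one_pow, mul_one, one_smul] at eg ef
  have e₂ := H L hL (c • v) (Submodule.smul_mem _ _ hv) (smul_ne_zero hc hv0) p hp
    (by rw [eg]; exact mul_ne_zero (pow_ne_zero _ hc) h0)
  rw [eg, ef] at e₂
  apply mul_right_cancel₀ (mul_ne_zero (pow_ne_zero a hc) h0)
  rw [e₂, pow_add]
  linear_combination -c ^ a * c ^ d * e₁

section model

variable {S : Set (Line k)} {h : Fin 6 → k} {b : Fin 6 → Fin 6 → k} [CharP k 2]

/-- A regular section is `A + B w` with polynomials `A, B`. At a base point this follows by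
specialization along a ray. -/
lemma IsModel.exists_eq_add_mul [IsAlgClosed k] (M : IsModel S h b) {d : ℕ}
    {σ : (Fin 4 → k) → Line k → k} (hσ : IsRegularSection S d σ) :
    ∃ A B : MvPolynomial (Fin 4) k, ∀ L ∈ S, ∀ v ∈ L.toSubmodule, v ≠ 0 →
      σ v L = MvPolynomial.eval v A + MvPolynomial.eval v B * sectionW h b v L := by
  obtain ⟨A, B, H⟩ := M.exists_eq_add_mul_of_not_isBasePoint hσ
  refine ⟨A, B, fun L hL v₀ hv₀ hv0 => ?_⟩
  obtain ⟨v₁, hv₁, hF⟩ := M.exists_F₂fun_ne_zero hL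
  obtain ⟨p, hp⟩ := L.exists_isPluckerVector
  obtain ⟨_, _, f, g, -, -, hg, hfg⟩ := hσ L hL v₀ hv₀ hv0
  obtain ⟨_, _, f', g', -, -, hg', hfg'⟩ := M.isRegularSection_sectionW L hL v₀ hv₀ hv0
  replace hg := hg p hp
  replace hg' := hg' p hp
  let y : (Fin 2 → k) → Fin 4 → k := fun s => s 0 • v₀ + s 1 • v₁
  have hy : ∀ s, y s ∈ L.toSubmodule := fun s =>
    Submodule.add_mem _ (Submodule.smul_mem _ _ hv₀) (Submodule.smul_mem _ _ hv₁)
  have hyP : ∀ i, IsPoly fun s => y s i := fun i =>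
    ((IsPoly.coord 0).mul (IsPoly.const (v₀ i))).add ((IsPoly.coord 1).mul (IsPoly.const (v₁ i)))
  have hyp : ∀ i, IsPoly fun s => (Sum.elim (y s) p : Fin 4 ⊕ Fin 6 → k) i := by
    rintro (i | i)
    · exact hyP i
    · exact IsPoly.const (p i)
  have y0 : y ![1, 0] = v₀ := by simp [y]
  have y1 : y ![0, 1] = v₁ := by simp [y]
  -- the identity `f g' = A g g' + B g f'` holds at general points of the ray, so it holds at `v₀`
  have key : MvPolynomial.eval (Sum.elim v₀ p) f * MvPolynomial.eval (Sum.elim v₀ p) g'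
      - MvPolynomial.eval v₀ A * MvPolynomial.eval (Sum.elim v₀ p) g
        * MvPolynomial.eval (Sum.elim v₀ p) g'
      - MvPolynomial.eval v₀ B * MvPolynomial.eval (Sum.elim v₀ p) g
        * MvPolynomial.eval (Sum.elim v₀ p) f' = 0 := by
    by_contra hne
    obtain ⟨s, ⟨⟨h1, h2⟩, h3⟩, h4⟩ : ∃ s, ((MvPolynomial.eval (Sum.elim (y s) p) g ≠ 0 ∧
        MvPolynomial.eval (Sum.elim (y s) p) g' ≠ 0) ∧ F₂fun h b (y s) ≠ 0) ∧
        MvPolynomial.eval (Sum.elim (y s) p) f * MvPolynomial.eval (Sum.elim (y s) p) g'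
        - MvPolynomial.eval (y s) A * MvPolynomial.eval (Sum.elim (y s) p) g
          * MvPolynomial.eval (Sum.elim (y s) p) g'
        - MvPolynomial.eval (y s) B * MvPolynomial.eval (Sum.elim (y s) p) g
          * MvPolynomial.eval (Sum.elim (y s) p) f' ≠ 0 := by
      have q := IsPoly.eval g hyp
      have q' := IsPoly.eval g' hyp
      have r := (isPoly_F₂fun h b).comp hyP
      obtain ⟨s, hs, h4⟩ := ((q.mul q').mul r).exists_ne_zero_and
        ((((IsPoly.eval f hyp).mul q').sub (((IsPoly.eval A hyP).mul q).mul q')).sub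
          (((IsPoly.eval B hyP).mul q).mul (IsPoly.eval f' hyp)))
        ((q.mul q').exists_ne_zero_and r ⟨![1, 0], by simpa only [y0] using mul_ne_zero hg hg'⟩
          ⟨![0, 1], by simpa only [y1] using hF⟩ |>.imp fun s hs => mul_ne_zero hs.1 hs.2)
        ⟨![1, 0], by simpa only [y0] using hne⟩
      obtain ⟨h12, h3⟩ := mul_ne_zero_iff.1 hs
      exact ⟨s, ⟨mul_ne_zero_iff.1 h12, h3⟩, h4⟩
    have hb := not_isBasePoint M.pf_ne h3
    have hs0 : y s ≠ 0 := fun h0 => hb (h0 ▸ isBasePoint_zero h b)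
    have e₁ := hfg L hL _ (hy s) hs0 p hp h1
    have e₂ := hfg' L hL _ (hy s) hs0 p hp h2
    have e₃ := H L hL _ (hy s) hb
    apply h4
    rw [← e₁, ← e₂, e₃]
    ring
  have e₁ := hfg L hL v₀ hv₀ hv0 p hp hg
  have e₂ := hfg' L hL v₀ hv₀ hv0 p hp hg'
  apply mul_right_cancel₀ (mul_ne_zero hg hg')
  linear_combination MvPolynomial.eval (Sum.elim v₀ p) g' * e₁
    - MvPolynomial.eval v₀ B * MvPolynomial.eval (Sum.elim v₀ p) g * e₂ + key

/-- The polynomials `A` and `B` are homogeneous, of degrees differing by two. -/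
lemma IsModel.isHomogeneous_add_mul [IsAlgClosed k] (M : IsModel S h b) {d : ℕ}
    {σ : (Fin 4 → k) → Line k → k} (hσ : IsRegularSection S d σ) {A B : MvPolynomial (Fin 4) k}
    (H : ∀ L ∈ S, ∀ v ∈ L.toSubmodule, v ≠ 0 →
      σ v L = MvPolynomial.eval v A + MvPolynomial.eval v B * sectionW h b v L) :
    A.IsHomogeneous d ∧ (B = 0 ∨ ∃ e, e + 2 = d ∧ B.IsHomogeneous e) := by
  have hsc : ∀ c : k, c ≠ 0 → ∀ x, MvPolynomial.eval (c • x) A = c ^ d * MvPolynomial.eval x A ∧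
      c ^ 2 * MvPolynomial.eval (c • x) B = c ^ d * MvPolynomial.eval x B := by
    intro c hc
    have hX : ∀ i, IsPoly fun x : Fin 4 → k => (c • x) i := fun i =>
      (IsPoly.const c).mul (IsPoly.coord i)
    obtain ⟨A', hA'⟩ := (IsPoly.eval A hX).sub ((IsPoly.const (c ^ d)).mul
      (IsPoly.eval A IsPoly.coord))
    obtain ⟨B', hB'⟩ := ((IsPoly.const (c ^ 2)).mul (IsPoly.eval B hX)).sub
      ((IsPoly.const (c ^ d)).mul (IsPoly.eval B IsPoly.coord))
    obtain ⟨rfl, rfl⟩ := M.eq_zero_of_add_mul_sectionW (A := A') (B := B')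
      fun L hL v hv hv0 => by
        have e₁ := hσ.map_smul hL hv hv0 hc
        have e₂ := M.isRegularSection_sectionW.map_smul hL hv hv0 hc
        rw [H L hL v hv hv0, H L hL _ (Submodule.smul_mem _ _ hv) (smul_ne_zero hc hv0), e₂] at e₁
        rw [hA', hB']
        linear_combination e₁
    exact fun x => ⟨by simpa using (hA' x).symm.trans (map_zero _) |> sub_eq_zero.1,
      by simpa using (hB' x).symm.trans (map_zero _) |> sub_eq_zero.1⟩
  have e1 : ∀ (c : k) (x : Fin 4 → k), (fun i => c ^ (1 : Fin 4 → ℕ) i * x i) = c • x := by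
    intro c x; ext i; simp
  constructor
  · intro m hm
    simpa using weight_add_eq_of_eval 1 0 d
      (fun c x hc => by rw [e1, pow_zero, one_mul, (hsc c hc x).1]) hm
  · by_cases hB : B = 0
    · exact Or.inl hB
    have key : ∀ m, B.coeff m ≠ 0 → Finsupp.weight 1 m + 2 = d := fun m hm =>
      weight_add_eq_of_eval 1 2 d (fun c x hc => by rw [e1, (hsc c hc x).2]) hm
    obtain ⟨m, hm⟩ := MvPolynomial.ne_zero_iff.1 hB
    refine Or.inr ⟨_, key m hm, fun m' hm' => ?_⟩
    have := key m hm
    have := key m' hm'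
    omega

/-- The equation of `sectionW` is the equation of the Stein factorization. -/
theorem IsModel.exists_isSteinEquation [IsAlgClosed k] (M : IsModel S h b) :
    ∃ F₂ F₄ : MvPolynomial (Fin 4) k, (∀ v, MvPolynomial.eval v F₂ = F₂fun h b v) ∧
      IsSteinEquation S F₂ F₄ := by
  obtain ⟨F₂, h₂⟩ := isPoly_F₂fun h b
  obtain ⟨F₄, h₄⟩ := isPoly_F₄fun h b
  refine ⟨F₂, F₄, h₂, isHomogeneous_of_eval _ _ fun c x => by rw [h₂, h₂, F₂fun_smul],
    isHomogeneous_of_eval _ _ fun c x => by rw [h₄, h₄, F₄fun_smul], sectionW h b,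
    M.isRegularSection_sectionW, fun L hL v hv hv0 => ?_, fun d σ hσ => ?_⟩
  · rw [h₂, h₄]
    exact M.sectionW_quadratic hL hv hv0
  · obtain ⟨A, B, H⟩ := M.exists_eq_add_mul hσ
    obtain ⟨hA, hB⟩ := M.isHomogeneous_add_mul hσ H
    refine ⟨(A, B), ⟨hA, hB, H⟩, ?_⟩
    rintro ⟨A', B'⟩ ⟨-, -, H'⟩
    obtain ⟨h1, h2⟩ := M.eq_zero_of_add_mul_sectionW (A := A' - A) (B := B' - B)
      fun L hL v hv hv0 => by
        have e := H L hL v hv hv0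
        have e' := H' L hL v hv hv0
        simp only [map_sub]
        linear_combination e - e'
    rw [sub_eq_zero.1 h1, sub_eq_zero.1 h2]

/-- If `F₂` vanished at a point, the double cover would be ramified there: the equation
`x₄² + F₄ = 0` has a single root in characteristic two. But the two rays through a general point of
a given ray are distinguished by a section of degree two. -/
theorem IsModel.not_forall_eval_eq_zero [IsAlgClosed k] (M : IsModel S h b)
    {F₂ F₄ : MvPolynomial (Fin 4) k} (hF : IsSteinEquation S F₂ F₄) {L : Line k} (hL : L ∈ S) :
    ¬ ∀ v ∈ L.toSubmodule, MvPolynomial.eval v F₂ = 0 := by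
  intro H0
  obtain ⟨-, -, w, -, hq, huniv⟩ := hF
  obtain ⟨⟨A, B⟩, ⟨-, -, H⟩, -⟩ := huniv 2 _ M.isRegularSection_sectionW
  -- `w` separates the two rays through a general point since the section `sectionW` does
  obtain ⟨v, hv, hv2⟩ := M.exists_F₂fun_ne_zero hL
  have hv0 : v ≠ 0 := by
    rintro rfl
    exact not_isBasePoint M.pf_ne hv2 (isBasePoint_zero h b)
  obtain ⟨L₁, hL₁, L₂, hL₂, h₁, h₂, e⟩ := M.exists_two_rays hv2
  have a₁ := H L₁ hL₁ v h₁ hv0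
  have a₂ := H L₂ hL₂ v h₂ hv0
  have hne : w v L₁ ≠ w v L₂ := by
    intro hww
    rw [e, a₁, hww] at a₂
    exact hv2 (by linear_combination a₂)
  have q₁ := hq L₁ hL₁ v h₁ hv0
  have q₂ := hq L₂ hL₂ v h₂ hv0
  rw [H0 v hv] at q₁ q₂
  apply hne
  have : (w v L₁ - w v L₂) ^ 2 = 0 := by
    linear_combination q₁ - q₂
      + (w v L₂ ^ 2 - w v L₁ * w v L₂) * (CharTwo.two_eq_zero : (2 : k) = 0)
  exact sub_eq_zero.1 (pow_eq_zero_iff two_ne_zero |>.1 this)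

end model

/-! ### Rays split -/

lemma Flag.vanishes_iff_rep {z : Flag k} {p : Fin 6 → k} (hp : z.line.IsPluckerVector p)
    {f : MvPolynomial (Fin 4 ⊕ Fin 6) k} {a b : ℕ} (hf : IsBihomogeneous f a b) :
    z.Vanishes f ↔ MvPolynomial.eval (Sum.elim z.pt.rep p) f = 0 := by
  refine ⟨fun H => H p hp, fun H p' hp' => ?_⟩
  obtain ⟨c, -, rfl⟩ := hp.exists_smul hp'
  have := hf.eval_smul 1 c z.pt.rep p
  rw [one_smul] at this
  rw [this, H, mul_zero]

lemma Flag.isClosed_setOf [Infinite k] {φ : (Fin 4 → k) → (Fin 6 → k) → k}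
    (h : IsPoly fun x : Fin 4 ⊕ Fin 6 → k => φ (fun i => x (Sum.inl i)) fun i => x (Sum.inr i))
    {a b : ℕ} (h₁ : ∀ c v p, φ (c • v) p = c ^ a * φ v p)
    (h₂ : ∀ c v p, φ v (c • p) = c ^ b * φ v p) :
    IsClosed {z : Flag k | ∀ p, z.line.IsPluckerVector p → φ z.pt.rep p = 0} := by
  obtain ⟨f, hf, hfe⟩ := exists_isBihomogeneous h h₁ h₂
  simpa only [Flag.Vanishes, hfe] using Flag.isClosed_vanishes hf

lemma isClosed_pt_mem [Infinite k] (l : Line k) : IsClosed {z : Flag k | z.pt ∈ l.points} := by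
  obtain ⟨p, hp⟩ := l.exists_isPluckerVector
  have : {z : Flag k | z.pt ∈ l.points} = ⋂ i : Fin 4, {z : Flag k |
      ∀ p', z.line.IsPluckerVector p' → incidence z.pt.rep p i = 0} := by
    ext z
    simp only [Set.mem_ofPred_eq, Set.mem_iInter, mem_points_iff, mem_iff_incidence hp]
    obtain ⟨p', hp'⟩ := z.line.exists_isPluckerVector
    exact ⟨fun H i _ _ => by rw [H]; rfl, fun H => funext fun i => H i p' hp'⟩
  rw [this]
  refine isClosed_iInter fun i => Flag.isClosed_setOf (φ := fun v _ => incidence v p i)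
    (a := 1) (b := 0) (IsPoly.incidence (fun i => IsPoly.coord _) (fun i => IsPoly.const (p i)) i)
    (fun c v _ => ?_) (fun c v _ => by ring)
  fin_cases i <;> simp [incidence] <;> ring

lemma isClosed_pt_eq [Infinite k] (x : ℙ k (Fin 4 → k)) : IsClosed {z : Flag k | z.pt = x} := by
  have : {z : Flag k | z.pt = x} = ⋂ i : Fin 6, {z : Flag k |
      ∀ p', z.line.IsPluckerVector p' → plucker x.rep z.pt.rep i = 0} := by
    ext z
    simp only [Set.mem_ofPred_eq, Set.mem_iInter]
    obtain ⟨p', hp'⟩ := z.line.exists_isPluckerVector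
    refine ⟨fun H i _ _ => by rw [H, plucker_self]; rfl, fun H => ?_⟩
    obtain ⟨c, hc⟩ := exists_smul_of_plucker_eq_zero x.rep_nonzero (funext fun i => H i p' hp')
    rw [← z.pt.mk_rep, ← x.mk_rep, Projectivization.mk_eq_mk_iff']
    exact ⟨c, hc.symm⟩
  rw [this]
  refine isClosed_iInter fun i => Flag.isClosed_setOf (φ := fun v _ => plucker x.rep v i)
    (a := 1) (b := 0) (IsPoly.plucker (fun i => IsPoly.const (x.rep i)) (fun i => IsPoly.coord _) i)
    (fun c v _ => by rw [plucker_smul_right, pow_one]; rfl) (fun c v _ => by ring)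

lemma isClosed_line_eq [Infinite k] (l : Line k) : IsClosed {z : Flag k | z.line = l} := by
  obtain ⟨x, y, h0, rfl⟩ := l.exists_eq_lineOf
  have : {z : Flag k | z.line = lineOf x y h0} = (⋂ i : Fin 4, {z : Flag k |
      ∀ p, z.line.IsPluckerVector p → incidence x p i = 0}) ∩ ⋂ i : Fin 4, {z : Flag k |
      ∀ p, z.line.IsPluckerVector p → incidence y p i = 0} := by
    ext z
    simp only [Set.mem_ofPred_eq, Set.mem_iInter, Set.mem_inter_iff]
    obtain ⟨p, hp⟩ := z.line.exists_isPluckerVector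
    constructor
    · intro H
      have hx : x ∈ z.line.toSubmodule := H ▸ left_mem_lineOf
      have hy : y ∈ z.line.toSubmodule := H ▸ right_mem_lineOf
      exact ⟨fun i p hp => congrFun ((mem_iff_incidence hp x).1 hx) i,
        fun i p hp => congrFun ((mem_iff_incidence hp y).1 hy) i⟩
    · rintro ⟨H, H'⟩
      exact Line.eq_lineOf ((mem_iff_incidence hp x).2 (funext fun i => H i p hp))
        ((mem_iff_incidence hp y).2 (funext fun i => H' i p hp)) h0
  rw [this]
  refine (isClosed_iInter fun i => ?_).inter (isClosed_iInter fun i => ?_)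
  · exact Flag.isClosed_setOf (φ := fun _ p => incidence x p i) (a := 0) (b := 1)
      (IsPoly.incidence (fun i => IsPoly.const (x i)) (fun i => IsPoly.coord _) i)
      (fun c v _ => by ring) (fun c v _ => by rw [incidence_smul, pow_one]; rfl)
  · exact Flag.isClosed_setOf (φ := fun _ p => incidence y p i) (a := 0) (b := 1)
      (IsPoly.incidence (fun i => IsPoly.const (y i)) (fun i => IsPoly.coord _) i)
      (fun c v _ => by ring) (fun c v _ => by rw [incidence_smul, pow_one]; rfl)

lemma Line.pt_image_line_eq (l : Line k) : Flag.pt '' {z : Flag k | z.line = l} = l.points := by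
  ext x
  constructor
  · rintro ⟨z, rfl, rfl⟩
    exact z.mem
  · exact fun hx => ⟨⟨x, l, hx⟩, rfl, rfl⟩

/-- A set of flags is irreducible if it contains the general member of a family parametrized by an
affine space, and the equations of the family vanish on it. -/
lemma Flag.isPreirreducible_of_param [Infinite k] {σ : Type*} {T : Set (Flag k)}
    {y : (σ → k) → Fin 4 → k} {N : (σ → k) → Fin 6 → k} {δ : (σ → k) → k}
    (hy : ∀ i, IsPoly fun s => y s i) (hN : ∀ i, IsPoly fun s => N s i) (hδ : IsPoly δ)
    (hδ0 : ∃ s, δ s ≠ 0)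
    (h₁ : ∀ s, δ s ≠ 0 → ∃ z ∈ T, ∃ v hv hL, v = y s ∧ z = flagOf v z.line hv hL ∧
      z.line.IsPluckerVector (N s))
    (h₂ : ∀ z ∈ T, ∃ s, ∃ v hv hL, v = y s ∧ z = flagOf v z.line hv hL ∧
      z.line.IsPluckerVector (N s)) : IsPreirreducible T := by
  rw [Flag.isPreirreducible_iff]
  have hyN : ∀ i, IsPoly fun s => (Sum.elim (y s) (N s) : Fin 4 ⊕ Fin 6 → k) i := by
    rintro (i | i)
    · exact hy i
    · exact hN i
  rintro a b a' b' f g hf hg ⟨z, hz, hzf⟩ ⟨z', hz', hzg⟩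
  have key : ∀ {z : Flag k} {s : σ → k}, (∃ v hv hL, v = y s ∧ z = flagOf v z.line hv hL ∧
      z.line.IsPluckerVector (N s)) → ∀ {a b f}, IsBihomogeneous f a b →
      (z.Vanishes f ↔ MvPolynomial.eval (Sum.elim (y s) (N s)) f = 0) := by
    rintro z s ⟨v, hv, hL, rfl, e, hp⟩ a b f hf
    rw [e, flagOf_vanishes_iff hp hf]
  obtain ⟨s, hs⟩ := h₂ z hz
  obtain ⟨s', hs'⟩ := h₂ z' hz'
  rw [key hs hf] at hzf
  rw [key hs' hg] at hzg
  obtain ⟨t, ht, ht'⟩ := ((IsPoly.eval f hyN).mul (IsPoly.eval g hyN)).exists_ne_zero_and hδ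
    ((IsPoly.eval f hyN).exists_ne_zero_and (IsPoly.eval g hyN) ⟨s, hzf⟩ ⟨s', hzg⟩ |>.imp
      fun _ h => mul_ne_zero h.1 h.2) hδ0
  obtain ⟨z'', hz'', H⟩ := h₁ t ht'
  rw [mul_ne_zero_iff] at ht
  exact ⟨z'', hz'', by rw [key H hf]; exact ht.1, by rw [key H hg]; exact ht.2⟩

section model

variable {S : Set (Line k)} {h : Fin 6 → k} {b : Fin 6 → Fin 6 → k}

lemma IsModel.isClosed_universalFamily [Infinite k] (M : IsModel S h b) :
    IsClosed (universalFamily S) := by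
  have : universalFamily S = {z : Flag k | ∀ p, z.line.IsPluckerVector p → lin h p = 0} ∩
      {z : Flag k | ∀ p, z.line.IsPluckerVector p → bil b p p = 0} := by
    ext z
    simp only [universalFamily, Set.mem_ofPred_eq, Set.mem_inter_iff]
    obtain ⟨p, hp⟩ := z.line.exists_isPluckerVector
    exact ⟨fun H => ⟨fun p hp => ((M.mem_iff _ p hp).1 H).1,
      fun p hp => ((M.mem_iff _ p hp).1 H).2⟩,
      fun H => (M.mem_iff _ p hp).2 ⟨H.1 p hp, H.2 p hp⟩⟩
  rw [this]
  have hY : ∀ i, IsPoly fun x : Fin 4 ⊕ Fin 6 → k => x (Sum.inr i) := fun i => IsPoly.coord _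
  refine (Flag.isClosed_setOf (φ := fun _ p => lin h p) (a := 0) (b := 1) ?_
    (fun c v p => by ring) fun c v p => by rw [lin_smul, pow_one]).inter
    (Flag.isClosed_setOf (φ := fun _ p => bil b p p) (a := 0) (b := 2) (IsPoly.bil b hY hY)
    (fun c v p => by ring) fun c v p => by rw [bil_smul_left, bil_smul_right]; ring)
  exact IsPoly.sum _ fun i => (IsPoly.const (h i)).mul (hY i)

lemma IsModel.isClosed_preimageOfLine [Infinite k] (M : IsModel S h b) (l : Line k) :
    IsClosed (preimageOfLine S l) :=
  M.isClosed_universalFamily.inter (isClosed_pt_mem l)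

variable [CharP k 2]

/-- For `v` on the ray `⟨e₁, e₂⟩`, a vector which spans `v^⊥` together with the ray. -/
def perpVec (h : Fin 6 → k) (f₁ f₂ v : Fin 4 → k) : Fin 4 → k := om h v f₂ • f₁ + om h v f₁ • f₂

variable {e₁ e₂ f₁ f₂ : Fin 4 → k}

/-- A frame `u, perpVec v` of `v^⊥` modulo `v`, for `v` on the ray `⟨e₁, e₂⟩`. -/
lemma IsSymp.exists_frame (B : IsSymp h e₁ e₂ f₁ f₂) {v : Fin 4 → k}
    (hv : v ∈ (lineOf e₁ e₂ B.plucker_ne_zero).toSubmodule) (hv0 : v ≠ 0) :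
    ∃ u, plucker v u = plucker e₁ e₂ ∧ om h v u = 0 ∧ om h v (perpVec h f₁ f₂ v) = 0 ∧
      om h u (perpVec h f₁ f₂ v) = 1 := by
  have two : (2 : k) = 0 := CharTwo.two_eq_zero
  obtain ⟨u, h0, hL, hu⟩ :=
    Line.exists_plucker_eq hv hv0 (isPluckerVector_plucker B.plucker_ne_zero)
  have hu' : u ∈ (lineOf e₁ e₂ B.plucker_ne_zero).toSubmodule := hL ▸ right_mem_lineOf
  refine ⟨u, hu, ?_, ?_, ?_⟩
  · have : om h v u = om h e₁ e₂ := by simp only [om, hu]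
    rw [this, B.e₁e₂]
  all_goals
    obtain ⟨s, t, rfl⟩ := mem_lineOf.1 hv
    obtain ⟨x, y, rfl⟩ := mem_lineOf.1 hu'
    simp only [perpVec, om_add_left, om_add_right, om_smul_left, om_smul_right, B.e₁f₁, B.e₁f₂,
      B.e₂f₁, B.e₂f₂]
  · linear_combination s * t * two
  · simp only [plucker_add_left, plucker_add_right, plucker_smul_left, plucker_smul_right,
      plucker_self, plucker_swap e₂ e₁, smul_zero, zero_add, add_zero, ← add_smul, smul_smul] at hu
    have := smul_left_injective k B.plucker_ne_zero (hu.trans (one_smul k _).symm)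
    linear_combination this

/-- The Plücker vector of the second ray through a point of the ray `⟨e₁, e₂⟩`. -/
def secondRay (h : Fin 6 → k) (b : Fin 6 → Fin 6 → k) (e₁ e₂ f₁ f₂ v : Fin 4 → k) : Fin 6 → k :=
  bil b (plucker v (perpVec h f₁ f₂ v)) (plucker v (perpVec h f₁ f₂ v)) • plucker e₁ e₂
    + F₂fun h b v • plucker v (perpVec h f₁ f₂ v)

lemma IsModel.bil_frame (M : IsModel S h b) (B : IsSymp h e₁ e₂ f₁ f₂)
    (hS : lineOf e₁ e₂ B.plucker_ne_zero ∈ S) {v u : Fin 4 → k}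
    (hu : plucker v u = plucker e₁ e₂) (hvu : om h v u = 0)
    (hp : om h v (perpVec h f₁ f₂ v) = 0) (hup : om h u (perpVec h f₁ f₂ v) = 1) (x y : k) :
    bil b (plucker v (x • u + y • perpVec h f₁ f₂ v)) (plucker v (x • u + y • perpVec h f₁ f₂ v))
      = y * (x * F₂fun h b v
        + y * bil b (plucker v (perpVec h f₁ f₂ v)) (plucker v (perpVec h f₁ f₂ v))) := by
  rw [plucker_add_right, plucker_smul_right, plucker_smul_right,
    ← plucker_smul_right, ← plucker_smul_right, ← plucker_add_right,
    bil_self_smul_add_smul M.pf_ne b hvu hp, hup, hu, ((M.lineOf_mem_iff _).1 hS).2]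
  ring

lemma plucker_frame_ne_zero {v u g : Fin 4 → k} (hv0 : v ≠ 0) (hvu : om h v u = 0)
    (hvg : om h v g = 0) (hug : om h u g = 1) {x y : k} (hxy : x ≠ 0 ∨ y ≠ 0) :
    plucker v (x • u + y • g) ≠ 0 := by
  intro h0
  obtain ⟨c, hc⟩ := exists_smul_of_plucker_eq_zero hv0 h0
  have h1 := congrArg (om h · g) hc
  have h2 := congrArg (om h · u) hc
  simp only [om_add_left, om_smul_left, om_self, hug, hvg, hvu, om_comm h g u, mul_zero,
    add_zero, zero_add, mul_one] at h1 h2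
  exact hxy.elim (fun hx => hx h1) fun hy => hy h2

/-- The rays through a point of a given ray, when there is more than one: either the point is a base
point, or there is exactly one further ray. -/
lemma IsModel.second_ray (M : IsModel S h b) (B : IsSymp h e₁ e₂ f₁ f₂)
    (hS : lineOf e₁ e₂ B.plucker_ne_zero ∈ S) {v : Fin 4 → k}
    (hv : v ∈ (lineOf e₁ e₂ B.plucker_ne_zero).toSubmodule) (hv0 : v ≠ 0) {L : Line k} (hL : L ∈ S)
    (hvL : v ∈ L.toSubmodule) (hne : L ≠ lineOf e₁ e₂ B.plucker_ne_zero) :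
    IsBasePoint h b v ∨ F₂fun h b v ≠ 0 ∧ L.IsPluckerVector (secondRay h b e₁ e₂ f₁ f₂ v) := by
  have two : (2 : k) = 0 := CharTwo.two_eq_zero
  obtain ⟨u, hu, hvu, hvg, hug⟩ := B.exists_frame hv hv0
  have hbil := M.bil_frame B hS hu hvu hvg hug
  have hpu : plucker v u ≠ 0 := hu ▸ B.plucker_ne_zero
  have hexp : ∀ u', om h v u' = 0 → plucker v u' = plucker v (om h u' (perpVec h f₁ f₂ v) • u
      + om h u' u • perpVec h f₁ f₂ v) := fun u' hu' => by
    have := om_smul_plucker M.pf_ne hvu hvg hu' hpu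
    rwa [hug, one_smul, ← plucker_smul_right, ← plucker_smul_right, ← plucker_add_right] at this
  obtain ⟨u', hu0', rfl⟩ := L.exists_eq_lineOf_of_mem hvL hv0
  obtain ⟨hom, hq⟩ := (M.lineOf_mem_iff hu0').1 hL
  have he := hexp u' hom
  rw [he, hbil] at hq
  have hy : om h u' u ≠ 0 := by
    intro hy
    rw [hy, zero_smul, add_zero, plucker_smul_right, hu] at he
    apply hne
    refine Line.eq_of_isPluckerVector (isPluckerVector_plucker hu0') ?_
    rw [he]
    refine (isPluckerVector_plucker B.plucker_ne_zero).smul ?_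
    rintro hx
    rw [hx, zero_smul] at he
    exact hu0' he
  have hq' := (mul_eq_zero.1 hq).resolve_left hy
  by_cases hF : F₂fun h b v = 0
  · left
    intro u'' hu''
    rw [hF, mul_zero, zero_add] at hq'
    rw [hexp u'' hu'', hbil, hF, (mul_eq_zero.1 hq').resolve_left hy]
    ring
  · refine Or.inr ⟨hF, ?_⟩
    refine isPluckerVector_lineOf.2 ⟨F₂fun h b v / om h u' u, div_ne_zero hF hy, ?_⟩
    rw [div_eq_mul_inv, mul_comm, mul_smul, eq_comm, inv_smul_eq_iff₀ hy, he, secondRay,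
      plucker_add_right, plucker_smul_right, plucker_smul_right, hu]
    ext i
    simp only [Pi.add_apply, Pi.smul_apply, smul_eq_mul]
    linear_combination plucker e₁ e₂ i * hq' - plucker e₁ e₂ i * om h u' u *
      bil b (plucker v (perpVec h f₁ f₂ v)) (plucker v (perpVec h f₁ f₂ v)) * two

/-- Limits of second rays are rays. -/
lemma IsModel.exists_ray_of_ratio (M : IsModel S h b) (B : IsSymp h e₁ e₂ f₁ f₂)
    (hS : lineOf e₁ e₂ B.plucker_ne_zero ∈ S) {v : Fin 4 → k}
    (hv : v ∈ (lineOf e₁ e₂ B.plucker_ne_zero).toSubmodule) (hv0 : v ≠ 0) {x y : k}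
    (hxy : x ≠ 0 ∨ y ≠ 0) (hq : x * F₂fun h b v
      + y * bil b (plucker v (perpVec h f₁ f₂ v)) (plucker v (perpVec h f₁ f₂ v)) = 0) :
    ∃ L ∈ S, v ∈ L.toSubmodule ∧
      L.IsPluckerVector (x • plucker e₁ e₂ + y • plucker v (perpVec h f₁ f₂ v)) := by
  obtain ⟨u, hu, hvu, hvg, hug⟩ := B.exists_frame hv hv0
  have h0 := plucker_frame_ne_zero hv0 hvu hvg hug hxy
  refine ⟨lineOf v _ h0, (M.lineOf_mem_iff h0).2 ⟨?_, ?_⟩, left_mem_lineOf, ?_⟩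
  · rw [om_add_right, om_smul_right, om_smul_right, hvu, hvg]; ring
  · rw [M.bil_frame B hS hu hvu hvg hug, hq, mul_zero]
  · have := isPluckerVector_plucker h0
    rwa [plucker_add_right, plucker_smul_right, plucker_smul_right, hu] at this

end model

/-- The restriction of a form to an affine line. -/
lemma IsPoly.exists_polynomial_natDegree_le [Infinite k] {φ : (Fin 4 → k) → k} (hφ : IsPoly φ)
    {n : ℕ} (hs : ∀ c v, φ (c • v) = c ^ n * φ v) (x y : Fin 4 → k) :
    ∃ P : Polynomial k, P.natDegree ≤ n ∧ ∀ s, P.eval s = φ (x + s • y) := by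
  obtain ⟨f, hf⟩ := hφ
  have hfn : f.IsHomogeneous n := isHomogeneous_of_eval n f fun c v => by rw [hf, hf, hs]
  refine ⟨MvPolynomial.aeval (fun i => Polynomial.C (x i) + Polynomial.X * Polynomial.C (y i)) f,
    ?_, fun s => ?_⟩
  · refine (MvPolynomial.aeval_natDegree_le f (m := n) hfn.totalDegree_le _ (n := 1)
      fun i => ?_).trans (mul_one n).le
    compute_degree
  rw [polynomial_eval_aeval, ← hf]
  congr 2
  ext i
  simp only [Polynomial.eval_add, Polynomial.eval_mul, Polynomial.eval_C, Polynomial.eval_X,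
    Pi.add_apply, Pi.smul_apply, smul_eq_mul]

section model

variable {S : Set (Line k)} {h : Fin 6 → k} {b : Fin 6 → Fin 6 → k}
  {e₁ e₂ f₁ f₂ : Fin 4 → k}

/-- The flags over general points of the ray `l` whose line is the second ray through the point. -/
def secondFlags (S : Set (Line k)) (h : Fin 6 → k) (b : Fin 6 → Fin 6 → k) (l : Line k) :
    Set (Flag k) :=
  {z | z ∈ preimageOfLine S l ∧ F₂fun h b z.pt.rep ≠ 0 ∧ z.line ≠ l}

lemma IsPoly.perpVec {σ : Type*} (h : Fin 6 → k) (f₁ f₂ : Fin 4 → k) {y : (σ → k) → Fin 4 → k}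
    (hy : ∀ i, IsPoly fun s => y s i) (i : Fin 4) :
    IsPoly fun s => LineCongruence.perpVec h f₁ f₂ (y s) i :=
  ((IsPoly.om h hy (g := fun _ => f₂) fun j => IsPoly.const (f₂ j)).mul (IsPoly.const (f₁ i))).add
    ((IsPoly.om h hy (g := fun _ => f₁) fun j => IsPoly.const (f₁ j)).mul (IsPoly.const (f₂ i)))

lemma perpVec_smul (h : Fin 6 → k) (f₁ f₂ : Fin 4 → k) (c : k) (v : Fin 4 → k) :
    perpVec h f₁ f₂ (c • v) = c • perpVec h f₁ f₂ v := by
  simp only [perpVec, om_smul_left]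
  module

/-- `b(c, c)` for the Plücker vector `c = v ∧ perpVec v`. -/
def perpQuad (h : Fin 6 → k) (b : Fin 6 → Fin 6 → k) (f₁ f₂ v : Fin 4 → k) : k :=
  bil b (plucker v (perpVec h f₁ f₂ v)) (plucker v (perpVec h f₁ f₂ v))

lemma IsPoly.perpQuad {σ : Type*} (h : Fin 6 → k) (b : Fin 6 → Fin 6 → k) (f₁ f₂ : Fin 4 → k)
    {y : (σ → k) → Fin 4 → k} (hy : ∀ i, IsPoly fun s => y s i) :
    IsPoly fun s => LineCongruence.perpQuad h b f₁ f₂ (y s) :=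
  IsPoly.bil b (IsPoly.plucker hy (IsPoly.perpVec h f₁ f₂ hy))
    (IsPoly.plucker hy (IsPoly.perpVec h f₁ f₂ hy))

lemma perpQuad_smul (h : Fin 6 → k) (b : Fin 6 → Fin 6 → k) (f₁ f₂ : Fin 4 → k) (c : k)
    (v : Fin 4 → k) : perpQuad h b f₁ f₂ (c • v) = c ^ 4 * perpQuad h b f₁ f₂ v := by
  simp only [perpQuad, perpVec_smul, plucker_smul_left, plucker_smul_right, bil_smul_left,
    bil_smul_right]
  ring

lemma IsPoly.secondRay {σ : Type*} (h : Fin 6 → k) (b : Fin 6 → Fin 6 → k) (e₁ e₂ f₁ f₂ : Fin 4 → k)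
    {y : (σ → k) → Fin 4 → k} (hy : ∀ i, IsPoly fun s => y s i) (i : Fin 6) :
    IsPoly fun s => LineCongruence.secondRay h b e₁ e₂ f₁ f₂ (y s) i :=
  ((IsPoly.perpQuad h b f₁ f₂ hy).mul (IsPoly.const (LineCongruence.plucker e₁ e₂ i))).add
    (((isPoly_F₂fun h b).comp hy).mul (IsPoly.plucker hy (IsPoly.perpVec h f₁ f₂ hy) i))

lemma F₂fun_rep_mk_ne_zero {v : Fin 4 → k} (hv : v ≠ 0) :
    F₂fun h b (Projectivization.mk k v hv).rep ≠ 0 ↔ F₂fun h b v ≠ 0 := by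
  obtain ⟨c, hc⟩ := Projectivization.exists_smul_eq_mk_rep k v hv
  rw [← hc, Units.smul_def, F₂fun_smul]
  simp

variable [CharP k 2]

/-- Coordinates of a Plücker vector in the basis given by a symplectic basis of `k⁴`. -/
lemma IsSymp.klein_secondRay (B : IsSymp h e₁ e₂ f₁ f₂) (v : Fin 4 → k) :
    pf h * klein (secondRay h b e₁ e₂ f₁ f₂ v) (plucker f₁ f₂) = perpQuad h b f₁ f₂ v ∧
    (v ∈ (lineOf e₁ e₂ B.plucker_ne_zero).toSubmodule →
      pf h * klein (secondRay h b e₁ e₂ f₁ f₂ v) (plucker e₂ f₁)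
        = F₂fun h b v * om h v f₁ ^ 2) := by
  have two : (2 : k) = 0 := CharTwo.two_eq_zero
  constructor
  · rw [secondRay, klein_add_left, klein_smul_left, klein_smul_left, mul_add, mul_left_comm,
      B.pf_mul_klein, mul_left_comm, LineCongruence.pf_mul_klein, perpVec, perpQuad, perpVec]
    simp only [om_add_left, om_add_right, om_smul_left, om_smul_right, B.f₁f₂, om_comm h f₂ f₁,
      om_self]
    ring
  · intro hv
    obtain ⟨s, t, rfl⟩ := mem_lineOf.1 hv
    rw [secondRay, klein_add_left, klein_smul_left, klein_smul_left, mul_add, mul_left_comm,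
      LineCongruence.pf_mul_klein, mul_left_comm, LineCongruence.pf_mul_klein, perpVec]
    simp only [om_add_left, om_add_right, om_smul_left, om_smul_right, B.e₁f₁, B.e₁f₂,
      B.e₂f₁, B.e₂f₂, B.e₁e₂, B.f₁f₂, om_comm h f₁ e₂, om_comm h f₂ e₂, om_comm h f₂ f₁, om_self]
    ring_nf

lemma IsModel.secondRay_isPlucker (M : IsModel S h b) (B : IsSymp h e₁ e₂ f₁ f₂)
    (hS : lineOf e₁ e₂ B.plucker_ne_zero ∈ S) {v : Fin 4 → k}
    (hv : v ∈ (lineOf e₁ e₂ B.plucker_ne_zero).toSubmodule) (hF : F₂fun h b v ≠ 0) :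
    ∃ L ∈ S, v ∈ L.toSubmodule ∧ L ≠ lineOf e₁ e₂ B.plucker_ne_zero ∧
      L.IsPluckerVector (secondRay h b e₁ e₂ f₁ f₂ v) := by
  have two : (2 : k) = 0 := CharTwo.two_eq_zero
  have hv0 : v ≠ 0 := by rintro rfl; exact hF (F₂fun_zero h b)
  obtain ⟨L, hL, hvL, hp⟩ := M.exists_ray_of_ratio B hS hv hv0
    (x := perpQuad h b f₁ f₂ v) (Or.inr hF) (by
      rw [perpQuad]
      linear_combination F₂fun h b v * bil b (plucker v (perpVec h f₁ f₂ v))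
        (plucker v (perpVec h f₁ f₂ v)) * two)
  refine ⟨L, hL, hvL, ?_, hp⟩
  rintro rfl
  obtain ⟨u, hu, hvu, hvg, hug⟩ := B.exists_frame hv hv0
  obtain ⟨c, hc, e⟩ := isPluckerVector_lineOf.1 hp
  have h0 := plucker_frame_ne_zero hv0 hvu hvg hug
    (x := perpQuad h b f₁ f₂ v - c) (Or.inr hF)
  apply h0
  rw [plucker_add_right, plucker_smul_right, plucker_smul_right, hu, sub_smul, ← e]
  abel

lemma IsModel.isIrreducible_line_eq [Infinite k] (M : IsModel S h b) {l : Line k} (hl : l ∈ S) :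
    IsIrreducible {z : Flag k | z.line = l} := by
  obtain ⟨v₁, hv₁, hF⟩ := M.exists_F₂fun_ne_zero hl
  obtain ⟨x, y, h0, rfl⟩ := l.exists_eq_lineOf
  have hyP : ∀ i, IsPoly fun s : Fin 2 → k => (s 0 • x + s 1 • y) i := fun i =>
    ((IsPoly.coord 0).mul (IsPoly.const (x i))).add ((IsPoly.coord 1).mul (IsPoly.const (y i)))
  have hmem : ∀ s : Fin 2 → k, s 0 • x + s 1 • y ∈ (lineOf x y h0).toSubmodule := fun s =>
    mem_lineOf.2 ⟨_, _, rfl⟩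
  refine ⟨⟨flagOf x (lineOf x y h0) (ne_zero_left_of_plucker h0) left_mem_lineOf, rfl⟩,
    Flag.isPreirreducible_of_param hyP (fun i => IsPoly.const (plucker x y i))
      ((isPoly_F₂fun h b).comp hyP) ?_ (fun s hs => ?_) fun z hz => ?_⟩
  · obtain ⟨s, t, rfl⟩ := mem_lineOf.1 hv₁
    exact ⟨![s, t], by simpa using hF⟩
  · have hv0 : s 0 • x + s 1 • y ≠ 0 := fun h1 => hs (by simp only [h1, F₂fun_zero])
    exact ⟨flagOf _ _ hv0 (hmem s), rfl, _, hv0, hmem s, rfl, rfl, isPluckerVector_plucker h0⟩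
  · obtain ⟨v, hv, hL, hz'⟩ := z.exists_eq_flagOf
    have hz'' : z.line = lineOf x y h0 := hz
    obtain ⟨s, t, e⟩ := mem_lineOf.1 (hz'' ▸ hL)
    exact ⟨![s, t], v, hv, hL, by simpa using e.symm, hz', hz'' ▸ isPluckerVector_plucker h0⟩

lemma IsModel.secondFlags_spec (M : IsModel S h b) (B : IsSymp h e₁ e₂ f₁ f₂)
    (hS : lineOf e₁ e₂ B.plucker_ne_zero ∈ S) {z : Flag k}
    (hz : z ∈ secondFlags S h b (lineOf e₁ e₂ B.plucker_ne_zero)) :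
    z.line.IsPluckerVector (secondRay h b e₁ e₂ f₁ f₂ z.pt.rep) :=
  ((M.second_ray B hS (mem_points_iff.1 hz.1.2) z.pt.rep_nonzero hz.1.1 z.rep_mem
    hz.2.2).resolve_left (not_isBasePoint M.pf_ne hz.2.1)).2

lemma IsModel.exists_mem_secondFlags (M : IsModel S h b) (B : IsSymp h e₁ e₂ f₁ f₂)
    (hS : lineOf e₁ e₂ B.plucker_ne_zero ∈ S) {v : Fin 4 → k}
    (hv : v ∈ (lineOf e₁ e₂ B.plucker_ne_zero).toSubmodule) (hF : F₂fun h b v ≠ 0) :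
    ∃ L hv0 hL, flagOf v L hv0 hL ∈ secondFlags S h b (lineOf e₁ e₂ B.plucker_ne_zero) ∧
      L.IsPluckerVector (secondRay h b e₁ e₂ f₁ f₂ v) := by
  have hv0 : v ≠ 0 := by rintro rfl; exact hF (F₂fun_zero h b)
  obtain ⟨L, hL, hvL, hne, hp⟩ := M.secondRay_isPlucker B hS hv hF
  exact ⟨L, hv0, hvL, ⟨⟨hL, (mk_mem_points_iff hv0).2 hv⟩, (F₂fun_rep_mk_ne_zero hv0).2 hF, hne⟩,
    hp⟩

lemma IsModel.isIrreducible_secondFlags [Infinite k] (M : IsModel S h b) {l : Line k}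
    (hl : l ∈ S) : IsIrreducible (secondFlags S h b l) := by
  obtain ⟨v₁, hv₁, hF⟩ := M.exists_F₂fun_ne_zero hl
  obtain ⟨e₁, e₂, h0, rfl⟩ := l.exists_eq_lineOf
  obtain ⟨hom, hq⟩ := (M.lineOf_mem_iff h0).1 hl
  obtain ⟨f₁, f₂, B⟩ := exists_isSymp_of_isotropic M.pf_ne h0 hom
  have hyP : ∀ i, IsPoly fun s : Fin 2 → k => (s 0 • e₁ + s 1 • e₂) i := fun i =>
    ((IsPoly.coord 0).mul (IsPoly.const (e₁ i))).add ((IsPoly.coord 1).mul (IsPoly.const (e₂ i)))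
  have hmem : ∀ s : Fin 2 → k, s 0 • e₁ + s 1 • e₂ ∈ (lineOf e₁ e₂ h0).toSubmodule := fun s =>
    mem_lineOf.2 ⟨_, _, rfl⟩
  refine ⟨?_, Flag.isPreirreducible_of_param hyP (IsPoly.secondRay h b e₁ e₂ f₁ f₂ hyP)
      ((isPoly_F₂fun h b).comp hyP) ?_ (fun s hs => ?_) fun z hz => ?_⟩
  · obtain ⟨L, hv0, hL, H, -⟩ := M.exists_mem_secondFlags B hl hv₁ hF
    exact ⟨_, H⟩
  · obtain ⟨s, t, rfl⟩ := mem_lineOf.1 hv₁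
    exact ⟨![s, t], by simpa using hF⟩
  · obtain ⟨L, hv0, hL, H, hp⟩ := M.exists_mem_secondFlags B hl (hmem s) hs
    exact ⟨_, H, _, hv0, hL, rfl, rfl, hp⟩
  · obtain ⟨s, t, e⟩ := mem_lineOf.1 (mem_points_iff.1 hz.1.2)
    refine ⟨![s, t], z.pt.rep, z.pt.rep_nonzero, z.rep_mem, by simpa using e.symm, ?_, ?_⟩
    · rcases z with ⟨x, L, hx⟩
      simp [flagOf]
    · have := M.secondFlags_spec B hl hz
      simpa [e] using this

/-- Over every point of a ray there is a limit of second rays: a common zero of the two coefficients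
of the second ray can be cancelled along a curve. -/
lemma IsModel.exists_mem_closure_secondFlags [Infinite k] (M : IsModel S h b) {l : Line k}
    (hl : l ∈ S) {v₀ : Fin 4 → k} (hv₀ : v₀ ∈ l.toSubmodule) (hv0 : v₀ ≠ 0) :
    ∃ z ∈ closure (secondFlags S h b l), z.pt = Projectivization.mk k v₀ hv0 := by
  have two : (2 : k) = 0 := CharTwo.two_eq_zero
  obtain ⟨v₁, hv₁, hF⟩ := M.exists_F₂fun_ne_zero hl
  obtain ⟨e₁, e₂, h0, rfl⟩ := l.exists_eq_lineOf
  obtain ⟨hom, hq⟩ := (M.lineOf_mem_iff h0).1 hl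
  obtain ⟨f₁, f₂, B⟩ := exists_isSymp_of_isotropic M.pf_ne h0 hom
  let y : k → Fin 4 → k := fun s => v₀ + s • (v₁ - v₀)
  have hy : ∀ s, y s ∈ (lineOf e₁ e₂ h0).toSubmodule := fun s =>
    Submodule.add_mem _ hv₀ (Submodule.smul_mem _ _ (Submodule.sub_mem _ hv₁ hv₀))
  have y0 : y 0 = v₀ := by simp [y]
  have y1 : y 1 = v₁ := by simp [y]
  obtain ⟨P, -, hP⟩ := (isPoly_F₂fun h b).exists_polynomial_natDegree_le (F₂fun_smul h b) v₀
    (v₁ - v₀)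
  obtain ⟨Q, -, hQ⟩ := (IsPoly.perpQuad h b f₁ f₂ IsPoly.coord).exists_polynomial_natDegree_le
    (perpQuad_smul h b f₁ f₂) v₀ (v₁ - v₀)
  have hP' : ∀ s, P.eval s = F₂fun h b (y s) := hP
  have hQ' : ∀ s, Q.eval s = perpQuad h b f₁ f₂ (y s) := hQ
  have hP0 : P ≠ 0 := by
    rintro rfl
    apply hF
    rw [← y1, ← hP', Polynomial.eval_zero]
  obtain ⟨g, P', Q', hcop, rfl, rfl⟩ : ∃ g P' Q' : Polynomial k, IsCoprime P' Q' ∧ P = g * P' ∧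
      Q = g * Q' := by
    obtain ⟨P', Q', g, h1, h2, h3⟩ := UniqueFactorizationMonoid.exists_reduced_factors P hP0 Q
    exact ⟨g, P', Q', h1.isCoprime, h2.symm, h3.symm⟩
  have hg0 : g ≠ 0 := left_ne_zero_of_mul hP0
  have hPQ : Q'.eval 0 ≠ 0 ∨ P'.eval 0 ≠ 0 := by
    by_contra! H
    obtain ⟨u, v, huv⟩ := hcop
    have := congrArg (Polynomial.eval 0) huv
    rw [Polynomial.eval_add, Polynomial.eval_mul, Polynomial.eval_mul, H.1, H.2,
      Polynomial.eval_one] at this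
    simp at this
  have hrel : ∀ s, Q'.eval s * F₂fun h b (y s) + P'.eval s * perpQuad h b f₁ f₂ (y s) = 0 := by
    intro s
    rw [← hP', ← hQ', Polynomial.eval_mul, Polynomial.eval_mul]
    linear_combination Q'.eval s * P'.eval s * g.eval s * two
  let N : k → Fin 6 → k := fun s =>
    Q'.eval s • plucker e₁ e₂ + P'.eval s • plucker (y s) (perpVec h f₁ f₂ (y s))
  have hN : ∀ s, secondRay h b e₁ e₂ f₁ f₂ (y s) = g.eval s • N s := by
    intro s
    have e1 := hQ' s
    rw [perpQuad] at e1
    rw [secondRay, ← e1, ← hP']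
    simp only [N, Polynomial.eval_mul]
    module
  obtain ⟨L, hL, hvL, hpL⟩ := M.exists_ray_of_ratio B hl hv₀ hv0 hPQ (by
    have := hrel 0
    rwa [y0] at this)
  refine ⟨flagOf v₀ L hv0 hvL, ?_, rfl⟩
  rw [Flag.mem_closure_iff]
  intro m n f hf hfz
  have hN0 : N 0 = Q'.eval 0 • plucker e₁ e₂ + P'.eval 0 • plucker v₀ (perpVec h f₁ f₂ v₀) := by
    simp only [N, y0]
  rw [← hN0] at hpL
  rw [flagOf_vanishes_iff hpL hf] at hfz
  obtain ⟨R, hR⟩ : ∃ R : Polynomial k, ∀ s, R.eval s =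
      MvPolynomial.eval (Sum.elim (y s) (N s)) f := by
    have hc : ∀ j, ∃ T : Polynomial k, ∀ s, T.eval s =
        plucker (y s) (perpVec h f₁ f₂ (y s)) j := fun j =>
      ((IsPoly.plucker IsPoly.coord (IsPoly.perpVec h f₁ f₂ IsPoly.coord) j
        ).exists_polynomial_natDegree_le (n := 2) (fun c v => by
          simp only [perpVec_smul, plucker_smul_left, plucker_smul_right, Pi.smul_apply,
            smul_eq_mul]
          ring) v₀ (v₁ - v₀)).imp fun _ => And.right
    choose T hT using hc
    refine ⟨MvPolynomial.aeval (Sum.elim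
      (fun i => Polynomial.C (v₀ i) + Polynomial.X * Polynomial.C ((v₁ - v₀) i))
      fun j => Q' * Polynomial.C (plucker e₁ e₂ j) + P' * T j) f, fun s => ?_⟩
    rw [polynomial_eval_aeval]
    congr 2
    ext (i | i)
    · simp [y]
    · simp [N, hT]
  have hR0 : R ≠ 0 := by
    rintro rfl
    apply hfz
    have := hR 0
    rw [Polynomial.eval_zero, y0] at this
    exact this.symm
  obtain ⟨s, hs⟩ : ∃ s, (R * (g * P')).eval s ≠ 0 := by
    by_contra! H
    exact mul_ne_zero hR0 hP0 (Polynomial.funext fun s => by rw [H, Polynomial.eval_zero])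
  rw [Polynomial.eval_mul, hP', hR, mul_ne_zero_iff] at hs
  obtain ⟨L', hv0', hL', hmem, hp⟩ := M.exists_mem_secondFlags B hl (hy s) hs.2
  refine ⟨_, hmem, ?_⟩
  rw [flagOf_vanishes_iff hp hf, hN]
  have := hf.eval_smul 1 (g.eval s) (y s) (N s)
  rw [one_smul] at this
  rw [this, one_pow, one_mul]
  refine mul_ne_zero (pow_ne_zero _ fun h1 => hs.2 ?_) hs.1
  rw [← hP', Polynomial.eval_mul, h1, zero_mul]

/-- The two components of the preimage of a ray are distinguished by an equation satisfied by
the second rays. -/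
lemma IsModel.not_line_eq_subset [Infinite k] (M : IsModel S h b) {l : Line k} (hl : l ∈ S) :
    ¬ {z : Flag k | z.line = l} ⊆ closure (secondFlags S h b l) := by
  intro hsub
  obtain ⟨v₁, hv₁, hF⟩ := M.exists_F₂fun_ne_zero hl
  obtain ⟨e₁, e₂, h0, rfl⟩ := l.exists_eq_lineOf
  obtain ⟨hom, hq⟩ := (M.lineOf_mem_iff h0).1 hl
  obtain ⟨f₁, f₂, B⟩ := exists_isSymp_of_isotropic M.pf_ne h0 hom
  have hX : ∀ i, IsPoly fun x : Fin 4 ⊕ Fin 6 → k => x (Sum.inl i) := fun i => IsPoly.coord _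
  have hY : ∀ i, IsPoly fun x : Fin 4 ⊕ Fin 6 → k => x (Sum.inr i) := fun i => IsPoly.coord _
  have hyP : ∀ i, IsPoly fun s : Fin 2 → k => (s 0 • e₁ + s 1 • e₂) i := fun i =>
    ((IsPoly.coord 0).mul (IsPoly.const (e₁ i))).add ((IsPoly.coord 1).mul (IsPoly.const (e₂ i)))
  let φ : (Fin 4 → k) → (Fin 6 → k) → k := fun v p =>
    om h v f₁ ^ 2 * F₂fun h b v * (pf h * klein p (plucker f₁ f₂))
      - perpQuad h b f₁ f₂ v * (pf h * klein p (plucker e₂ f₁))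
  have hcl : IsClosed {z : Flag k | ∀ p, z.line.IsPluckerVector p → φ z.pt.rep p = 0} :=
    Flag.isClosed_setOf (a := 4) (b := 1)
      (((((IsPoly.om h hX fun i => IsPoly.const (f₁ i)).pow 2).mul ((isPoly_F₂fun h b).comp hX)).mul
        ((IsPoly.const _).mul (IsPoly.klein hY fun i => IsPoly.const (plucker f₁ f₂ i)))).sub
      ((IsPoly.perpQuad h b f₁ f₂ hX).mul
        ((IsPoly.const _).mul (IsPoly.klein hY fun i => IsPoly.const (plucker e₂ f₁ i)))))
      (fun c v p => by simp only [φ, om_smul_left, F₂fun_smul, perpQuad_smul]; ring)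
      (fun c v p => by simp only [φ, klein_smul_left]; ring)
  have hsec : secondFlags S h b (lineOf e₁ e₂ h0) ⊆
      {z : Flag k | ∀ p, z.line.IsPluckerVector p → φ z.pt.rep p = 0} := fun z hz p hp => by
    obtain ⟨c, -, rfl⟩ := (M.secondFlags_spec B hl hz).exists_smul hp
    obtain ⟨h1, h2⟩ := B.klein_secondRay (b := b) z.pt.rep
    have h2 := h2 (mem_points_iff.1 hz.1.2)
    simp only [φ, klein_smul_left]
    linear_combination c * om h z.pt.rep f₁ ^ 2 * F₂fun h b z.pt.rep * h1
      - c * perpQuad h b f₁ f₂ z.pt.rep * h2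
  have hsub' := hsub.trans (closure_minimal hsec hcl)
  obtain ⟨s, hs, hs'⟩ := (IsPoly.om h hyP fun i => IsPoly.const (f₁ i)).exists_ne_zero_and
    ((isPoly_F₂fun h b).comp hyP) ⟨![1, 0], by simp [B.e₁f₁]⟩ (by
      obtain ⟨s, t, rfl⟩ := mem_lineOf.1 hv₁
      exact ⟨![s, t], by simpa using hF⟩)
  have hv0 : s 0 • e₁ + s 1 • e₂ ≠ 0 := fun h1 => hs' (by simp only [h1, F₂fun_zero])
  have hmem : s 0 • e₁ + s 1 • e₂ ∈ (lineOf e₁ e₂ h0).toSubmodule :=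
    mem_lineOf.2 ⟨s 0, s 1, rfl⟩
  have := hsub' (show flagOf _ (lineOf e₁ e₂ h0) hv0 hmem ∈ _ from rfl) _
    (isPluckerVector_plucker h0)
  simp only [φ, B.pf_mul_klein, LineCongruence.pf_mul_klein, B.e₁e₂, B.e₁f₁, om_self] at this
  obtain ⟨c, hc⟩ := Projectivization.exists_smul_eq_mk_rep k _ hv0
  rw [show (flagOf _ (lineOf e₁ e₂ h0) hv0 hmem).pt.rep = _ from hc.symm] at this
  simp only [Units.smul_def, om_smul_left, F₂fun_smul] at this
  have hc0 := c.ne_zero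
  simp_all

/-- The preimage of a ray `l` consists of the flags on `l` itself, of the closure of the flags on
the second rays through the points of `l`, and of components over base points. -/
theorem IsModel.subset_splittingLocus [Infinite k] (M : IsModel S h b) : S ⊆ splittingLocus S := by
  intro l hl
  set C₁ : Set (Flag k) := {z | z.line = l}
  set C₂ : Set (Flag k) := closure (secondFlags S h b l)
  have hC₁ : C₁ ⊆ preimageOfLine S l := by
    intro z hz
    have hz' : z.line = l := hz
    exact ⟨by rwa [universalFamily, Set.mem_ofPred_eq, hz'], hz' ▸ z.mem⟩
  have hC₂ : C₂ ⊆ preimageOfLine S l :=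
    closure_minimal (fun z hz => hz.1) (M.isClosed_preimageOfLine l)
  have hi₁ : IsIrreducible C₁ := M.isIrreducible_line_eq hl
  have hi₂ : IsIrreducible C₂ := (M.isIrreducible_secondFlags hl).closure
  have him₁ : Flag.pt '' C₁ = l.points := l.pt_image_line_eq
  have him₂ : Flag.pt '' C₂ = l.points := by
    ext x
    constructor
    · rintro ⟨z, hz, rfl⟩
      exact (hC₂ hz).2
    · intro hx
      obtain ⟨z, hz, e⟩ := M.exists_mem_closure_secondFlags hl (mem_points_iff.1 hx) x.rep_nonzero
      exact ⟨z, hz, e.trans x.mk_rep⟩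
  have h₁₂ : ¬ C₁ ⊆ C₂ := M.not_line_eq_subset hl
  have h₂₁ : ¬ C₂ ⊆ C₁ := by
    intro H
    obtain ⟨z, hz⟩ := (M.isIrreducible_secondFlags hl).nonempty
    exact hz.2.2 (H (subset_closure hz))
  -- an irreducible set in the preimage lies over a base point or in one of the two families
  have key : ∀ T : Set (Flag k), IsIrreducible T → T ⊆ preimageOfLine S l →
      Flag.pt '' T = l.points → T ⊆ C₁ ∨ T ⊆ C₂ := by
    classical
    intro T hT hTs hTi
    obtain ⟨C, hC, hTC⟩ := isIrreducible_iff_sUnion_isClosed.1 hT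
      (insert C₁ (insert C₂ (M.finite_base.toFinset.image fun x => {z : Flag k | z.pt = x})))
      (by
        intro C hC
        simp only [Finset.mem_insert, Finset.mem_image] at hC
        rcases hC with rfl | rfl | ⟨x, -, rfl⟩
        · exact isClosed_line_eq l
        · exact isClosed_closure
        · exact isClosed_pt_eq x)
      (fun z hz => by
        by_cases hzl : z.line = l
        · exact ⟨C₁, by simp, hzl⟩
        have hz' := hTs hz
        obtain ⟨e₁, e₂, h0, rfl⟩ := l.exists_eq_lineOf
        obtain ⟨hom, hq⟩ := (M.lineOf_mem_iff h0).1 hl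
        obtain ⟨f₁, f₂, B⟩ := exists_isSymp_of_isotropic M.pf_ne h0 hom
        rcases M.second_ray B hl (mem_points_iff.1 hz'.2) z.pt.rep_nonzero hz'.1 z.rep_mem hzl with
          hb | ⟨hF, -⟩
        · exact ⟨{y | y.pt = z.pt}, by simpa using Or.inr (Or.inr ⟨z.pt, hb, rfl⟩), rfl⟩
        · exact ⟨C₂, by simp, subset_closure ⟨hz', hF, hzl⟩⟩)
    simp only [Finset.mem_insert, Finset.mem_image] at hC
    rcases hC with rfl | rfl | ⟨x, -, rfl⟩
    · exact Or.inl hTC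
    · exact Or.inr hTC
    · exfalso
      obtain ⟨u, v, h0, rfl⟩ := l.exists_eq_lineOf
      have h1 : ∀ w ∈ (lineOf u v h0).toSubmodule, ∀ hw : w ≠ 0,
          Projectivization.mk k w hw = x := by
        intro w hw hw0
        have := (mk_mem_points_iff hw0).2 hw
        rw [← hTi] at this
        obtain ⟨z, hz, e⟩ := this
        exact e.symm.trans (hTC hz)
      have h2 := (h1 u left_mem_lineOf (ne_zero_left_of_plucker h0)).trans
        (h1 v right_mem_lineOf (ne_zero_right_of_plucker h0)).symm
      rw [Projectivization.mk_eq_mk_iff'] at h2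
      obtain ⟨c, rfl⟩ := h2
      rw [plucker_smul_left, plucker_self, smul_zero] at h0
      exact h0 rfl
  have hset : {C | C ∈ componentsOf (preimageOfLine S l) ∧ Flag.pt '' C = l.points} = {C₁, C₂} := by
    ext C
    simp only [Set.mem_ofPred_eq, Set.mem_insert_iff, Set.mem_singleton_iff, componentsOf]
    constructor
    · rintro ⟨⟨⟨hCi, hCs⟩, hmax⟩, him⟩
      rcases key C hCi hCs him with H | H
      · exact Or.inl (H.antisymm (hmax ⟨hi₁, hC₁⟩ H))
      · exact Or.inr (H.antisymm (hmax ⟨hi₂, hC₂⟩ H))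
    · have hbig : ∀ {C T : Set (Flag k)}, Flag.pt '' C = l.points → T ⊆ preimageOfLine S l →
          C ⊆ T → Flag.pt '' T = l.points := fun {C T} hC hT hCT => by
        refine Set.Subset.antisymm ?_ (hC ▸ Set.image_mono hCT)
        rintro _ ⟨z, hz, rfl⟩
        exact (hT hz).2
      rintro (rfl | rfl)
      · refine ⟨⟨⟨hi₁, hC₁⟩, fun T hT hle => ?_⟩, him₁⟩
        exact (key T hT.1 hT.2 (hbig him₁ hT.2 hle)).resolve_right fun H => h₁₂ (hle.trans H)
      · refine ⟨⟨⟨hi₂, hC₂⟩, fun T hT hle => ?_⟩, him₂⟩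
        exact (key T hT.1 hT.2 (hbig him₂ hT.2 hle)).resolve_left fun H => h₂₁ (hle.trans H)
  rw [splittingLocus, Set.mem_ofPred_eq, Splits, hset]
  exact Set.encard_pair fun H => h₁₂ H.subset

end model

/-! ### Singular quadrics of the pencil defining the congruence -/

/-- Every subspace has a complement inside any larger subspace. -/
lemma exists_complement_in {V : Type*} [AddCommGroup V] [Module k V] [FiniteDimensional k V]
    {P E : Submodule k V} (hPE : P ≤ E) : ∃ C ≤ E, P ⊓ C = ⊥ ∧ P ⊔ C = E ∧
      Module.finrank k P + Module.finrank k C = Module.finrank k E := by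
  obtain ⟨C, hC⟩ := P.exists_isCompl
  have h1 : P ⊓ (C ⊓ E) = ⊥ := by rw [← inf_assoc, hC.inf_eq_bot, bot_inf_eq]
  have h2 : P ⊔ C ⊓ E = E := by rw [← sup_inf_assoc_of_le C hPE, hC.sup_eq_top, top_inf_eq]
  refine ⟨C ⊓ E, inf_le_right, h1, h2, ?_⟩
  have := Submodule.finrank_sup_add_finrank_inf_eq P (C ⊓ E)
  rwa [h1, h2, finrank_bot, add_zero, eq_comm] at this

lemma exists_notMem_span_singleton {V : Type*} [AddCommGroup V] [Module k V]
    [FiniteDimensional k V] (hV : 2 ≤ Module.finrank k V) :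
    ∃ x y : V, x ≠ 0 ∧ y ∉ Submodule.span k {x} := by
  have : Nontrivial V := Module.nontrivial_of_finrank_pos (R := k) (by omega)
  obtain ⟨x, hx⟩ := exists_ne (0 : V)
  refine ⟨x, ?_⟩
  by_contra! H
  have h1 : Submodule.span k {x} = ⊤ := Submodule.eq_top_iff'.2 fun y => H y hx
  have h2 := finrank_span_singleton (K := k) hx
  rw [h1, finrank_top] at h2
  omega

/-- The polar form of the quadratic form `b(x, x)`. -/
def polar (b : Fin 6 → Fin 6 → k) (x y : Fin 6 → k) : k := bil b x y + bil b y x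

section

variable (b : Fin 6 → Fin 6 → k) (c : k) (x y z : Fin 6 → k)

lemma polar_comm : polar b x y = polar b y x := add_comm _ _

lemma polar_self [CharP k 2] : polar b x x = 0 := CharTwo.add_self_eq_zero _

lemma polar_add_left : polar b (x + y) z = polar b x z + polar b y z := by
  simp only [polar, bil_add_left, bil_add_right]; ring

lemma polar_smul_left : polar b (c • x) y = c * polar b x y := by
  simp only [polar, bil_smul_left, bil_smul_right]; ring

lemma polar_add_right : polar b x (y + z) = polar b x y + polar b x z := by
  simp only [polar, bil_add_left, bil_add_right]; ring

lemma polar_smul_right : polar b x (c • y) = c * polar b x y := by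
  simp only [polar, bil_smul_left, bil_smul_right]; ring

lemma bil_add_self : bil b (x + y) (x + y) = bil b x x + bil b y y + polar b x y := by
  simp only [polar, bil_add_left, bil_add_right]; ring

lemma klein_self [CharP k 2] : klein x x = 0 := by
  have two : (2 : k) = 0 := CharTwo.two_eq_zero
  simp only [klein]
  linear_combination (x 0 * x 5 - x 1 * x 4 + x 2 * x 3) * two

end

/-- The point of `ℙ⁵` whose polar hyperplane with respect to the Klein quadric is `h = 0`. -/
def nucleus (h : Fin 6 → k) : Fin 6 → k := ![h 5, -h 4, h 3, h 2, -h 1, h 0]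

lemma klein_nucleus (h x : Fin 6 → k) : klein (nucleus h) x = lin h x := by
  simp [klein, nucleus, lin, Fin.sum_univ_six]; ring

lemma kleinQ_nucleus (h : Fin 6 → k) : kleinQ (nucleus h) = pf h := by
  simp [kleinQ, nucleus, pf]; ring

lemma nucleus_nucleus (x : Fin 6 → k) : nucleus (nucleus x) = x := by
  ext i; fin_cases i <;> simp [nucleus]

lemma nucleus_smul (c : k) (x : Fin 6 → k) : nucleus (c • x) = c • nucleus x := by
  ext i; fin_cases i <;> simp [nucleus]

/-- `lin` as a linear form in its second argument. -/
def linMap (h : Fin 6 → k) : (Fin 6 → k) →ₗ[k] k where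
  toFun := lin h
  map_add' := lin_add h
  map_smul' := lin_smul h

lemma ne_zero_of_pf {h : Fin 6 → k} (hpf : pf h ≠ 0) : h ≠ 0 := by
  rintro rfl
  simp [pf] at hpf

lemma exists_lin_ne_zero {h : Fin 6 → k} (hh : h ≠ 0) : ∃ x, lin h x ≠ 0 := by
  obtain ⟨i, hi⟩ := Function.ne_iff.1 hh
  exact ⟨Pi.single i 1, by simpa [lin, Pi.single_apply] using hi⟩

lemma finrank_ker_linMap {h : Fin 6 → k} (hh : h ≠ 0) :
    Module.finrank k (LinearMap.ker (linMap h)) = 5 := by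
  have h0 : linMap h ≠ 0 := fun h0 => by
    obtain ⟨x, hx⟩ := exists_lin_ne_zero hh
    exact hx (LinearMap.congr_fun h0 x)
  have := Module.Dual.finrank_ker_add_one_of_ne_zero h0
  rw [Module.finrank_pi, Fintype.card_fin] at this
  omega

lemma eq_of_klein_eq {x x' : Fin 6 → k} (H : ∀ y, klein x y = klein x' y) : x = x' := by
  rw [← nucleus_nucleus x, ← nucleus_nucleus x']
  congr 1
  ext i
  have := H (Pi.single i 1)
  rw [← nucleus_nucleus x, ← nucleus_nucleus x', klein_nucleus, klein_nucleus] at this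
  simpa [lin, Pi.single_apply] using this

/-- A vector orthogonal to the hyperplane `h = 0` is a multiple of the nucleus. -/
lemma exists_eq_smul_nucleus {h x : Fin 6 → k} (hh : h ≠ 0)
    (hx : ∀ y, lin h y = 0 → klein x y = 0) : ∃ c : k, x = c • nucleus h := by
  obtain ⟨z, hz⟩ := exists_lin_ne_zero hh
  refine ⟨klein x z / lin h z, ?_⟩
  have key : ∀ y, klein x y = klein ((klein x z / lin h z) • nucleus h) y := by
    intro y
    have h1 := hx (y + (-(lin h y / lin h z)) • z) (by
      rw [lin_add, lin_smul]; field_simp; ring)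
    rw [klein_add_right, klein_smul_right] at h1
    rw [klein_smul_left, klein_nucleus]
    linear_combination h1
  exact eq_of_klein_eq key

/-- A subspace of dimension at least two contains a zero of the Klein form. -/
lemma exists_kleinQ_eq_zero [IsAlgClosed k] {V : Type*} [AddCommGroup V] [Module k V]
    [FiniteDimensional k V] (hV : 2 ≤ Module.finrank k V) (φ : V →ₗ[k] (Fin 6 → k)) :
    ∃ x, x ≠ 0 ∧ kleinQ (φ x) = 0 := by
  obtain ⟨x, y, hx, hy⟩ := exists_notMem_span_singleton hV
  by_cases hq : kleinQ (φ x) = 0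
  · exact ⟨x, hx, hq⟩
  · obtain ⟨s, hs⟩ := exists_root_quadratic hq (klein (φ x) (φ y)) (kleinQ (φ y))
    refine ⟨s • x + y, fun h0 => hy ?_, ?_⟩
    · rw [eq_neg_of_add_eq_zero_right h0]
      exact Submodule.neg_mem _ (Submodule.smul_mem _ _ (Submodule.mem_span_singleton_self x))
    · rw [map_add, map_smul, kleinQ_add, kleinQ_smul, klein_smul_left]
      linear_combination hs

/-- The radical, on the hyperplane `h = 0`, of the polar form of the quadric `q - c Q`, where `Q` is
the Klein quadric. -/
def radical (h : Fin 6 → k) (b : Fin 6 → Fin 6 → k) (c : k) : Submodule k (Fin 6 → k) where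
  carrier := {x | lin h x = 0 ∧ ∀ y, lin h y = 0 → polar b x y = c * klein x y}
  zero_mem' := ⟨by rw [← zero_smul k (0 : Fin 6 → k), lin_smul, zero_mul], fun y _ => by
    rw [← zero_smul k (0 : Fin 6 → k), polar_smul_left, klein_smul_left]; ring⟩
  add_mem' := fun {x y} hx hy => ⟨by rw [lin_add, hx.1, hy.1, add_zero], fun z hz => by
    rw [polar_add_left, klein_add_left, hx.2 z hz, hy.2 z hz]; ring⟩
  smul_mem' := fun a x hx => ⟨by rw [lin_smul, hx.1, mul_zero], fun z hz => by
    rw [polar_smul_left, klein_smul_left, hx.2 z hz]; ring⟩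

section model

variable {S : Set (Line k)} {h : Fin 6 → k} {b : Fin 6 → Fin 6 → k} [CharP k 2]

/-- The polar form of `q - c Q` is alternating on the five-dimensional space `h = 0`, so that the
dimension of its radical is odd. -/
lemma finrank_radical_ne_two (hh : h ≠ 0) (c : k) : Module.finrank k (radical h b c) ≠ 2 := by
  intro h2
  have hle : radical h b c ≤ LinearMap.ker (linMap h) := fun x hx => hx.1
  obtain ⟨C, hCE, hinf, hsup, hfin⟩ := exists_complement_in hle
  rw [h2, finrank_ker_linMap hh] at hfin
  let e := Module.finBasisOfFinrankEq k C (n := 3) (by omega)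
  have two : (2 : k) = 0 := CharTwo.two_eq_zero
  let ω : (Fin 6 → k) → (Fin 6 → k) → k := fun x y => polar b x y + c * klein x y
  have ωadd : ∀ x y z, ω (x + y) z = ω x z + ω y z := fun x y z => by
    simp only [ω, polar_add_left, klein_add_left]; ring
  have ωsmul : ∀ a x z, ω (a • x) z = a * ω x z := fun a x z => by
    simp only [ω, polar_smul_left, klein_smul_left]; ring
  have ωadd' : ∀ x y z, ω z (x + y) = ω z x + ω z y := fun x y z => by
    simp only [ω, polar_add_right, klein_add_right]; ring
  have ωsmul' : ∀ a x z, ω z (a • x) = a * ω z x := fun a x z => by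
    simp only [ω, polar_smul_right, klein_smul_right]; ring
  have ωcomm : ∀ x y, ω x y = ω y x := fun x y => by
    simp only [ω, polar_comm b x y, klein_comm x y]
  have ωself : ∀ x, ω x x = 0 := fun x => by
    simp only [ω, polar_self, klein_self, mul_zero, add_zero]
  have ωrad : ∀ x ∈ radical h b c, ∀ y, lin h y = 0 → ω x y = 0 := fun x hx y hy => by
    simp only [ω, hx.2 y hy]
    linear_combination c * klein x y * two
  -- an element of `C` in the radical of the form on the three-dimensional space `C`
  obtain ⟨x, hx0, hxC⟩ : ∃ x : C, x ≠ 0 ∧ ∀ y : C, ω x y = 0 := by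
    suffices ∃ a : Fin 3 → k, a ≠ 0 ∧ ∀ i, ω (a 0 • e 0 + a 1 • e 1 + a 2 • e 2 : C) (e i) = 0 by
      obtain ⟨a, ha, H⟩ := this
      refine ⟨a 0 • e 0 + a 1 • e 1 + a 2 • e 2, fun h0 => ha ?_, fun y => ?_⟩
      · have := Fintype.linearIndependent_iff.1 e.linearIndependent a
          (by rw [Fin.sum_univ_three]; exact h0)
        exact funext this
      · rw [← e.sum_repr y, Fin.sum_univ_three]
        simp only [Submodule.coe_add, Submodule.coe_smul, ωadd', ωsmul'] at H ⊢
        rw [H 0, H 1, H 2]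
        ring
    by_cases h12 : ω (e 0) (e 1) = 0 ∧ ω (e 0) (e 2) = 0
    · refine ⟨![1, 0, 0], fun h0 => by simpa using congrFun h0 0, fun i => ?_⟩
      fin_cases i <;> simp [ωself, h12]
    · refine ⟨![ω (e 1) (e 2), ω (e 0) (e 2), ω (e 0) (e 1)], fun h0 => h12 ⟨?_, ?_⟩, fun i => ?_⟩
      · simpa using congrFun h0 2
      · simpa using congrFun h0 1
      · fin_cases i
        all_goals
          simp only [Fin.zero_eta, Fin.mk_one, Fin.reduceFinMk, Matrix.cons_val_zero,
            Matrix.cons_val_one, Matrix.cons_val, Submodule.coe_add, Submodule.coe_smul, ωadd,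
            ωsmul, ωself, ωcomm (e 1) (e 0), ωcomm (e 2) (e 0), ωcomm (e 2) (e 1)]
          ring_nf
          simp only [two, mul_zero]
  have hmem : (x : Fin 6 → k) ∈ radical h b c := by
    refine ⟨hCE x.2, fun y hy => ?_⟩
    have hy' : y ∈ radical h b c ⊔ C := by rw [hsup]; exact hy
    obtain ⟨u, hu, v, hv, rfl⟩ := Submodule.mem_sup.1 hy'
    have h1 : ω x (u + v) = 0 := by
      rw [ωadd', ωcomm x u, ωrad u hu x (hCE x.2), hxC ⟨v, hv⟩, add_zero]
    simp only [ω] at h1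
    linear_combination h1 - c * klein x (u + v) * two
  have : (x : Fin 6 → k) ∈ radical h b c ⊓ C := ⟨hmem, x.2⟩
  rw [hinf, Submodule.mem_bot] at this
  exact hx0 (Subtype.ext this)

/-- On the radical, `q - c Q` is the square of a linear form. If the radical had dimension three,
this linear form and `Q` would have a common zero, at which the congruence would be singular. -/
lemma IsModel.finrank_radical_lt_three [IsAlgClosed k] (M : IsModel S h b) (c : k) :
    Module.finrank k (radical h b c) < 3 := by
  by_contra! h3
  have two : (2 : k) = 0 := CharTwo.two_eq_zero
  have hg : ∀ x : Fin 6 → k, ∃ s, s ^ 2 = bil b x x + c * kleinQ x := fun x =>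
    IsAlgClosed.exists_pow_nat_eq _ two_pos
  choose g hg using hg
  obtain ⟨f, hf⟩ : ∃ f : radical h b c →ₗ[k] k, ∀ x, f x = g x := ⟨
    { toFun := fun x => g x
      map_add' := fun x y => by
        apply CharTwo.sq_injective
        simp only
        rw [Submodule.coe_add, add_sq, hg, hg, hg, bil_add_self, kleinQ_add, x.2.2 y y.2.1]
        linear_combination (c * klein x y - g x * g y) * two
      map_smul' := fun a x => by
        apply CharTwo.sq_injective
        simp only [RingHom.id_apply, smul_eq_mul]
        rw [mul_pow, Submodule.coe_smul, hg, hg, bil_smul_left, bil_smul_right, kleinQ_smul]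
        ring }, fun _ => rfl⟩
  have h1 := LinearMap.finrank_range_add_finrank_ker f
  have h2 : Module.finrank k (LinearMap.range f) ≤ 1 := by
    simpa using Submodule.finrank_le (LinearMap.range f)
  obtain ⟨x, hx0, hxQ⟩ := exists_kleinQ_eq_zero (V := LinearMap.ker f) (by omega)
    ((radical h b c).subtype.comp (LinearMap.ker f).subtype)
  have hxf : g (x : radical h b c) = 0 := (hf x).symm.trans x.2
  simp only [LinearMap.comp_apply, Submodule.subtype_apply] at hxQ
  set y : Fin 6 → k := ((x : radical h b c) : Fin 6 → k)
  have hy : y ∈ radical h b c := (x : radical h b c).2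
  have hy0 : y ≠ 0 := fun h0 => hx0 (Subtype.ext (Subtype.ext h0))
  have hq : bil b y y = 0 := by
    have := hg y
    rw [hxf, hxQ] at this
    linear_combination -this
  obtain ⟨z, hz⟩ := exists_lin_ne_zero (ne_zero_of_pf M.pf_ne)
  refine M.smooth y hy0 hxQ hy.1 hq c ((polar b y z - c * klein y z) / lin h z) fun u => ?_
  have := hy.2 (u + (-(lin h u / lin h z)) • z) (by rw [lin_add, lin_smul]; field_simp; ring)
  rw [polar_add_right, polar_smul_right, klein_add_right, klein_smul_right] at this
  change polar b y u = _
  field_simp at this ⊢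
  linear_combination this

lemma IsModel.finrank_radical_le_one [IsAlgClosed k] (M : IsModel S h b) (c : k) :
    Module.finrank k (radical h b c) ≤ 1 := by
  have h1 := M.finrank_radical_lt_three c
  have h2 := finrank_radical_ne_two (b := b) (ne_zero_of_pf M.pf_ne) c
  omega

lemma IsModel.exists_smul_of_mem_radical [IsAlgClosed k] (M : IsModel S h b) {c : k}
    {x y : Fin 6 → k} (hx : x ∈ radical h b c) (hx0 : x ≠ 0) (hy : y ∈ radical h b c) :
    ∃ a : k, y = a • x := by
  have h1 : Module.finrank k (radical h b c) = 1 := by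
    have := M.finrank_radical_le_one c
    have : 0 < Module.finrank k (radical h b c) :=
      Module.finrank_pos_iff_exists_ne_zero.2 ⟨⟨x, hx⟩, fun h0 => hx0 (congrArg Subtype.val h0)⟩
    omega
  obtain ⟨a, ha⟩ := (finrank_eq_one_iff_of_nonzero' (⟨x, hx⟩ : radical h b c)
    fun h0 => hx0 (congrArg Subtype.val h0)).1 h1 ⟨y, hy⟩
  exact ⟨a, (congrArg Subtype.val ha).symm⟩

end model

lemma IsPoly.det {σ n : Type*} [Fintype n] [DecidableEq n] {A : (σ → k) → Matrix n n k}
    (hA : ∀ i j, IsPoly fun x => A x i j) : IsPoly fun x => (A x).det := by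
  simp only [Matrix.det_apply']
  exact IsPoly.sum _ fun τ => (IsPoly.const _).mul (IsPoly.prod _ fun i => hA _ _)

lemma IsPoly.adjugate {σ n : Type*} [Fintype n] [DecidableEq n] {A : (σ → k) → Matrix n n k}
    (hA : ∀ i j, IsPoly fun x => A x i j) (i j : n) : IsPoly fun x => (A x).adjugate i j := by
  simp only [Matrix.adjugate_apply]
  refine IsPoly.det fun i' j' => ?_
  by_cases hi : i' = j
  · subst hi
    simpa only [Matrix.updateRow_self] using IsPoly.const _
  · simpa only [Matrix.updateRow_ne hi] using hA i' j'

lemma IsPoly.finite_zeros {φ : (Unit → k) → k} (hφ : IsPoly φ) {c₀ : k}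
    (h0 : φ (fun _ => c₀) ≠ 0) : {c : k | φ (fun _ => c) = 0}.Finite := by
  obtain ⟨f, hf⟩ := hφ
  let P : Polynomial k := MvPolynomial.aeval (fun _ => Polynomial.X) f
  have hP : ∀ c, P.eval c = φ fun _ => c := fun c => by
    rw [polynomial_eval_aeval, ← hf]
    simp only [Polynomial.eval_X]
  have hP0 : P ≠ 0 := fun h => h0 (by rw [← hP, h, Polynomial.eval_zero])
  refine (Polynomial.finite_setOfPred_isRoot hP0).subset fun c hc => ?_
  exact (hP c).trans hc

/-- The endomorphism relating the polar form of `b` to the polar form of the Klein quadric. -/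
def polarMap (b : Fin 6 → Fin 6 → k) : (Fin 6 → k) →ₗ[k] (Fin 6 → k) where
  toFun x := nucleus fun l => ∑ j, (b j l + b l j) * x j
  map_add' x y := by
    have : (fun l => ∑ j, (b j l + b l j) * (x + y) j) = (fun l => ∑ j, (b j l + b l j) * x j)
        + fun l => ∑ j, (b j l + b l j) * y j := by
      ext l; simp [mul_add, Finset.sum_add_distrib]
    rw [this]
    ext i
    fin_cases i <;> simp [nucleus] <;> ring
  map_smul' c x := by
    rw [RingHom.id_apply, ← nucleus_smul]
    congr 1
    ext l
    simp [Finset.mul_sum, mul_left_comm]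

lemma klein_polarMap (b : Fin 6 → Fin 6 → k) (x y : Fin 6 → k) :
    klein (polarMap b x) y = polar b x y := by
  change klein (nucleus fun l => ∑ j, (b j l + b l j) * x j) y = _
  rw [klein_nucleus, lin, polar, bil, bil, Finset.sum_comm (f := fun i j => b i j * (x i * y j)),
    ← Finset.sum_add_distrib]
  refine Finset.sum_congr rfl fun l _ => ?_
  rw [Finset.sum_mul, ← Finset.sum_add_distrib]
  exact Finset.sum_congr rfl fun j _ => by ring

lemma exists_polarMap_eq {h : Fin 6 → k} {b : Fin 6 → Fin 6 → k} (hh : h ≠ 0) {c : k}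
    {x : Fin 6 → k} (hx : x ∈ radical h b c) : ∃ a : k, polarMap b x = c • x + a • nucleus h := by
  obtain ⟨a, ha⟩ := exists_eq_smul_nucleus (x := polarMap b x + (-c) • x) hh fun y hy => by
    rw [klein_add_left, klein_smul_left, klein_polarMap, hx.2 y hy]; ring
  refine ⟨a, ?_⟩
  rw [← ha]
  module

/-- The values `c` such that the quadric `q - c Q` is singular on the hyperplane `h = 0`. -/
def singularValues (h : Fin 6 → k) (b : Fin 6 → Fin 6 → k) : Set k :=
  {c | ∃ r ∈ radical h b c, r ≠ 0 ∧ bil b r r = c * kleinQ r}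

/-- The pencil contains only finitely many singular quadrics. For `c = 1 / μ` the radical contains
a vector which depends polynomially on `μ`, and which is the nucleus for `μ = 0`. -/
lemma finite_singularValues {h : Fin 6 → k} (hpf : pf h ≠ 0) (b : Fin 6 → Fin 6 → k) :
    (singularValues h b).Finite := by
  let A := LinearMap.toMatrix' (polarMap b)
  let B : (Unit → k) → Matrix (Fin 6) (Fin 6) k := fun μ => 1 - μ () • A
  let n : (Unit → k) → Fin 6 → k := fun μ => (B μ).adjugate.mulVec (nucleus h)
  let E : (Unit → k) → k := fun μ =>
    (B μ).det * (μ () * bil b (n μ) (n μ) - kleinQ (n μ))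
  have hB : ∀ i j, IsPoly fun μ => B μ i j := fun i j => by
    simp only [B, Matrix.sub_apply, Matrix.smul_apply, smul_eq_mul]
    exact (IsPoly.const _).sub ((IsPoly.coord ()).mul (IsPoly.const _))
  have hn : ∀ i, IsPoly fun μ => n μ i := fun i => by
    simp only [n, Matrix.mulVec, dotProduct]
    exact IsPoly.sum _ fun j => (IsPoly.adjugate hB i j).mul (IsPoly.const (nucleus h j))
  have hE : IsPoly E := (IsPoly.det hB).mul (((IsPoly.coord ()).mul (IsPoly.bil b hn hn)).sub
    ((((hn 0).mul (hn 5)).sub ((hn 1).mul (hn 4))).add ((hn 2).mul (hn 3))))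
  have hE0 : E (fun _ => 0) ≠ 0 := by
    simp only [E, B, n, zero_smul, sub_zero, Matrix.det_one, Matrix.adjugate_one,
      Matrix.one_mulVec, kleinQ_nucleus]
    simpa using hpf
  refine (((hE.finite_zeros hE0).image fun μ => μ⁻¹).insert 0).subset ?_
  rintro c ⟨r, hr, hr0, hq⟩
  by_cases hc : c = 0
  · exact Or.inl hc
  refine Or.inr ⟨c⁻¹, ?_, inv_inv c⟩
  rw [Set.mem_ofPred_eq]
  obtain ⟨a, ha⟩ := exists_polarMap_eq (ne_zero_of_pf hpf) hr
  set μ : Unit → k := fun _ => c⁻¹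
  by_cases hdet : (B μ).det = 0
  · simp only [E, hdet, zero_mul]
  have h1 : (B μ).mulVec r = (-(c⁻¹ * a)) • nucleus h := by
    simp only [B, A, Matrix.sub_mulVec, Matrix.one_mulVec, Matrix.smul_mulVec,
      LinearMap.toMatrix'_mulVec, ha, μ, smul_add, smul_smul, inv_mul_cancel₀ hc]
    module
  have h2 : (B μ).det • r = (-(c⁻¹ * a)) • n μ := by
    simp only [n]
    rw [← Matrix.mulVec_smul, ← h1, Matrix.mulVec_mulVec, Matrix.adjugate_mul, Matrix.smul_mulVec,
      Matrix.one_mulVec]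
  have h3 : -(c⁻¹ * a) ≠ 0 := by
    intro h3
    rw [h3, zero_smul] at h2
    exact smul_ne_zero hdet hr0 h2
  have e1 : bil b ((B μ).det • r) ((B μ).det • r) = c * kleinQ ((B μ).det • r) := by
    rw [bil_smul_left, bil_smul_right, kleinQ_smul, hq]; ring
  rw [h2, bil_smul_left, bil_smul_right, kleinQ_smul] at e1
  have e2 : bil b (n μ) (n μ) = c * kleinQ (n μ) := by
    apply mul_left_cancel₀ (pow_ne_zero 2 h3)
    linear_combination e1
  simp only [E, μ, e2]
  field_simp
  ring

lemma nucleus_ne_zero {h : Fin 6 → k} (hpf : pf h ≠ 0) : nucleus h ≠ 0 := fun h0 => by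
  apply hpf
  rw [← kleinQ_nucleus, h0]
  simp [kleinQ]

section model

variable {S : Set (Line k)} {h : Fin 6 → k} {b : Fin 6 → Fin 6 → k} [CharP k 2]

lemma lin_nucleus (h : Fin 6 → k) : lin h (nucleus h) = 0 := by
  rw [← klein_nucleus, klein_self]

/-- If the nucleus were a vertex of a quadric of the pencil, it would lie in all the radicals, and
one of these would contain an eigenvector on the quotient by the nucleus. -/
lemma IsModel.nucleus_notMem_radical [IsAlgClosed k] (M : IsModel S h b) (c : k) :
    nucleus h ∉ radical h b c := by
  intro hN
  have hh := ne_zero_of_pf M.pf_ne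
  have hN0 := nucleus_ne_zero M.pf_ne
  have hNy : ∀ y, lin h y = 0 → polar b (nucleus h) y = 0 := fun y hy => by
    rw [hN.2 y hy, klein_nucleus, hy, mul_zero]
  let H := LinearMap.ker (linMap h)
  have hA : ∀ x ∈ H, polarMap b x ∈ H := fun x hx => by
    change lin h _ = 0
    rw [← klein_nucleus, klein_comm, klein_polarMap, polar_comm]
    exact hNy x hx
  let f : H →ₗ[k] H := (polarMap b).restrict hA
  let N : H := ⟨nucleus h, lin_nucleus h⟩
  obtain ⟨a, ha⟩ := exists_polarMap_eq hh hN
  have hfN : f N = (c + a) • N := by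
    apply Subtype.ext
    change polarMap b (nucleus h) = (c + a) • nucleus h
    rw [ha, add_smul]
  let W := Submodule.span k {N}
  have hW : W ≤ W.comap f := by
    rw [Submodule.span_singleton_le_iff_mem, Submodule.mem_comap, hfN]
    exact Submodule.smul_mem _ _ (Submodule.mem_span_singleton_self N)
  have hnt : Nontrivial (H ⧸ W) := by
    have h1 := Submodule.finrank_quotient_add_finrank W
    have h2 : Module.finrank k H = 5 := finrank_ker_linMap hh
    have h3 : Module.finrank k W = 1 :=
      finrank_span_singleton fun h0 => hN0 (congrArg Subtype.val h0)
    exact Module.nontrivial_of_finrank_pos (R := k) (by omega)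
  obtain ⟨e, he⟩ := Module.End.exists_eigenvalue (W.mapQ W f hW)
  obtain ⟨v, hv⟩ := he.exists_hasEigenvector
  obtain ⟨x, rfl⟩ := Submodule.mkQ_surjective W v
  have h1 := hv.apply_eq_smul
  rw [Submodule.mkQ_apply, Submodule.mapQ_apply, ← Submodule.Quotient.mk_smul,
    Submodule.Quotient.eq, Submodule.mem_span_singleton] at h1
  obtain ⟨s, hs⟩ := h1
  have hs' : s • nucleus h = polarMap b x - e • (x : Fin 6 → k) := congrArg Subtype.val hs
  have hx : (x : Fin 6 → k) ∈ radical h b e := ⟨x.2, fun y hy => by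
    rw [← klein_polarMap, eq_add_of_sub_eq hs'.symm, klein_add_left, klein_smul_left,
      klein_smul_left, klein_nucleus, hy, mul_zero, zero_add]⟩
  have hN' : nucleus h ∈ radical h b e := ⟨lin_nucleus h, fun y hy => by
    rw [hNy y hy, klein_nucleus, hy, mul_zero]⟩
  obtain ⟨t, ht⟩ := M.exists_smul_of_mem_radical hN' hN0 hx
  apply hv.2
  rw [Submodule.mkQ_apply, Submodule.Quotient.mk_eq_zero, Submodule.mem_span_singleton]
  exact ⟨t, Subtype.ext ht.symm⟩

/-- Isotropic lines span the hyperplane `h = 0`. -/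
lemma exists_eq_smul_nucleus_of_isotropic (hpf : pf h ≠ 0) {r : Fin 6 → k}
    (hr : ∀ u v, om h u v = 0 → klein r (plucker u v) = 0) : ∃ c : k, r = c • nucleus h := by
  obtain ⟨e₂, f₁, f₂, B⟩ := exists_isSymp hpf (e₁ := Pi.single 0 1) (by
    intro h0; simpa using congrFun h0 0)
  set e₁ : Fin 4 → k := Pi.single 0 1
  let φ : (Fin 6 → k) →ₗ[k] k :=
    { toFun := fun x => klein r x - klein r (plucker e₁ f₁) * lin h x
      map_add' := fun x y => by rw [klein_add_right, lin_add]; ring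
      map_smul' := fun c x => by
        rw [klein_smul_right, lin_smul, RingHom.id_apply, smul_eq_mul]; ring }
  have hφ : ∀ x, φ x = klein r x - klein r (plucker e₁ f₁) * lin h x := fun x => rfl
  have h0 : ∀ {u v}, om h u v = 0 → φ (plucker u v) = 0 := fun {u v} huv => by
    rw [hφ, hr u v huv, lin_plucker, huv]; ring
  have hz := B.linearMap_eq_zero φ (h0 B.e₁e₂) (by rw [hφ, lin_plucker, B.e₁f₁]; ring)
    (h0 B.e₁f₂) (h0 B.e₂f₁) (by
      have two : (2 : k) = 0 := CharTwo.two_eq_zero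
      have h1 := hr (e₁ + e₂) (f₁ + f₂) (by
        simp only [om_add_left, om_add_right, B.e₁f₁, B.e₁f₂, B.e₂f₁, B.e₂f₂]
        linear_combination two)
      simp only [plucker_add_left, plucker_add_right, klein_add_right, hr _ _ B.e₁f₂,
        hr _ _ B.e₂f₁] at h1
      rw [hφ, lin_plucker, B.e₂f₂]
      linear_combination h1 - klein r (plucker e₁ f₁) * two) (h0 B.f₁f₂)
  refine exists_eq_smul_nucleus (ne_zero_of_pf hpf) fun y hy => ?_
  have := LinearMap.congr_fun hz y
  rw [hφ, hy, LinearMap.zero_apply] at this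
  linear_combination this

/-- The congruence spans the hyperplane `h = 0`: through a general point there are two rays, which
span the pencil of isotropic lines through the point. -/
lemma IsModel.exists_klein_ne_zero [IsAlgClosed k] (M : IsModel S h b) {r : Fin 6 → k}
    (hr : ∀ c : k, r ≠ c • nucleus h) :
    ∃ L ∈ S, ∃ p, L.IsPluckerVector p ∧ klein r p ≠ 0 := by
  by_contra! H
  obtain ⟨L₀, hL₀⟩ := M.irreducible.nonempty
  obtain ⟨v₀, -, hv₀⟩ := M.exists_F₂fun_ne_zero hL₀
  suffices ∀ u v, om h u v = 0 → klein r (plucker u v) = 0 by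
    obtain ⟨c, hc⟩ := exists_eq_smul_nucleus_of_isotropic M.pf_ne this
    exact hr c hc
  have h1 : ∀ v, F₂fun h b v ≠ 0 → ∀ u, om h v u = 0 → klein r (plucker v u) = 0 := by
    intro v hv u hu
    have hv0 : v ≠ 0 := by rintro rfl; exact hv (F₂fun_zero h b)
    obtain ⟨L₁, hL₁, L₂, hL₂, h₁, h₂, e⟩ := M.exists_two_rays hv
    have hne : L₁ ≠ L₂ := by
      rintro rfl
      exact hv (by linear_combination -e)
    obtain ⟨u₁, h1, rfl⟩ := L₁.exists_eq_lineOf_of_mem h₁ hv0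
    obtain ⟨u₂, h2, rfl⟩ := L₂.exists_eq_lineOf_of_mem h₂ hv0
    have o₁ := ((M.lineOf_mem_iff h1).1 hL₁).1
    have o₂ := ((M.lineOf_mem_iff h2).1 hL₂).1
    have h12 : om h u₁ u₂ ≠ 0 := by
      intro h12
      have := om_smul_plucker M.pf_ne o₁ o₁ o₂ h1
      obtain ⟨g₁, g₂, B⟩ := exists_isSymp_of_isotropic M.pf_ne h1 o₁
      have e2 := B.plucker_eq_of_om_eq_zero o₂
      rw [om_comm h u₂ u₁, h12, zero_smul, add_zero] at e2
      apply hne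
      refine Line.eq_of_isPluckerVector (p := plucker v u₂) ?_ (isPluckerVector_plucker h2)
      rw [e2]
      refine (isPluckerVector_plucker h1).smul fun h0 => h2 ?_
      rw [e2, h0, zero_smul]
    have e1 := congrArg (klein r) (om_smul_plucker M.pf_ne o₁ o₂ hu h1)
    rw [klein_smul_right, klein_add_right, klein_smul_right, klein_smul_right,
      H _ hL₁ _ (isPluckerVector_plucker h1), H _ hL₂ _ (isPluckerVector_plucker h2)] at e1
    exact (mul_eq_zero.1 (by linear_combination e1)).resolve_left h12
  -- extend to all `v` by density: `orthVec` is the general element of `v^⊥`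
  intro v u hvu
  by_cases hv0 : v = 0
  · rw [hv0, plucker_zero_left, ← zero_smul k (0 : Fin 6 → k), klein_smul_right, zero_mul]
  obtain ⟨x, hx⟩ := exists_om_ne_zero M.pf_ne hv0
  obtain ⟨P, hP⟩ : IsPoly fun v => klein r (plucker v (orthVec h x u v)) :=
    IsPoly.klein (fun i => IsPoly.const (r i)) (IsPoly.plucker IsPoly.coord
      (IsPoly.orthVec h x u IsPoly.coord))
  have hP0 : P = 0 := (isPoly_F₂fun h b).eq_zero_of_eval ⟨v₀, hv₀⟩ fun v hv => by
    rw [hP]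
    exact h1 v hv _ (om_orthVec h x u v)
  have := hP v
  simp only [orthVec] at this
  rw [hP0, map_zero, hvu, zero_smul, add_zero, plucker_smul_right, klein_smul_right] at this
  exact (mul_eq_zero.1 this.symm).resolve_left hx

/-- A conic on the congruence lies in a plane which meets the vertex of some quadric of the
pencil. -/
lemma exists_mem_radical_of_conic [Infinite k] (hh : h ≠ 0) {P₀ Z P₁ : Fin 6 → k}
    (hP₀ : lin h P₀ = 0) (hZ : lin h Z = 0) (hP₁ : lin h P₁ = 0) (hne : klein P₀ P₁ ≠ 0)
    (hQ : ∀ t : k, kleinQ (P₀ + t • Z + t ^ 2 • P₁) = 0)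
    (hq : ∀ t : k, bil b (P₀ + t • Z + t ^ 2 • P₁) (P₀ + t • Z + t ^ 2 • P₁) = 0) :
    ∃ c, ∃ r ∈ radical h b c, r ≠ 0 ∧ bil b r r = c * kleinQ r ∧
      ∃ x y z : k, r = x • P₀ + y • Z + z • P₁ := by
  have two : (2 : k) = 0 := CharTwo.two_eq_zero
  have coeffs : ∀ a₀ a₁ a₂ a₃ a₄ : k,
      (∀ t : k, a₀ + a₁ * t + a₂ * t ^ 2 + a₃ * t ^ 3 + a₄ * t ^ 4 = 0) →
      a₀ = 0 ∧ a₁ = 0 ∧ a₂ = 0 ∧ a₃ = 0 ∧ a₄ = 0 := by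
    intro a₀ a₁ a₂ a₃ a₄ H
    have h0 : Polynomial.C a₀ + Polynomial.C a₁ * Polynomial.X + Polynomial.C a₂ * Polynomial.X ^ 2
        + Polynomial.C a₃ * Polynomial.X ^ 3 + Polynomial.C a₄ * Polynomial.X ^ 4 = 0 :=
      Polynomial.funext fun t => by simpa using H t
    have hc := fun i => congrArg (Polynomial.coeff · i) h0
    refine ⟨?_, ?_, ?_, ?_, ?_⟩
    · simpa [Polynomial.coeff_X, Polynomial.coeff_C, Polynomial.coeff_X_pow] using hc 0
    · simpa [Polynomial.coeff_X, Polynomial.coeff_C, Polynomial.coeff_X_pow] using hc 1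
    · simpa [Polynomial.coeff_X, Polynomial.coeff_C, Polynomial.coeff_X_pow] using hc 2
    · simpa [Polynomial.coeff_X, Polynomial.coeff_C, Polynomial.coeff_X_pow] using hc 3
    · simpa [Polynomial.coeff_X, Polynomial.coeff_C, Polynomial.coeff_X_pow] using hc 4
  obtain ⟨Q0, Q1, Q2, Q3, Q4⟩ := coeffs (kleinQ P₀) (klein P₀ Z) (kleinQ Z + klein P₀ P₁)
    (klein Z P₁) (kleinQ P₁) fun t => by
      have := hQ t
      simp only [kleinQ_add, kleinQ_smul, klein_add_left, klein_smul_left, klein_smul_right] at this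
      linear_combination this
  obtain ⟨q0, q1, q2, q3, q4⟩ := coeffs (bil b P₀ P₀) (polar b P₀ Z) (bil b Z Z + polar b P₀ P₁)
    (polar b Z P₁) (bil b P₁ P₁) fun t => by
      have := hq t
      simp only [bil_add_self, polar_add_left, polar_smul_left, polar_smul_right, bil_smul_left,
        bil_smul_right] at this
      linear_combination this
  set c := polar b P₀ P₁ / klein P₀ P₁
  have hc : polar b P₀ P₁ = c * klein P₀ P₁ := (div_mul_cancel₀ _ hne).symm
  let P : (Fin 3 → k) →ₗ[k] (Fin 6 → k) :=
    { toFun := fun x => x 0 • P₀ + x 1 • Z + x 2 • P₁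
      map_add' := fun x y => by simp only [Pi.add_apply]; module
      map_smul' := fun c x => by simp only [Pi.smul_apply, RingHom.id_apply, smul_eq_mul]; module }
  have hP : ∀ x, P x = x 0 • P₀ + x 1 • Z + x 2 • P₁ := fun x => rfl
  have hK : ∀ x y, klein (P x) (P y) = (x 0 * y 2 + x 2 * y 0) * klein P₀ P₁ := fun x y => by
    simp only [hP, klein_add_left, klein_add_right, klein_smul_left, klein_smul_right, klein_self,
      klein_comm Z P₀, klein_comm P₁ P₀, klein_comm P₁ Z, Q1, Q3]
    ring
  have hB : ∀ x y, polar b (P x) (P y) = c * klein (P x) (P y) := fun x y => by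
    rw [hK]
    simp only [hP, polar_add_left, polar_add_right, polar_smul_left, polar_smul_right, polar_self,
      polar_comm b Z P₀, polar_comm b P₁ P₀, polar_comm b P₁ Z, q1, q3, hc]
    ring
  have hqQ : ∀ x, bil b (P x) (P x) = c * kleinQ (P x) := fun x => by
    simp only [hP, bil_add_self, kleinQ_add, polar_add_left, polar_smul_left, polar_smul_right,
      klein_add_left, klein_smul_left, klein_smul_right, kleinQ_smul, bil_smul_left,
      bil_smul_right, q0, q1, q3, q4, Q0, Q1, Q3, Q4]
    linear_combination x 1 ^ 2 * (q2 - c * Q2 - hc) + x 0 * x 2 * hc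
  have hinj : Function.Injective P := by
    rw [← LinearMap.ker_eq_bot, LinearMap.ker_eq_bot']
    intro x hx
    have e0 := hK x ![1, 0, 0]
    have e2 := hK x ![0, 0, 1]
    have z0 : ∀ y : Fin 6 → k, klein 0 y = 0 := fun y => by
      rw [← zero_smul k (0 : Fin 6 → k), klein_smul_left, zero_mul]
    simp only [hx, z0] at e0 e2
    have x2 : x 2 = 0 := by simpa [hne] using e0.symm
    have x0 : x 0 = 0 := by simpa [hne] using e2.symm
    have e1 := congrArg kleinQ hx
    rw [hP, x0, x2, zero_smul, zero_smul, add_zero, zero_add, kleinQ_smul] at e1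
    have hZ0 : kleinQ Z ≠ 0 := fun h0 => hne (by rw [h0, zero_add] at Q2; exact Q2)
    have hQ0 : kleinQ (0 : Fin 6 → k) = 0 := by simp [kleinQ]
    have x1 : x 1 = 0 :=
      eq_zero_of_pow_eq_zero ((mul_eq_zero.1 (e1.trans hQ0)).resolve_right hZ0)
    ext i
    fin_cases i <;> assumption
  have hle : LinearMap.range P ≤ LinearMap.ker (linMap h) := by
    rintro _ ⟨x, rfl⟩
    change lin h _ = 0
    rw [hP, lin_add, lin_add, lin_smul, lin_smul, lin_smul, hP₀, hZ, hP₁]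
    ring
  obtain ⟨C, hCE, hinf, hsup, hfin⟩ := exists_complement_in hle
  rw [LinearMap.finrank_range_of_inj hinj, Module.finrank_pi, Fintype.card_fin,
    finrank_ker_linMap hh] at hfin
  let e := Module.finBasisOfFinrankEq k C (n := 2) (by omega)
  -- a vector of the plane orthogonal to the two-dimensional complement of the plane
  let T : (Fin 3 → k) →ₗ[k] (Fin 2 → k) :=
    { toFun := fun x i => polar b (P x) (e i) - c * klein (P x) (e i)
      map_add' := fun x y => by
        ext i
        simp only [map_add, polar_add_left, klein_add_left, Pi.add_apply]; ring
      map_smul' := fun a x => by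
        ext i
        simp only [map_smul, polar_smul_left, klein_smul_left, Pi.smul_apply, RingHom.id_apply,
          smul_eq_mul]; ring }
  have hT : LinearMap.ker T ≠ ⊥ := LinearMap.ker_ne_bot_of_finrank_lt (by simp)
  obtain ⟨x, hx, hx0⟩ := Submodule.exists_mem_ne_zero_of_ne_bot hT
  have hTx : ∀ i, polar b (P x) (e i) = c * klein (P x) (e i) := fun i =>
    sub_eq_zero.1 (congrFun hx i)
  refine ⟨c, P x, ⟨hle ⟨x, rfl⟩, fun y hy => ?_⟩, fun h0 => hx0 (hinj (h0.trans (map_zero P).symm)),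
    hqQ x, x 0, x 1, x 2, rfl⟩
  have hy' : y ∈ LinearMap.range P ⊔ C := by rw [hsup]; exact hy
  obtain ⟨_, ⟨u, rfl⟩, v, hv, rfl⟩ := Submodule.mem_sup.1 hy'
  have hv' : v = (e.repr ⟨v, hv⟩ 0) • (e 0 : Fin 6 → k)
      + (e.repr ⟨v, hv⟩ 1) • (e 1 : Fin 6 → k) := by
    have := congrArg Subtype.val (e.sum_repr ⟨v, hv⟩)
    rw [Fin.sum_univ_two] at this
    exact this.symm
  rw [hv', polar_add_right, klein_add_right, hB, polar_add_right, klein_add_right, polar_smul_right,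
    polar_smul_right, klein_smul_right, klein_smul_right, hTx, hTx]
  ring

end model

/-! ### Lines that split -/

lemma natDegree_le_two_of_root {A F G : Polynomial k} (hF : F.natDegree ≤ 2)
    (hG : G.natDegree ≤ 4) (H : A ^ 2 + F * A + G = 0) : A.natDegree ≤ 2 := by
  by_contra! h
  have h1 : (A ^ 2).natDegree ≤ max (A.natDegree + 2) 4 := by
    rw [show A ^ 2 = -(F * A + G) by linear_combination H, Polynomial.natDegree_neg]
    refine (Polynomial.natDegree_add_le _ _).trans (max_le_max ?_ hG)
    exact Polynomial.natDegree_mul_le.trans (by omega)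
  rw [Polynomial.natDegree_pow] at h1
  rcases le_max_iff.1 h1 with h1 | h1 <;> omega

lemma not_splits_of_isIrreducible {S : Set (Line k)} {l : Line k}
    (H : IsIrreducible (preimageOfLine S l)) : ¬ Splits S l := by
  intro hs
  have hsub : {C | C ∈ componentsOf (preimageOfLine S l) ∧ Flag.pt '' C = l.points} ⊆
      {preimageOfLine S l} := by
    rintro C ⟨hC, -⟩
    exact hC.1.2.antisymm (hC.2 ⟨H, subset_rfl⟩ hC.1.2)
  have h1 := Set.encard_le_encard hsub
  rw [Splits] at hs
  rw [hs, Set.encard_singleton] at h1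
  exact absurd h1 (by decide)

/-- A monic quadratic equation over the polynomial ring which has a root in the field of fractions
has a polynomial root. -/
lemma exists_root_of_norm_eq_zero {R : Type*} [CommRing R] [IsDomain R]
    [UniqueFactorizationMonoid R] {F G p₀ p₁ : R} (hp : p₁ ≠ 0)
    (H : p₀ ^ 2 + p₀ * p₁ * F + p₁ ^ 2 * G = 0) : ∃ A, A ^ 2 + F * A + G = 0 := by
  obtain ⟨p₁', p₀', c, hrel, rfl, rfl⟩ :=
    UniqueFactorizationMonoid.exists_reduced_factors p₁ hp p₀
  have hc : c ≠ 0 := left_ne_zero_of_mul hp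
  have hp' : p₁' ≠ 0 := right_ne_zero_of_mul hp
  have h1 : p₀' * p₀' = p₁' * (-(p₀' * F + p₁' * G)) := by
    apply mul_left_cancel₀ (pow_ne_zero 2 hc)
    linear_combination H
  have h2 : IsUnit p₁' := hrel dvd_rfl (hrel.dvd_of_dvd_mul_left (Dvd.intro _ h1.symm))
  obtain ⟨A, rfl⟩ := h2.dvd (a := p₀')
  refine ⟨A, mul_left_cancel₀ (pow_ne_zero 2 hp') ?_⟩
  linear_combination h1

section model

variable {S : Set (Line k)} {h : Fin 6 → k} {b : Fin 6 → Fin 6 → k}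

/-- The norm of a function on the double cover of a line which is not identically zero does not
vanish identically, unless the double cover has a section. -/
lemma IsRedPoly.exists_norm_ne_zero [Infinite k] {Φ : (Fin 4 → k) → k → k}
    {x y v₀ : Fin 4 → k} {w₀ : k} {g₀ g₁ : (Fin 4 → k) → k} (hg₀ : IsPoly g₀) (hg₁ : IsPoly g₁)
    (hΦ : ∀ v w, w ^ 2 + F₂fun h b v * w + F₄fun h b v = 0 → Φ v w = g₀ v + g₁ v * w)
    (hv₀ : ∃ s : Fin 2 → k, v₀ = s 0 • x + s 1 • y)
    (hw₀ : w₀ ^ 2 + F₂fun h b v₀ * w₀ + F₄fun h b v₀ = 0) (h0 : Φ v₀ w₀ ≠ 0)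
    (hroot : ¬ ∃ φ : (Fin 2 → k) → k, IsPoly φ ∧ ∀ s, φ s ^ 2
      + F₂fun h b (s 0 • x + s 1 • y) * φ s + F₄fun h b (s 0 • x + s 1 • y) = 0) :
    ∃ s : Fin 2 → k, g₀ (s 0 • x + s 1 • y) ^ 2
      + g₀ (s 0 • x + s 1 • y) * g₁ (s 0 • x + s 1 • y) * F₂fun h b (s 0 • x + s 1 • y)
      + g₁ (s 0 • x + s 1 • y) ^ 2 * F₄fun h b (s 0 • x + s 1 • y) ≠ 0 := by
  by_contra! H
  have hyP : ∀ i, IsPoly fun s : Fin 2 → k => (s 0 • x + s 1 • y) i := fun i =>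
    ((IsPoly.coord 0).mul (IsPoly.const (x i))).add ((IsPoly.coord 1).mul (IsPoly.const (y i)))
  obtain ⟨p₀, hp₀⟩ := hg₀.comp hyP
  obtain ⟨p₁, hp₁⟩ := hg₁.comp hyP
  obtain ⟨F, hF⟩ := (isPoly_F₂fun h b).comp hyP
  obtain ⟨G, hG⟩ := (isPoly_F₄fun h b).comp hyP
  by_cases hp : p₁ = 0
  · obtain ⟨s, rfl⟩ := hv₀
    apply h0
    have h1 := H s
    have h2 : g₁ (s 0 • x + s 1 • y) = 0 := by
      rw [← map_zero (MvPolynomial.eval s), ← hp]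
      exact (hp₁ s).symm
    rw [hΦ _ _ hw₀, h2, zero_mul, add_zero]
    rw [h2] at h1
    exact eq_zero_of_pow_eq_zero (n := 2) (by linear_combination h1)
  · apply hroot
    obtain ⟨A, hA⟩ := exists_root_of_norm_eq_zero (F := F) (G := G) (p₀ := p₀) hp
      (MvPolynomial.funext fun s => by
        simp only [map_add, map_mul, map_pow, map_zero, hp₀, hp₁, hF, hG, H s])
    refine ⟨_, ⟨A, fun s => rfl⟩, fun s => ?_⟩
    have := congrArg (MvPolynomial.eval s) hA
    simpa only [map_add, map_mul, map_pow, map_zero, hF, hG] using this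

variable [CharP k 2]

/-- In a chart, a bihomogeneous polynomial is a polynomial function on the double cover. -/
lemma IsModel.exists_isRedPoly_of_not_vanishes (M : IsModel S h b) {z : Flag k}
    (hz : z.line ∈ S) (hb : ¬ IsBasePoint h b z.pt.rep) {m n : ℕ}
    {f : MvPolynomial (Fin 4 ⊕ Fin 6) k} (hf : IsBihomogeneous f m n) (hzf : ¬ z.Vanishes f) :
    ∃ Φ, IsRedPoly h b Φ ∧ Φ z.pt.rep (sectionW h b z.pt.rep z.line) ≠ 0 ∧
      ∀ L ∈ S, ∀ v, ∀ hv : v ∈ L.toSubmodule, ∀ hv0 : v ≠ 0, Φ v (sectionW h b v L) ≠ 0 →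
        ¬ (flagOf v L hv0 hv).Vanishes f := by
  obtain ⟨κ, ρ, hκ, hx, hκ0, H⟩ := M.exists_chart hb
  refine ⟨fun v w => κ v * MvPolynomial.eval (Sum.elim v (ρ v w)) f,
    (IsRedPoly.of_isPoly hκ).mul (IsRedPoly.eval f hx), ?_, fun L hL v hv hv0 hne => ?_⟩
  · refine mul_ne_zero hκ0 fun h0 => hzf ?_
    rwa [Flag.vanishes_iff_rep (H _ hz _ z.rep_mem hκ0) hf]
  · obtain ⟨h1, h2⟩ := mul_ne_zero_iff.1 hne
    rwa [flagOf_vanishes_iff (H L hL v hv h1) hf]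

/-- The preimage of a line without base points is irreducible unless the double cover
`x₄² + F₂ x₄ + F₄ = 0` has a section over the line. -/
lemma IsModel.isIrreducible_preimageOfLine [IsAlgClosed k] (M : IsModel S h b) {x y : Fin 4 → k}
    (hxy : plucker x y ≠ 0) (hb : ∀ v ∈ (lineOf x y hxy).toSubmodule, v ≠ 0 → ¬ IsBasePoint h b v)
    (hroot : ¬ ∃ φ : (Fin 2 → k) → k, IsPoly φ ∧ ∀ s, φ s ^ 2
      + F₂fun h b (s 0 • x + s 1 • y) * φ s + F₄fun h b (s 0 • x + s 1 • y) = 0) :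
    IsIrreducible (preimageOfLine S (lineOf x y hxy)) := by
  have two : (2 : k) = 0 := CharTwo.two_eq_zero
  have hray : ∀ v ∈ (lineOf x y hxy).toSubmodule, v ≠ 0 → ∃ L ∈ S, v ∈ L.toSubmodule := by
    intro v hv hv0
    obtain ⟨w, hw⟩ := exists_root_quadratic one_ne_zero (F₂fun h b v) (F₄fun h b v)
    obtain ⟨L, hL, hvL, -⟩ := M.exists_ray_of_root (hb v hv hv0) (w := w) (by linear_combination hw)
    exact ⟨L, hL, hvL⟩
  constructor
  · have hx0 := ne_zero_left_of_plucker hxy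
    obtain ⟨L, hL, hvL⟩ := hray x left_mem_lineOf hx0
    exact ⟨flagOf x L hx0 hvL, hL, (mk_mem_points_iff hx0).2 left_mem_lineOf⟩
  rw [Flag.isPreirreducible_iff]
  rintro m n m' n' f g hf hg ⟨z, hz, hzf⟩ ⟨z', hz', hzg⟩
  have hyP : ∀ i, IsPoly fun s : Fin 2 → k => (s 0 • x + s 1 • y) i := fun i =>
    ((IsPoly.coord 0).mul (IsPoly.const (x i))).add ((IsPoly.coord 1).mul (IsPoly.const (y i)))
  have key : ∀ {z : Flag k}, z ∈ preimageOfLine S (lineOf x y hxy) → ∀ {m n f},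
      IsBihomogeneous f m n → ¬ z.Vanishes f → ∃ (Φ : (Fin 4 → k) → k → k) (ν : (Fin 2 → k) → k),
        IsPoly ν ∧ (∃ s, ν s ≠ 0) ∧ (∀ s w, w ^ 2 + F₂fun h b (s 0 • x + s 1 • y) * w
          + F₄fun h b (s 0 • x + s 1 • y) = 0 → ν s ≠ 0 → Φ (s 0 • x + s 1 • y) w ≠ 0) ∧
        ∀ L ∈ S, ∀ v, ∀ hv : v ∈ L.toSubmodule, ∀ hv0 : v ≠ 0, Φ v (sectionW h b v L) ≠ 0 →
        ¬ (flagOf v L hv0 hv).Vanishes f := by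
    intro z hz m n f hf hzf
    have hzl := mem_points_iff.1 hz.2
    obtain ⟨Φ, ⟨g₀, g₁, hg₀, hg₁, hΦ⟩, hΦ0, H⟩ := M.exists_isRedPoly_of_not_vanishes hz.1
      (hb _ hzl z.pt.rep_nonzero) hf hzf
    obtain ⟨s, t, hst⟩ := mem_lineOf.1 hzl
    refine ⟨Φ, _, (((hg₀.comp hyP).pow 2).add (((hg₀.comp hyP).mul (hg₁.comp hyP)).mul
      ((isPoly_F₂fun h b).comp hyP))).add (((hg₁.comp hyP).pow 2).mul
      ((isPoly_F₄fun h b).comp hyP)),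
      IsRedPoly.exists_norm_ne_zero hg₀ hg₁ hΦ ⟨![s, t], by simpa using hst.symm⟩
        (M.sectionW_quadratic hz.1 z.rep_mem z.pt.rep_nonzero) hΦ0 hroot,
      fun s w hw hν h0 => hν ?_, H⟩
    rw [hΦ _ _ hw] at h0
    set v := s 0 • x + s 1 • y
    -- the norm is the product of the two conjugates
    linear_combination (g₀ v + g₁ v * (w + F₂fun h b v)) * h0 - g₁ v ^ 2 * hw
      + (g₁ v ^ 2 * F₄fun h b v - g₀ v * g₁ v * w) * two
  obtain ⟨Φ, ν, hν, hν0, h1, h2⟩ := key hz hf hzf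
  obtain ⟨Ψ, ν', hν', hν0', h1', h2'⟩ := key hz' hg hzg
  obtain ⟨s, hs, hs0⟩ := (hν.mul hν').exists_ne_zero_and (IsPoly.coord 0)
    (hν.exists_ne_zero_and hν' hν0 hν0' |>.imp fun _ h => mul_ne_zero h.1 h.2)
    ⟨fun _ => 1, one_ne_zero⟩
  obtain ⟨hs1, hs2⟩ := mul_ne_zero_iff.1 hs
  set v := s 0 • x + s 1 • y with hv
  have hvl : v ∈ (lineOf x y hxy).toSubmodule := mem_lineOf.2 ⟨_, _, rfl⟩
  have hv0 : v ≠ 0 := by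
    intro h0
    have : plucker v y = 0 := by rw [h0, plucker_zero_left]
    rw [hv, plucker_add_left, plucker_smul_left, plucker_smul_left, plucker_self, smul_zero,
      add_zero] at this
    exact smul_ne_zero hs0 hxy this
  obtain ⟨L, hL, hvL⟩ := hray v hvl hv0
  have hw := M.sectionW_quadratic hL hvL hv0
  exact ⟨flagOf v L hv0 hvL, ⟨hL, (mk_mem_points_iff hv0).2 hvl⟩,
    h2 L hL v hvL hv0 (h1 s _ hw hs1), h2' L hL v hvL hv0 (h1' s _ hw hs2)⟩

/-- Over a splitting line without base points, the double cover has a section. -/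
lemma IsModel.exists_polynomial_root [IsAlgClosed k] (M : IsModel S h b) {l : Line k}
    (hl : Splits S l) (hb : ∀ v ∈ l.toSubmodule, v ≠ 0 → ¬ IsBasePoint h b v) {x y : Fin 4 → k}
    (hx : x ∈ l.toSubmodule) (hy : y ∈ l.toSubmodule) (hxy : plucker x y ≠ 0) :
    ∃ A : Polynomial k, A.natDegree ≤ 2 ∧ ∀ t, A.eval t ^ 2 + F₂fun h b (x + t • y) * A.eval t
      + F₄fun h b (x + t • y) = 0 := by
  obtain rfl := l.eq_lineOf hx hy hxy
  obtain ⟨φ, hφ, H⟩ : ∃ φ : (Fin 2 → k) → k, IsPoly φ ∧ ∀ s, φ s ^ 2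
      + F₂fun h b (s 0 • x + s 1 • y) * φ s + F₄fun h b (s 0 • x + s 1 • y) = 0 := by
    by_contra hroot
    exact not_splits_of_isIrreducible (M.isIrreducible_preimageOfLine hxy hb hroot) hl
  obtain ⟨f, hf⟩ := hφ
  obtain ⟨F, hFd, hF⟩ := (isPoly_F₂fun h b).exists_polynomial_natDegree_le (F₂fun_smul h b) x y
  obtain ⟨G, hGd, hG⟩ := (isPoly_F₄fun h b).exists_polynomial_natDegree_le (F₄fun_smul h b) x y
  have hA : ∀ t, (MvPolynomial.aeval ![1, Polynomial.X] f).eval t ^ 2 + F₂fun h b (x + t • y)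
      * (MvPolynomial.aeval ![1, Polynomial.X] f).eval t + F₄fun h b (x + t • y) = 0 := by
    intro t
    have h1 := H ![1, t]
    have h2 : (fun i => ((![1, Polynomial.X] : Fin 2 → Polynomial k) i).eval t) = ![1, t] := by
      ext i
      fin_cases i <;> simp
    simp only [Matrix.cons_val_zero, Matrix.cons_val_one, one_smul] at h1
    rw [polynomial_eval_aeval, h2, hf]
    exact h1
  refine ⟨_, natDegree_le_two_of_root hFd hGd (Polynomial.funext fun t => ?_), hA⟩
  simpa only [Polynomial.eval_add, Polynomial.eval_mul, Polynomial.eval_pow, Polynomial.eval_zero,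
    hF, hG] using hA t

end model

/-! ### Conics of rays over a line with a section -/

lemma klein_plucker_inner (u v x : Fin 4 → k) : klein (plucker u v) (plucker v x) = 0 := by
  simp [klein, plucker]; ring

lemma exists_coeffs_of_natDegree_le_two {A : Polynomial k} (hA : A.natDegree ≤ 2) :
    ∃ a₀ a₁ a₂ : k, ∀ t, A.eval t = a₀ + a₁ * t + a₂ * t ^ 2 := by
  refine ⟨A.coeff 0, A.coeff 1, A.coeff 2, fun t => ?_⟩
  rw [Polynomial.eval_eq_sum_range' (Nat.lt_succ_of_le hA), Finset.sum_range_succ,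
    Finset.sum_range_succ, Finset.sum_range_one]
  ring

/-- A factorization `a c = n (n + b)` yields a solution of `a x² + b x y + c y² = 0`, given either
by constants or by polynomials of degree one. -/
lemma exists_isotropic_of_mul_eq [CharP k 2] {a b c n : Polynomial k} (ha : a.natDegree = 2)
    (hb : b.natDegree ≤ 2) (hn : n.natDegree ≤ 2) (H : a * c = n * (n + b)) :
    (∃ κ : k, Polynomial.C κ ^ 2 * a + Polynomial.C κ * b + c = 0) ∨
    ∃ x₀ x₁ y₀ y₁ : k, x₀ * y₁ + y₀ * x₁ ≠ 0 ∧
      ∀ t, (x₀ + t * x₁) ^ 2 * a.eval t + (x₀ + t * x₁) * (y₀ + t * y₁) * b.eval t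
        + (y₀ + t * y₁) ^ 2 * c.eval t = 0 := by
  have two : (2 : Polynomial k) = 0 := CharTwo.two_eq_zero
  obtain ⟨a₁, a₂, ⟨n₁, rfl⟩, ⟨m, hm⟩, rfl⟩ :=
    exists_dvd_and_dvd_of_dvd_mul (Dvd.intro _ H : a ∣ n * (n + b))
  have h0 : a₁ * a₂ ≠ 0 := by
    intro h0
    simp [h0] at ha
  obtain ⟨h1, h2⟩ := mul_ne_zero_iff.1 h0
  obtain rfl : c = n₁ * m := by
    apply mul_left_cancel₀ h0
    rw [H, hm]
    ring
  obtain rfl : b = a₁ * n₁ + a₂ * m := by linear_combination hm - a₁ * n₁ * two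
  have hm2 : (a₂ * m).natDegree ≤ 2 := by
    rw [← hm]
    exact (Polynomial.natDegree_add_le _ _).trans (max_le hn hb)
  rw [Polynomial.natDegree_mul h1 h2] at ha
  -- `κ² a + κ b + c` is the product of `κ a₁ + m` and `κ a₂ + n₁`
  have fac : ∀ κ : k, n₁ = Polynomial.C κ * a₂ ∨ m = Polynomial.C κ * a₁ →
      Polynomial.C κ ^ 2 * (a₁ * a₂) + Polynomial.C κ * (a₁ * n₁ + a₂ * m) + n₁ * m = 0 := by
    rintro κ (rfl | rfl)
    · linear_combination (Polynomial.C κ ^ 2 * a₁ * a₂ + Polynomial.C κ * a₂ * m) * two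
    · linear_combination (Polynomial.C κ ^ 2 * a₁ * a₂ + Polynomial.C κ * a₁ * n₁) * two
  have const : ∀ {p q r : Polynomial k}, p ≠ 0 → (p * q).natDegree ≤ 2 → p.natDegree = 2 →
      r ≠ 0 → r.natDegree = 0 → ∃ κ, q = Polynomial.C κ * r := by
    intro p q r hp hpq hp2 hr hr0
    rw [Polynomial.eq_C_of_natDegree_eq_zero hr0] at hr ⊢
    have hq : q.natDegree = 0 := by
      by_cases hq : q = 0
      · rw [hq, Polynomial.natDegree_zero]
      · rw [Polynomial.natDegree_mul hp hq] at hpq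
        omega
    rw [Polynomial.eq_C_of_natDegree_eq_zero hq]
    refine ⟨q.coeff 0 / r.coeff 0, ?_⟩
    rw [← Polynomial.C_mul, div_mul_cancel₀ _ (by simpa using hr)]
  rcases (by omega : a₁.natDegree = 2 ∧ a₂.natDegree = 0 ∨ a₁.natDegree = 0 ∧ a₂.natDegree = 2 ∨
    a₁.natDegree = 1 ∧ a₂.natDegree = 1) with ⟨d1, d2⟩ | ⟨d1, d2⟩ | ⟨d1, d2⟩
  · obtain ⟨κ, hκ⟩ := const h1 hn d1 h2 d2
    exact Or.inl ⟨κ, fac κ (Or.inl hκ)⟩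
  · obtain ⟨κ, hκ⟩ := const h2 hm2 d2 h1 d1
    exact Or.inl ⟨κ, fac κ (Or.inr hκ)⟩
  have hn1 : n₁.natDegree ≤ 1 := by
    by_cases hq : n₁ = 0
    · simp [hq]
    · rw [Polynomial.natDegree_mul h1 hq] at hn
      omega
  obtain ⟨x₁, x₀, hx⟩ := Polynomial.exists_eq_X_add_C_of_natDegree_le_one hn1
  obtain ⟨y₁, y₀, hy⟩ := Polynomial.exists_eq_X_add_C_of_natDegree_le_one d2.le
  by_cases hxy : x₀ * y₁ + y₀ * x₁ = 0
  · have hy1 : y₁ ≠ 0 := by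
      rintro rfl
      rw [hy] at d2
      simp at d2
    refine Or.inl ⟨x₁ / y₁, fac _ (Or.inl ?_)⟩
    have e0 : x₀ = x₁ / y₁ * y₀ := by
      field_simp
      linear_combination hxy - y₀ * x₁ * (CharTwo.two_eq_zero : (2 : k) = 0)
    have e1 : x₁ = x₁ / y₁ * y₁ := by field_simp
    rw [hx, hy, mul_add, ← mul_assoc, ← Polynomial.C_mul, ← Polynomial.C_mul, ← e0, ← e1]
  · refine Or.inr ⟨x₀, x₁, y₀, y₁, hxy, fun t => ?_⟩
    have e0 : x₀ + t * x₁ = n₁.eval t := by simp [hx]; ring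
    have e1 : y₀ + t * y₁ = a₂.eval t := by simp [hy]; ring
    rw [e0, e1]
    simp only [Polynomial.eval_mul, Polynomial.eval_add]
    linear_combination (n₁.eval t ^ 2 * a₁.eval t * a₂.eval t
      + n₁.eval t * m.eval t * a₂.eval t ^ 2) * (CharTwo.two_eq_zero : (2 : k) = 0)

section model

variable [CharP k 2] {S : Set (Line k)} {h : Fin 6 → k} {b : Fin 6 → Fin 6 → k}
  {e₁ e₂ f₁ f₂ : Fin 4 → k}

/-- Over an isotropic line, the rays in a section of the double cover form a conic. -/
lemma IsModel.exists_mem_radical_of_isotropic [IsAlgClosed k] (M : IsModel S h b)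
    (B : IsSymp h e₁ e₂ f₁ f₂) (ha : bil b (plucker e₁ e₂) (plucker e₁ e₂) ≠ 0)
    {A : Polynomial k} (hd : A.natDegree ≤ 2)
    (hA : ∀ t, A.eval t ^ 2 + F₂fun h b (e₁ + t • e₂) * A.eval t + F₄fun h b (e₁ + t • e₂) = 0) :
    ∃ c, ∃ r ∈ radical h b c, r ≠ 0 ∧ bil b r r = c * kleinQ r ∧ klein (plucker e₁ e₂) r = 0 := by
  have two : (2 : k) = 0 := CharTwo.two_eq_zero
  obtain ⟨α₀, α₁, α₂, hα⟩ := exists_coeffs_of_natDegree_le_two hd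
  set p := plucker e₁ e₂ with hp
  set a := bil b p p
  set P₀ := (α₀ + bil b (plucker e₁ f₂) p) • p + a • plucker e₁ f₂ with hP₀
  set Z := (α₁ + bil b (plucker e₁ f₁ + plucker e₂ f₂) p) • p
    + a • (plucker e₁ f₁ + plucker e₂ f₂) with hZ
  set P₁ := (α₂ + bil b (plucker e₂ f₁) p) • p + a • plucker e₂ f₁ with hP₁
  have hvec : ∀ t : k, P₀ + t • Z + t ^ 2 • P₁
      = rayVector h b (e₁ + t • e₂) e₂ (t • f₁ + f₂) (A.eval t) := by
    intro t
    have e0 : plucker (e₁ + t • e₂) e₂ = p := by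
      rw [plucker_add_left, plucker_smul_left, plucker_self, smul_zero, add_zero]
    have e1 : plucker (e₁ + t • e₂) (t • f₁ + f₂) = plucker e₁ f₂
        + t • (plucker e₁ f₁ + plucker e₂ f₂) + t ^ 2 • plucker e₂ f₁ := by
      simp only [plucker_add_left, plucker_add_right, plucker_smul_left, plucker_smul_right]
      module
    have e2 : om h e₂ (t • f₁ + f₂) = 1 := by
      rw [om_add_right, om_smul_right, B.e₂f₁, B.e₂f₂]; ring
    rw [rayVector, e0, e1, e2, hα]
    simp only [bil_add_left, bil_smul_left, hP₀, hZ, hP₁]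
    module
  have hmem : ∀ t : k, lin h (P₀ + t • Z + t ^ 2 • P₁) = 0 ∧
      bil b (P₀ + t • Z + t ^ 2 • P₁) (P₀ + t • Z + t ^ 2 • P₁) = 0 ∧
      kleinQ (P₀ + t • Z + t ^ 2 • P₁) = 0 := by
    intro t
    have e0 : plucker (e₁ + t • e₂) e₂ = p := by
      rw [plucker_add_left, plucker_smul_left, plucker_self, smul_zero, add_zero]
    have e1 : om h (e₁ + t • e₂) e₂ = 0 := by
      rw [om_add_left, om_smul_left, B.e₁e₂, om_self]; ring
    have hb : ¬ IsBasePoint h b (e₁ + t • e₂) := fun hb => ha (by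
      have := hb e₂ e1
      rwa [e0] at this)
    obtain ⟨L, hL, hvL, hw⟩ := M.exists_ray_of_root hb (hA t)
    have h1 := M.isPluckerVector_rayVector (u₂ := t • f₁ + f₂) e1
      (by
        simp only [om_add_left, om_add_right, om_smul_left, om_smul_right, B.e₁f₁, B.e₁f₂, B.e₂f₁,
          B.e₂f₂]
        linear_combination t * two)
      (by
        rw [om_add_right, om_smul_right, B.e₂f₁, B.e₂f₂]
        simp)
      (by rwa [e0]) hL hvL
    rw [hw, ← hvec] at h1
    obtain ⟨h2, h3⟩ := (M.mem_iff L _ h1).1 hL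
    obtain ⟨u, u', -, h4⟩ := h1
    exact ⟨h2, h3, by rw [h4, kleinQ_plucker]⟩
  have lp : lin h p = 0 := by rw [hp, lin_plucker, B.e₁e₂]
  have kp1 : klein p (plucker e₁ f₂) = 0 := klein_plucker_left _ _ _
  have kp2 : klein p (plucker e₁ f₁) = 0 := klein_plucker_left _ _ _
  have kp3 : klein p (plucker e₂ f₂) = 0 := klein_plucker_inner _ _ _
  have kp4 : klein p (plucker e₂ f₁) = 0 := klein_plucker_inner _ _ _
  have kpp : klein p p = 0 := klein_self p
  obtain ⟨c, r, hr, hr0, hrq, x, y, z, rfl⟩ := exists_mem_radical_of_conic (b := b)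
    (ne_zero_of_pf M.pf_ne) (P₀ := P₀) (Z := Z) (P₁ := P₁)
    (by simp only [hP₀, lin_add, lin_smul, lp, lin_plucker, B.e₁f₂]; ring)
    (by
      simp only [hZ, lin_add, lin_smul, lp, lin_plucker, B.e₁f₁, B.e₂f₂]
      linear_combination a * two)
    (by simp only [hP₁, lin_add, lin_smul, lp, lin_plucker, B.e₂f₁]; ring)
    (by
      have h1 := LineCongruence.pf_mul_klein h e₁ f₂ e₂ f₁
      rw [om_comm h f₂ f₁, om_comm h f₂ e₂, B.e₁f₂, B.e₁e₂, B.e₁f₁, B.e₂f₂] at h1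
      intro h0
      rw [hP₀, hP₁] at h0
      simp only [klein_add_left, klein_add_right, klein_smul_left, klein_smul_right, kpp, kp4,
        klein_comm (plucker e₁ f₂) p, kp1] at h0
      have h2 : klein (plucker e₁ f₂) (plucker e₂ f₁) = 0 := by
        have : a * a * klein (plucker e₁ f₂) (plucker e₂ f₁) = 0 := by linear_combination h0
        exact (mul_eq_zero.1 this).resolve_left (mul_ne_zero ha ha)
      rw [h2] at h1
      simp at h1)
    (fun t => (hmem t).2.2) (fun t => (hmem t).2.1)
  refine ⟨c, _, hr, hr0, hrq, ?_⟩
  simp only [hP₀, hZ, hP₁, klein_add_right, klein_smul_right, kpp, kp1, kp2, kp3, kp4]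
  ring

/-- Over a line which is not isotropic, a section of the double cover contains a conic of rays or
the polar line contains a base point. -/
lemma IsModel.exists_mem_radical_of_hyperbolic [IsAlgClosed k] (M : IsModel S h b)
    (B : IsSymp h e₁ e₂ f₁ f₂) (ha : bil b (plucker f₁ e₂) (plucker f₁ e₂) ≠ 0)
    (hb : ∀ κ : k, ¬ IsBasePoint h b (κ • e₂ + f₂)) {A : Polynomial k} (hd : A.natDegree ≤ 2)
    (hA : ∀ t, A.eval t ^ 2 + F₂fun h b (e₁ + t • f₁) * A.eval t + F₄fun h b (e₁ + t • f₁) = 0) :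
    ∃ c, ∃ r ∈ radical h b c, r ≠ 0 ∧ bil b r r = c * kleinQ r ∧ klein (plucker e₁ f₁) r = 0 := by
  have two : (2 : k) = 0 := CharTwo.two_eq_zero
  let P : (Fin 4 → k) → (Fin 4 → k) → Polynomial k := fun x y =>
    Polynomial.C (bil b (plucker f₁ x) (plucker f₁ y)) * Polynomial.X ^ 2
      + Polynomial.C (bil b (plucker e₁ x) (plucker f₁ y) + bil b (plucker f₁ x) (plucker e₁ y))
        * Polynomial.X + Polynomial.C (bil b (plucker e₁ x) (plucker e₁ y))
  have hP : ∀ x y t, (P x y).eval t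
      = bil b (plucker (e₁ + t • f₁) x) (plucker (e₁ + t • f₁) y) := by
    intro x y t
    simp only [P, Polynomial.eval_add, Polynomial.eval_mul, Polynomial.eval_C, Polynomial.eval_X,
      Polynomial.eval_pow, plucker_add_left, plucker_smul_left, bil_add_left, bil_add_right,
      bil_smul_left, bil_smul_right]
    ring
  have hPd : ∀ x y, (P x y).natDegree ≤ 2 := fun x y => Polynomial.natDegree_quadratic_le
  obtain ⟨F, hFd, hF⟩ := (isPoly_F₂fun h b).exists_polynomial_natDegree_le (F₂fun_smul h b) e₁ f₁
  have o1 : ∀ t, om h (e₁ + t • f₁) e₂ = 0 := fun t => by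
    rw [om_add_left, om_smul_left, B.e₁e₂, om_comm, B.e₂f₁]; ring
  have o2 : ∀ t, om h (e₁ + t • f₁) f₂ = 0 := fun t => by
    rw [om_add_left, om_smul_left, B.e₁f₂, B.f₁f₂]; ring
  have H : P e₂ e₂ * P f₂ f₂ = (A + P f₂ e₂) * (A + P f₂ e₂ + F) := Polynomial.funext fun t => by
    simp only [Polynomial.eval_add, Polynomial.eval_mul, hP, hF]
    have h1 := bil_det M.pf_ne b (o1 t) (o2 t)
    have h2 := bil_add_bil M.pf_ne b (o1 t) (o2 t)
    rw [B.e₂f₂] at h1 h2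
    set d := bil b (plucker (e₁ + t • f₁) f₂) (plucker (e₁ + t • f₁) e₂)
    linear_combination h1 - hA t + d * h2
      + (F₄fun h b (e₁ + t • f₁) - d ^ 2 - A.eval t * d) * two
  have hPa : (P e₂ e₂).natDegree = 2 := Polynomial.natDegree_quadratic ha
  rcases exists_isotropic_of_mul_eq hPa hFd
    ((Polynomial.natDegree_add_le _ _).trans (max_le hd (hPd _ _))) H with
    ⟨κ, hκ⟩ | ⟨x₀, x₁, y₀, y₁, hxy, hq⟩
  · refine absurd (fun y hy => ?_) (hb κ)
    set u := κ • e₂ + f₂ with hu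
    have h1 : P u u = 0 := by
      rw [← hκ]
      refine Polynomial.funext fun t => ?_
      have h2 := bil_self_smul_add_smul M.pf_ne b (o1 t) (o2 t) κ 1
      rw [one_smul, B.e₂f₂] at h2
      simp only [Polynomial.eval_add, Polynomial.eval_mul, Polynomial.eval_pow, Polynomial.eval_C,
        hP, hF]
      rw [h2]
      ring
    have c0 := congrArg (fun p => Polynomial.coeff p 0) h1
    have c1 := congrArg (fun p => Polynomial.coeff p 1) h1
    have c2 := congrArg (fun p => Polynomial.coeff p 2) h1
    simp [P, Polynomial.coeff_X, Polynomial.coeff_C] at c0 c1 c2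
    have hy2 : om h y f₂ = κ * om h y e₂ := by
      rw [hu, om_add_left, om_smul_left, om_comm h e₂, om_comm h f₂] at hy
      linear_combination hy - κ * om h y e₂ * two
    have e0 : y = om h y f₁ • e₁ + om h y e₁ • f₁ + om h y e₂ • u := by
      conv_lhs => rw [B.expand y, hy2]
      rw [hu]
      module
    have e1 : plucker u y = om h y f₁ • plucker e₁ u + om h y e₁ • plucker f₁ u := by
      conv_lhs => rw [e0]
      rw [plucker_add_right, plucker_add_right, plucker_smul_right, plucker_smul_right,
        plucker_smul_right, plucker_self, smul_zero, add_zero, plucker_swap u e₁, plucker_swap u f₁]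
    rw [e1]
    simp only [bil_add_left, bil_add_right, bil_smul_left, bil_smul_right]
    linear_combination om h y f₁ ^ 2 * c0 + om h y f₁ * om h y e₁ * c1 + om h y e₁ ^ 2 * c2
  · set g₀ := x₀ • e₂ + y₀ • f₂ with hg₀
    set g₁ := x₁ • e₂ + y₁ • f₂ with hg₁
    have g01 : om h g₀ g₁ = x₀ * y₁ + y₀ * x₁ := by
      simp only [hg₀, hg₁, om_add_left, om_add_right, om_smul_left, om_smul_right, om_self, B.e₂f₂,
        om_comm h f₂ e₂]
      ring
    have oe : ∀ x y : k, om h e₁ (x • e₂ + y • f₂) = 0 := fun x y => by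
      rw [om_add_right, om_smul_right, om_smul_right, B.e₁e₂, B.e₁f₂]; ring
    have of : ∀ x y : k, om h f₁ (x • e₂ + y • f₂) = 0 := fun x y => by
      rw [om_add_right, om_smul_right, om_smul_right, om_comm h f₁, B.e₂f₁, B.f₁f₂]; ring
    have hvec : ∀ t : k, plucker e₁ g₀ + t • (plucker e₁ g₁ + plucker f₁ g₀) + t ^ 2 • plucker f₁ g₁
        = plucker (e₁ + t • f₁) ((x₀ + t * x₁) • e₂ + (y₀ + t * y₁) • f₂) := by
      intro t
      have : (x₀ + t * x₁) • e₂ + (y₀ + t * y₁) • f₂ = g₀ + t • g₁ := by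
        rw [hg₀, hg₁]
        module
      rw [this]
      simp only [plucker_add_left, plucker_add_right, plucker_smul_left, plucker_smul_right]
      module
    have lZ : lin h (plucker e₁ g₁ + plucker f₁ g₀) = 0 := by
      rw [lin_add, lin_plucker, lin_plucker, oe, of, add_zero]
    obtain ⟨c, r, hr, hr0, hrq, x, y, z, rfl⟩ := exists_mem_radical_of_conic (b := b)
      (ne_zero_of_pf M.pf_ne) (P₀ := plucker e₁ g₀) (Z := plucker e₁ g₁ + plucker f₁ g₀)
      (P₁ := plucker f₁ g₁) (by rw [lin_plucker, oe])
      lZ (by rw [lin_plucker, of])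
      (by
        intro h0
        have h1 := LineCongruence.pf_mul_klein h e₁ g₀ f₁ g₁
        rw [h0, oe, oe, B.e₁f₁, g01] at h1
        apply hxy
        linear_combination h1)
      (fun t => by rw [hvec, kleinQ_plucker])
      (fun t => by
        rw [hvec, bil_self_smul_add_smul M.pf_ne b (o1 t) (o2 t), B.e₂f₂]
        have := hq t
        rw [hP, hP, hF] at this
        linear_combination this)
    refine ⟨c, _, hr, hr0, hrq, ?_⟩
    simp only [klein_add_right, klein_smul_right, klein_plucker_left, klein_plucker_inner]
    ring

end model

/-! ### The surface is a component of the splitting locus -/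

lemma Line.isOpen_setOf_ne_zero [Infinite k] {φ : (Fin 6 → k) → k} (hφ : IsPoly φ) {n : ℕ}
    (hs : ∀ c p, φ (c • p) = c ^ n * φ p) :
    IsOpen {L : Line k | ∀ p, L.IsPluckerVector p → φ p ≠ 0} := by
  obtain ⟨f, hf⟩ := hφ
  have hfn : f.IsHomogeneous n := isHomogeneous_of_eval n f fun c v => by rw [hf, hf, hs]
  have : {L : Line k | ∀ p, L.IsPluckerVector p → φ p ≠ 0} = {L | ¬ L.Vanishes f} := by
    ext L
    obtain ⟨p, hp⟩ := L.exists_isPluckerVector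
    simp only [Set.mem_ofPred_eq, Line.vanishes_iff hp hfn, hf]
    refine ⟨fun H => H p hp, fun H q hq => ?_⟩
    obtain ⟨c, hc, rfl⟩ := hp.exists_smul hq
    rw [hs]
    exact mul_ne_zero (pow_ne_zero _ hc) H
  rw [this]
  exact isOpen_not_vanishes hfn

variable [CharP k 2] {S : Set (Line k)} {h : Fin 6 → k} {b : Fin 6 → Fin 6 → k}

/-- A line which splits but is not a ray satisfies one of finitely many closed conditions: it
contains a base point, its polar line contains a base point, or it meets the vertex of a singular
quadric of the pencil. -/
lemma IsModel.exists_mem_radical_of_splits [IsAlgClosed k] (M : IsModel S h b) {l : Line k}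
    (hl : Splits S l) (hlS : l ∉ S) (hb : ∀ v ∈ l.toSubmodule, v ≠ 0 → ¬ IsBasePoint h b v)
    (hperp : ∀ v, v ≠ 0 → IsBasePoint h b v → ∃ u ∈ l.toSubmodule, om h v u ≠ 0)
    {p : Fin 6 → k} (hp : l.IsPluckerVector p) :
    ∃ c, ∃ r ∈ radical h b c, r ≠ 0 ∧ bil b r r = c * kleinQ r ∧ klein r p = 0 := by
  have two : (2 : k) = 0 := CharTwo.two_eq_zero
  have swap : ∀ {x y : Fin 4 → k} {r}, x ∈ l.toSubmodule → y ∈ l.toSubmodule → plucker x y ≠ 0 →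
      klein (plucker x y) r = 0 → klein r p = 0 := by
    intro x y r hx hy hxy h0
    obtain rfl := l.eq_lineOf hx hy hxy
    obtain ⟨c, -, rfl⟩ := isPluckerVector_lineOf.1 hp
    rw [klein_smul_right, klein_comm, h0, mul_zero]
  obtain ⟨x, y, hxy, hlxy⟩ := l.exists_eq_lineOf
  have hx : x ∈ l.toSubmodule := hlxy ▸ left_mem_lineOf
  have hy : y ∈ l.toSubmodule := hlxy ▸ right_mem_lineOf
  by_cases h0 : om h x y = 0
  · obtain ⟨f₁, f₂, B⟩ := exists_isSymp_of_isotropic M.pf_ne hxy h0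
    have ha : bil b (plucker x y) (plucker x y) ≠ 0 := fun ha =>
      hlS (hlxy ▸ (M.lineOf_mem_iff hxy).2 ⟨h0, ha⟩)
    obtain ⟨A, hd, hA⟩ := M.exists_polynomial_root hl hb hx hy hxy
    obtain ⟨c, r, hr, hr0, hrq, hk⟩ := M.exists_mem_radical_of_isotropic B ha hd hA
    exact ⟨c, r, hr, hr0, hrq, swap hx hy hxy hk⟩
  · obtain ⟨z, hz, hxz⟩ : ∃ z ∈ l.toSubmodule, om h x z = 1 :=
      ⟨(om h x y)⁻¹ • y, l.toSubmodule.smul_mem _ hy, by rw [om_smul_right, inv_mul_cancel₀ h0]⟩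
    obtain ⟨e₂, f₂, B⟩ := exists_isSymp_of_hyperbolic M.pf_ne hxz
    -- the vectors of the polar line are not base points
    have hpol : ∀ α β : k, α • e₂ + β • f₂ ≠ 0 → ¬ IsBasePoint h b (α • e₂ + β • f₂) := by
      intro α β hne hbase
      obtain ⟨u, hu, hou⟩ := hperp _ hne hbase
      have hxz0 : plucker x z ≠ 0 := fun h0 => by simp [om, h0] at hxz
      rw [l.eq_lineOf hx hz hxz0] at hu
      obtain ⟨s, t, rfl⟩ := mem_lineOf.1 hu
      apply hou
      simp only [om_add_left, om_add_right, om_smul_left, om_smul_right, om_comm h e₂ x,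
        om_comm h f₂ x, om_comm h f₂ z, B.e₁e₂, B.e₁f₂, B.e₂f₁, B.f₁f₂]
      ring
    obtain ⟨u, hu, hqu⟩ : ∃ u, om h e₂ u = 0 ∧ bil b (plucker e₂ u) (plucker e₂ u) ≠ 0 := by
      have he : (1 : k) • e₂ + (0 : k) • f₂ ≠ 0 := by
        rw [one_smul, zero_smul, add_zero]
        rintro rfl
        have := B.e₂f₂
        simp at this
      have := hpol 1 0 he
      rw [one_smul, zero_smul, add_zero, IsBasePoint] at this
      simpa only [not_forall, exists_prop] using this
    -- replace the basis of the line by a hyperbolic pair adapted to the quadratic form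
    set g := om h u z • x + om h u x • z with hg
    have hgl : g ∈ l.toSubmodule :=
      l.toSubmodule.add_mem (l.toSubmodule.smul_mem _ hx) (l.toSubmodule.smul_mem _ hz)
    have hgu : plucker g e₂ = plucker e₂ u := by
      have e := B.expand u
      rw [om_comm h u e₂, hu, zero_smul, add_zero] at e
      rw [plucker_swap e₂ u, e]
      simp only [hg, plucker_add_left, plucker_smul_left, plucker_self, smul_zero, add_zero]
    have hxg : om h x g = om h u x := by
      rw [hg, om_add_right, om_smul_right, om_smul_right, om_self, hxz]; ring
    have hzg : om h z g = om h u z := by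
      rw [hg, om_add_right, om_smul_right, om_smul_right, om_self, om_comm h z x, hxz]; ring
    obtain ⟨w, hw, hwg, hwe, hwf⟩ : ∃ w ∈ l.toSubmodule, om h w g = 1 ∧ om h w e₂ = 0 ∧
        om h w f₂ = 0 := by
      by_cases hux : om h u x = 0
      · have huz : om h u z ≠ 0 := by
          intro huz
          rw [← hgu, hg, hux, huz, zero_smul, zero_smul, add_zero, plucker_zero_left] at hqu
          simp [bil] at hqu
        refine ⟨(om h u z)⁻¹ • z, l.toSubmodule.smul_mem _ hz, ?_, ?_, ?_⟩
        · rw [om_smul_left, hzg, inv_mul_cancel₀ huz]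
        · rw [om_smul_left, om_comm h z e₂, B.e₂f₁, mul_zero]
        · rw [om_smul_left, B.f₁f₂, mul_zero]
      · refine ⟨(om h u x)⁻¹ • x, l.toSubmodule.smul_mem _ hx, ?_, ?_, ?_⟩
        · rw [om_smul_left, hxg, inv_mul_cancel₀ hux]
        · rw [om_smul_left, B.e₁e₂, mul_zero]
        · rw [om_smul_left, B.e₁f₂, mul_zero]
    have B' : IsSymp h w e₂ g f₂ := by
      refine ⟨hwg, B.e₂f₂, hwe, ?_, hwf, ?_⟩
      · rw [hg, om_add_left, om_smul_left, om_smul_left, B.e₁f₂, B.f₁f₂]; ring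
      · rw [hg, om_add_right, om_smul_right, om_smul_right, om_comm h e₂ x, B.e₁e₂, B.e₂f₁]; ring
    have hwg0 : plucker w g ≠ 0 := fun h0 => by simp [om, h0] at hwg
    obtain ⟨A, hd, hA⟩ := M.exists_polynomial_root hl hb hw hgl hwg0
    obtain ⟨c, r, hr, hr0, hrq, hk⟩ := M.exists_mem_radical_of_hyperbolic B' (by rwa [hgu])
      (fun κ => by
        have := hpol κ 1
        rw [one_smul] at this
        refine this fun h1 => ?_
        have h2 : om h e₂ (κ • e₂ + f₂) = 1 := by
          rw [om_add_right, om_smul_right, om_self, B.e₂f₂]; ring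
        rw [h1] at h2
        simp at h2) hd hA
    exact ⟨c, r, hr, hr0, hrq, swap hw hgl hwg0 hk⟩

/-- The rays through a base point do not fill the surface. -/
lemma IsModel.exists_notMem [IsAlgClosed k] (M : IsModel S h b) {x : Fin 4 → k} (hx : x ≠ 0)
    (hb : IsBasePoint h b x) : ∃ L ∈ S, x ∉ L.toSubmodule := by
  by_contra! H
  obtain ⟨L₀, hL₀⟩ := M.irreducible.nonempty
  obtain ⟨v, -, hv⟩ := M.exists_F₂fun_ne_zero hL₀
  have hFx : F₂fun h b x = 0 := by
    by_contra hF
    exact not_isBasePoint M.pf_ne hF hb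
  have hvx : plucker x v ≠ 0 := by
    intro h0
    obtain ⟨c, rfl⟩ := exists_smul_of_plucker_eq_zero hx h0
    rw [F₂fun_smul, hFx, mul_zero] at hv
    exact hv rfl
  obtain ⟨L, hL, L', hL', hvL, hvL', e⟩ := M.exists_two_rays hv
  rw [Line.eq_lineOf (H L hL) hvL hvx, Line.eq_lineOf (H L' hL') hvL' hvx] at e
  exact hv (by linear_combination -e)

/-- Finitely many open conditions, each satisfied by some ray, which force a splitting line to be a
ray. -/
lemma IsModel.exists_finite_open [IsAlgClosed k] (M : IsModel S h b) :
    ∃ 𝒰 : Set (Set (Line k)), 𝒰.Finite ∧ (∀ U ∈ 𝒰, IsOpen U ∧ (S ∩ U).Nonempty) ∧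
      ∀ l, (∀ U ∈ 𝒰, l ∈ U) → Splits S l → l ∈ S := by
  have two : (2 : k) = 0 := CharTwo.two_eq_zero
  have open_of : ∀ φ : (Fin 6 → k) → k, IsPoly φ → (∀ c p, φ (c • p) = c ^ 1 * φ p) →
      (∃ L ∈ S, ∃ p, L.IsPluckerVector p ∧ φ p ≠ 0) →
      IsOpen {L : Line k | ∀ p, L.IsPluckerVector p → φ p ≠ 0} ∧
      (S ∩ {L : Line k | ∀ p, L.IsPluckerVector p → φ p ≠ 0}).Nonempty := by
    rintro φ hφ hs ⟨L, hL, p, hp, h0⟩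
    refine ⟨Line.isOpen_setOf_ne_zero hφ hs, L, hL, fun q hq => ?_⟩
    obtain ⟨c, hc, rfl⟩ := hp.exists_smul hq
    rw [hs]
    exact mul_ne_zero (pow_ne_zero _ hc) h0
  -- the lines which do not meet the vertex of a singular quadric of the pencil
  have h1 : ∀ c ∈ singularValues h b, ∃ U : Set (Line k), (IsOpen U ∧ (S ∩ U).Nonempty) ∧
      ∀ l ∈ U, ∀ p, l.IsPluckerVector p → ∀ r ∈ radical h b c, r ≠ 0 → klein r p ≠ 0 := by
    rintro c ⟨r, hr, hr0, -⟩
    refine ⟨_, open_of (klein r) (IsPoly.klein (fun i => IsPoly.const (r i)) IsPoly.coord)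
      (fun c p => by rw [klein_smul_right, pow_one])
      (M.exists_klein_ne_zero fun a ha => M.nucleus_notMem_radical c ?_), ?_⟩
    · have ha0 : a ≠ 0 := by
        rintro rfl
        exact hr0 (by rw [ha, zero_smul])
      rw [← inv_smul_smul₀ ha0 (nucleus h), ← ha]
      exact Submodule.smul_mem _ _ hr
    · intro l hl p hp r' hr' hr0'
      obtain ⟨a, rfl⟩ := M.exists_smul_of_mem_radical hr hr0 hr'
      rw [klein_smul_left]
      exact mul_ne_zero (left_ne_zero_of_smul hr0') (hl p hp)
  -- the lines which do not contain a given base point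
  have h2 : ∀ x ∈ {x : ℙ k (Fin 4 → k) | IsBasePoint h b x.rep}, ∃ U : Set (Line k),
      (IsOpen U ∧ (S ∩ U).Nonempty) ∧ ∀ l ∈ U, x.rep ∉ l.toSubmodule := by
    intro x hx
    obtain ⟨L, hL, hxL⟩ := M.exists_notMem x.rep_nonzero hx
    obtain ⟨p, hp⟩ := L.exists_isPluckerVector
    rw [mem_iff_incidence hp] at hxL
    obtain ⟨i, hi⟩ := Function.ne_iff.1 hxL
    refine ⟨_, open_of (fun p => incidence x.rep p i)
      (IsPoly.incidence (fun i => IsPoly.const (x.rep i)) (fun i => IsPoly.coord _) i)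
      (fun c p => by rw [incidence_smul, pow_one]; rfl) ⟨L, hL, p, hp, hi⟩, fun l hl hxl => ?_⟩
    obtain ⟨q, hq⟩ := l.exists_isPluckerVector
    exact hl q hq (congrFun ((mem_iff_incidence hq _).1 hxl) i)
  -- the lines whose polar line does not contain a given base point
  have h3 : ∀ x ∈ {x : ℙ k (Fin 4 → k) | IsBasePoint h b x.rep}, ∃ U : Set (Line k),
      (IsOpen U ∧ (S ∩ U).Nonempty) ∧ ∀ l ∈ U, ∃ u ∈ l.toSubmodule, om h x.rep u ≠ 0 := by
    intro x hx
    obtain ⟨L, hL, hxL⟩ := M.exists_notMem x.rep_nonzero hx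
    obtain ⟨u, v, huv, rfl⟩ := L.exists_eq_lineOf
    set x' := x.rep
    have h0 := ((M.lineOf_mem_iff huv).1 hL).1
    obtain ⟨f₁, f₂, B⟩ := exists_isSymp_of_isotropic M.pf_ne huv h0
    -- the form is the value of `om` at `y` and the intersection of the line with `x^⊥`
    have hform : ∀ y u v, pf h * klein (plucker x' y) (plucker u v)
        + om h x' y * lin h (plucker u v) = om h x' u * om h y v + om h x' v * om h y u := by
      intro y u v
      rw [LineCongruence.pf_mul_klein, lin_plucker]
      linear_combination (om h x' y * om h u v - om h x' u * om h y v) * two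
    obtain ⟨y, hy⟩ : ∃ y, om h x' u * om h y v + om h x' v * om h y u ≠ 0 := by
      have hne : om h x' u • v + om h x' v • u ≠ 0 := by
        intro hz
        have z1 : om h x' u = 0 := by
          have := congrArg (om h f₂) hz
          rwa [om_add_right, om_smul_right, om_smul_right, om_comm h f₂, om_comm h f₂, B.e₂f₂,
            B.e₁f₂, mul_one, mul_zero, add_zero, om_zero_right] at this
        have z2 : om h x' v = 0 := by
          have := congrArg (om h f₁) hz
          rwa [om_add_right, om_smul_right, om_smul_right, om_comm h f₁, om_comm h f₁, B.e₂f₁,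
            B.e₁f₁, mul_one, mul_zero, zero_add, om_zero_right] at this
        apply hxL
        have e := B.expand x'
        rw [z1, z2, zero_smul, zero_smul, add_zero, add_zero] at e
        rw [e]
        exact mem_lineOf.2 ⟨_, _, rfl⟩
      obtain ⟨y, hy⟩ := exists_om_ne_zero M.pf_ne hne
      refine ⟨y, ?_⟩
      rwa [om_comm, om_add_right, om_smul_right, om_smul_right] at hy
    refine ⟨_, open_of (fun p => pf h * klein (plucker x' y) p + om h x' y * lin h p)
      (((IsPoly.const _).mul (IsPoly.klein (fun i => IsPoly.const (plucker x' y i))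
        IsPoly.coord)).add ((IsPoly.const _).mul
        (IsPoly.sum _ fun i => (IsPoly.const _).mul (IsPoly.coord _))))
      (fun c p => by rw [klein_smul_right, lin_smul]; ring)
      ⟨_, hL, _, isPluckerVector_plucker huv, by rwa [hform]⟩, fun l hl => ?_⟩
    obtain ⟨u', v', huv', rfl⟩ := l.exists_eq_lineOf
    have := hl _ (isPluckerVector_plucker huv')
    rw [hform] at this
    by_contra! H
    rw [H u' left_mem_lineOf, H v' right_mem_lineOf] at this
    simp at this
  choose! U₁ hU₁ hU₁' using h1
  choose! U₂ hU₂ hU₂' using h2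
  choose! U₃ hU₃ hU₃' using h3
  refine ⟨U₁ '' singularValues h b ∪ (U₂ '' {x | IsBasePoint h b x.rep}
    ∪ U₃ '' {x | IsBasePoint h b x.rep}), ((finite_singularValues M.pf_ne b).image _).union
      ((M.finite_base.image _).union (M.finite_base.image _)), ?_, fun l hl hs => ?_⟩
  · rintro _ (⟨c, hc, rfl⟩ | ⟨x, hx, rfl⟩ | ⟨x, hx, rfl⟩)
    exacts [hU₁ c hc, hU₂ x hx, hU₃ x hx]
  by_contra hlS
  obtain ⟨p, hp⟩ := l.exists_isPluckerVector
  have hrep : ∀ v, ∀ hv0 : v ≠ 0, IsBasePoint h b v →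
      IsBasePoint h b (Projectivization.mk k v hv0).rep ∧
      ∃ a : k, (Projectivization.mk k v hv0).rep = a • v := by
    intro v hv0 hv
    obtain ⟨a, ha⟩ := Projectivization.exists_smul_eq_mk_rep k v hv0
    rw [← ha]
    exact ⟨hv.smul (a : k), a, rfl⟩
  obtain ⟨c, r, hr, hr0, hrq, hk⟩ := M.exists_mem_radical_of_splits hs hlS
    (fun v hv hv0 hbv => by
      obtain ⟨hb', a, ha⟩ := hrep v hv0 hbv
      refine hU₂' _ hb' l (hl _ (Or.inr (Or.inl ⟨_, hb', rfl⟩))) ?_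
      rw [ha]
      exact l.toSubmodule.smul_mem a hv)
    (fun v hv0 hbv => by
      obtain ⟨hb', a, ha⟩ := hrep v hv0 hbv
      obtain ⟨u, hu, hou⟩ := hU₃' _ hb' l (hl _ (Or.inr (Or.inr ⟨_, hb', rfl⟩)))
      rw [ha, om_smul_left] at hou
      exact ⟨u, hu, right_ne_zero_of_mul hou⟩) hp
  have hc : c ∈ singularValues h b := ⟨r, hr, hr0, hrq⟩
  exact hU₁' c hc l (hl _ (Or.inl ⟨c, hc, rfl⟩)) p hp r hr hr0 hk

/-- An irreducible set of splitting lines which contains `S` satisfies generically the open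
conditions under which splitting lines are rays; a line outside `S` in this set would yield one
which satisfies all of them. -/
theorem IsModel.mem_componentsOf_splittingLocus [IsAlgClosed k] (M : IsModel S h b) :
    S ∈ componentsOf (splittingLocus S) := by
  classical
  refine ⟨⟨M.irreducible, M.subset_splittingLocus⟩, fun T hT hST l hl => ?_⟩
  by_contra hlS
  obtain ⟨𝒰, hfin, hop, hU⟩ := M.exists_finite_open
  obtain ⟨l', hl', hmem⟩ := isIrreducible_iff_sInter.1 hT.1 (insert Sᶜ hfin.toFinset)
    (by
      intro U hU
      rcases Finset.mem_insert.1 hU with rfl | hU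
      · exact M.isClosed.isOpen_compl
      · exact (hop U (hfin.mem_toFinset.1 hU)).1)
    (by
      intro U hU
      rcases Finset.mem_insert.1 hU with rfl | hU
      · exact ⟨l, hl, hlS⟩
      · exact (hop U (hfin.mem_toFinset.1 hU)).2.mono (Set.inter_subset_inter_left _ hST))
  rw [Finset.coe_insert, Set.sInter_insert, hfin.coe_toFinset] at hmem
  exact hmem.1 (hU l' hmem.2 (hT.2 hl'))

end LineCongruence

open LineCongruence in
theorem mainTheorem6 {k : Type*} [Field k] [IsAlgClosed k] [CharP k 2]
    (S : Set (Line k)) (hS : IsDelPezzoCongruence S) :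
    (HasOrder S 2 ∧ HasClass S 2) ∧
    S ∈ componentsOf (splittingLocus S) ∧
    (∃ F₂ F₄ : MvPolynomial (Fin 4) k, IsSteinEquation S F₂ F₄) ∧
    ∀ F₂ F₄ : MvPolynomial (Fin 4) k, IsSteinEquation S F₂ F₄ →
      ∀ L ∈ S, ¬ ∀ v ∈ L.toSubmodule, MvPolynomial.eval v F₂ = 0 := by
  obtain ⟨h, b, M⟩ := hS.exists_isModel
  obtain ⟨F₂, F₄, -, hF⟩ := M.exists_isSteinEquation
  exact ⟨⟨M.hasOrder, M.hasClass⟩, M.mem_componentsOf_splittingLocus, ⟨F₂, F₄, hF⟩,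
    fun _ _ hF' _ hL => M.not_forall_eval_eq_zero hF' hL⟩
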